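/- **Definitions.** A *double category* $\mathcal C$ here has objects, a category $\mathcal C_v$ of vertical morphisms and a category $\mathcal C_h$ of horizontal morphisms on these objects, and a class of commutative squares (with two horizontal and two vertical sides) which contains the identity squares, is closed under horizontal and vertical pasting, and under inverting a pair of parallel invertible sides. A *polytope complex* is a double category $\mathcal C$ with a Grothendieck topology on $\mathcal C_v$ such that: * (V) $\mathcal C_v$ is a preorder with a unique initial object $\varnothing$ and has pullbacks; * (H) $\mathcal C_h$ is a groupoid; * (P) every horizontal $\Sigma\colon A\to B$ induces by pullback an equivalence $\Sigma^*\colon(\mathcal C_v\downarrow B)\to(\mathcal C_v\downarrow A)$, and for every vertical $B'\to B$ there is a unique horizontal $\Sigma^*B'\to B'$ forming a commutative square with $\Sigma$; this square is a pullback square, i.e. every commutative square over $\Sigma$ with right side $B_1\to B'\to B$ factors vertically through it; * (C) if $\{X_\alpha\to X\}$ is a covering family and $\Sigma\colon Y\to X$ is horizontal, then $\{\Sigma^*X_\alpha\to Y\}$ is a covering family; * (B) if $\{X_\alpha\to X\}$ is a family for which there are covering families $\{X_{\alpha\beta}\to X_\alpha\}_\beta$ such that $\{X_{\alpha\beta}\to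 X\}_{\alpha,\beta}$ is a covering family, then $\{X_\alpha\to X\}$ is a covering family. For a polytope complex $\mathcal C$, the category $\mathrm{SC}(\mathcal C)$ has as objects the finite families $\{a_i\}_{i\in I}$ of noninitial objects of $\mathcal C$. A vertical (horizontal) morphism of families $\{a_i\}_{i\in I}\to\{b_j\}_{j\in J}$ is a map $f\colon I\to J$ with vertical (horizontal) morphisms $a_i\to b_{f(i)}$. A vertical morphism is a *sub-map* if $a_i\times_{b_j}a_{i'}=\varnothing$ for all $j$ and all distinct $i,i'\in f^{-1}(j)$, and a *covering sub-map* if moreover $\{a_i\to b_j\}_{i\in f^{-1}(j)}$ is a covering family for every $j$. A morphism $A\to B$ of $\mathrm{SC}(\mathcal C)$ is a diagram $A\xleftarrow{p}A'\xrightarrow{\sigma}B$ with $p$ a sub-map and $\sigma$ horizontal, up to vertical isomorphism of $A'$ compatible with $p$ and $\sigma$; diagrams are composed by pulling back the second sub-map along the first horizontal morphism. It is a *cofibration* (*weak equivalence*) if $p$ is a covering sub-map and the set map of $\sigma$ is injective (bijective). For a Waldhausen category $\mathcal E$, $K_0\mathcal E$ is the abelian group generated by the classes $[A]$ of objects of $\mathcal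 E$ with relations $[A]=[B]$ for weak equivalences $A\to B$ and $[B]=[A]+[B/A]$ for cofibrations $A\to B$ with cofiber $B/A$. **Theorem.** Let $X$ be $E^n$, $S^n$ or $H^n$ with $n\ge 0$, and let $G$ be a subgroup of the group of isometries of $X$. A simplex of $X$ is the convex hull of $n+1$ points of $X$ in general position (contained in an open hemisphere if $X=S^n$), and a polytope of $X$ is a nonempty finite union of simplices. Let $\mathcal C$ be the double category whose objects are the polytopes of $X$ and the empty set, whose vertical morphisms are the inclusions, whose horizontal morphisms $P\to Q$ are the elements $g\in G$ with $g\cdot P=Q$, and in which a square commutes if its two horizontal sides are given by the same element of $G$. Then: 1. there is a Grothendieck topology on $\mathcal C_v$ for which a family $\{P_\alpha\to P\}_{\alpha\in A}$ is a covering family if and only if $\bigcup_{\alpha\in A_0}P_\alpha=P$ for some finite $A_0\subseteq A$, and with it $\mathcal C$ is a polytope complex; 2. $\mathrm{SC}(X):=\mathrm{SC}(\mathcal C)$, with its cofibrations and weak equivalences, is a Waldhausen category; 3. there is an isomorphism $K_0\,\mathrm{SC}(X)\cong\mathcal P(X,G)$ which takes the class of the one-member family $\{P\}$ to $[P]$ for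 every polytope $P$. Here $\mathcal P(X,G)$ is the free abelian group generated by the polytopes of $X$ modulo the relations $[P]=[g\cdot P]$ for polytopes $P$ and $g\in G$, and $[P\cup P']=[P]+[P']$ for polytopes $P,P'$ such that $P\cap P'$ has measure $0$. -/

import Mathlib

open CategoryTheory CategoryTheory.Limits

namespace ScissorsCongruence

universe v w u

/-! ### Double categories and polytope complexes -/

/-- A double category whose squares are a property ("commutative squares").  The given category
structure on `C` is the vertical one; `HHom` is the set of horizontal morphisms.  `Sq σ p q τ` says
that the square with top `σ`, left side `p`, right side `q` and bottom `τ` commutes.  Commutative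
squares contain the identities, are closed under pasting in both directions, and may be inverted
when two parallel sides are invertible, as in any ordinary category. -/
class DoubleCategory (C : Type u) [Category.{v} C] where
  HHom : C → C → Type w
  hid (A : C) : HHom A A
  hcomp {A B D : C} : HHom A B → HHom B D → HHom A D
  hid_hcomp {A B : C} (σ : HHom A B) : hcomp (hid A) σ = σ
  hcomp_hid {A B : C} (σ : HHom A B) : hcomp σ (hid B) = σ
  hcomp_assoc {A B D E : C} (σ : HHom A B) (τ : HHom B D) (ρ : HHom D E) :
    hcomp (hcomp σ τ) ρ = hcomp σ (hcomp τ ρ)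
  Sq {A B A' B' : C} (σ : HHom A B) (p : A ⟶ A') (q : B ⟶ B') (τ : HHom A' B') : Prop
  sq_vid {A B : C} (σ : HHom A B) : Sq σ (𝟙 A) (𝟙 B) σ
  sq_hid {A A' : C} (p : A ⟶ A') : Sq (hid A) p p (hid A')
  sq_hcomp {A B D A' B' D' : C} {σ : HHom A B} {σ' : HHom B D} {p : A ⟶ A'} {q : B ⟶ B'}
    {r : D ⟶ D'} {τ : HHom A' B'} {τ' : HHom B' D'} :
    Sq σ p q τ → Sq σ' q r τ' → Sq (hcomp σ σ') p r (hcomp τ τ')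
  sq_vcomp {A B A' B' A'' B'' : C} {σ : HHom A B} {p : A ⟶ A'} {q : B ⟶ B'} {τ : HHom A' B'}
    {p' : A' ⟶ A''} {q' : B' ⟶ B''} {ρ : HHom A'' B''} :
    Sq σ p q τ → Sq τ p' q' ρ → Sq σ (p ≫ p') (q ≫ q') ρ
  sq_hinv {A B A' B' : C} {σ : HHom A B} {σ' : HHom B A} {p : A ⟶ A'} {q : B ⟶ B'}
    {τ : HHom A' B'} {τ' : HHom B' A'} :
    hcomp σ σ' = hid A → hcomp σ' σ = hid B → hcomp τ τ' = hid A' → hcomp τ' τ = hid B' →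
    Sq σ p q τ → Sq σ' q p τ'
  sq_vinv {A B A' B' : C} {σ : HHom A B} {p : A ⟶ A'} {q : B ⟶ B'} {τ : HHom A' B'}
    [IsIso p] [IsIso q] : Sq σ p q τ → Sq τ (inv p) (inv q) σ

open DoubleCategory

section

variable {C : Type u} [Category.{v} C] [DoubleCategory.{v, w} C]

/-- The square with top `τ : A' → B'`, left side `p`, right side `q` and bottom `σ` is a pullback
of `q` along `σ`: every commutative square over `σ` whose right side factors through `q`
factors (vertically) through it. -/
def IsPullbackSq {A B A' B' : C} (τ : HHom A' B') (p : A' ⟶ A) (q : B' ⟶ B)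
    (σ : HHom A B) : Prop :=
  Sq τ p q σ ∧
    ∀ {A₁ B₁ : C} (τ₁ : HHom A₁ B₁) (p₁ : A₁ ⟶ A) (s : B₁ ⟶ B'),
      Sq τ₁ p₁ (s ≫ q) σ → ∃ r : A₁ ⟶ A', r ≫ p = p₁ ∧ Sq τ₁ r s τ

/-- The family of vertical morphisms `f i : Y i ⟶ X` is a covering family. -/
def IsCovering (J : GrothendieckTopology C) {X : C} {ι : Type*} (Y : ι → C)
    (f : ∀ i, Y i ⟶ X) : Prop :=
  Sieve.ofArrows Y f ∈ J X

/-- The double category `C` with the Grothendieck topology `J` on its vertical category is a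
polytope complex. -/
structure IsPolytopeComplex (J : GrothendieckTopology C) : Prop where
  /-- (V) vertically `C` is a preorder -/
  thin : Quiver.IsThin C
  /-- (V) there is a unique vertically initial object -/
  unique_initial : ∃! X : C, Nonempty (IsInitial X)
  /-- (V) `C` is vertically closed under pullbacks -/
  hasPullbacks : HasPullbacks C
  /-- (H) horizontally `C` is a groupoid -/
  groupoid {A B : C} (σ : HHom A B) : ∃ τ : HHom B A, hcomp σ τ = hid A ∧ hcomp τ σ = hid B
  /-- (P) every horizontal `σ : A → B` induces, by pullback, an equivalence `σ^*` of slice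
  categories, and there is a unique horizontal morphism `σ^* B' → B'` over `σ` -/
  pull {A B : C} (σ : HHom A B) : ∃ Φ : Over B ≌ Over A, ∀ P : Over B,
    (∃! τ : HHom (Φ.functor.obj P).left P.left, Sq τ (Φ.functor.obj P).hom P.hom σ) ∧
    ∀ τ : HHom (Φ.functor.obj P).left P.left, Sq τ (Φ.functor.obj P).hom P.hom σ →
      IsPullbackSq τ (Φ.functor.obj P).hom P.hom σ
  /-- (C) pulling back along a horizontal morphism preserves covering families -/
  cover_pull {X Y : C} (σ : HHom Y X) {ι : Type u} (U : ι → C) (f : ∀ i, U i ⟶ X)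
    (V : ι → C) (g : ∀ i, V i ⟶ Y) (τ : ∀ i, HHom (V i) (U i))
    (h : ∀ i, IsPullbackSq (τ i) (g i) (f i) σ) :
    IsCovering J U f → IsCovering J V g
  /-- (B) a family which has a refinement that is a covering family is a covering family -/
  cover_of_refinement {X : C} {ι : Type u} (U : ι → C) (f : ∀ i, U i ⟶ X) (κ : ι → Type u)
    (V : ∀ i, κ i → C) (g : ∀ i (k : κ i), V i k ⟶ U i) (h : ∀ i, IsCovering J (V i) (g i)) :
    IsCovering J (fun x : Σ i, κ i => V x.1 x.2) (fun x => g x.1 x.2 ≫ f x.1) →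
      IsCovering J U f

/-- A polytope is a (vertically) noninitial object. -/
def IsPolytope (A : C) : Prop := IsEmpty (IsInitial A)

variable (C) in
/-- Objects of `Tw(C_p)`: finite families of polytopes of `C`. -/
structure Tw where
  ι : Type
  fin : Finite ι
  obj : ι → C
  poly : ∀ i, IsPolytope (obj i)

/-- Vertical morphisms of `Tw(C_p)`. -/
structure Tw.VHom (A B : Tw C) where
  map : A.ι → B.ι
  hom : ∀ i, A.obj i ⟶ B.obj (map i)

/-- Horizontal morphisms of `Tw(C_p)` (shuffles). -/
structure Tw.HHom (A B : Tw C) where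
  map : A.ι → B.ι
  hom : ∀ i, DoubleCategory.HHom (A.obj i) (B.obj (map i))

/-- The members of the family `A` lying over the `j`-th member of `B`, with their vertical
morphisms to it. -/
def Tw.VHom.fiberHom {A B : Tw C} (p : Tw.VHom A B) (j : B.ι) (i : {i : A.ι // p.map i = j}) :
    A.obj i.1 ⟶ B.obj j :=
  p.hom i.1 ≫ eqToHom (congrArg B.obj i.2)

/-- A sub-map: the pullback over `b_j` of two distinct members lying over `b_j` is initial. -/
def Tw.VHom.IsSubMap {A B : Tw C} (p : Tw.VHom A B) : Prop :=
  ∀ (j : B.ι) (i i' : {i : A.ι // p.map i = j}), i ≠ i' →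
    ∀ (Z : C) (f : Z ⟶ A.obj i.1) (g : Z ⟶ A.obj i'.1),
      IsPullback f g (p.fiberHom j i) (p.fiberHom j i') → Nonempty (IsInitial Z)

/-- For a sub-map `p`, being a covering sub-map: the members of `A` over `b_j` cover `b_j`. -/
def Tw.VHom.IsCover (J : GrothendieckTopology C) {A B : Tw C} (p : Tw.VHom A B) : Prop :=
  ∀ j : B.ι, IsCovering J (fun i : {i : A.ι // p.map i = j} => A.obj i.1) (p.fiberHom j)

/-- A diagram `A ← A' → B` consisting of a sub-map `A' → A` and a shuffle `A' → B`. -/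
structure Span (A B : Tw C) where
  apex : Tw C
  left : Tw.VHom apex A
  isSubMap : left.IsSubMap
  right : Tw.HHom apex B

/-- Two diagrams are equivalent if there is a vertical isomorphism of their apices which is
compatible with the sub-maps and with the shuffles. -/
def Span.Rel {A B : Tw C} (s t : Span A B) : Prop :=
  ∃ (e : s.apex.ι ≃ t.apex.ι) (ι : ∀ i, s.apex.obj i ≅ t.apex.obj (e i))
    (hl : ∀ i, s.left.map i = t.left.map (e i)) (hr : ∀ i, s.right.map i = t.right.map (e i)),
    (∀ i, s.left.hom i ≫ eqToHom (congrArg A.obj (hl i)) = (ι i).hom ≫ t.left.hom (e i)) ∧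
    ∀ i, Sq (s.right.hom i) (ι i).hom (eqToHom (congrArg B.obj (hr i))) (t.right.hom (e i))

end

/-! ### Pullbacks in a polytope complex -/

lemma isInitial_of_hom {C : Type u} [Category.{v} C] [Quiver.IsThin C] {Z P : C} (f : Z ⟶ P) (hP : IsInitial P) :
    Nonempty (IsInitial Z) :=
  ⟨hP.ofIso ⟨hP.to Z, f, Subsingleton.elim _ _, Subsingleton.elim _ _⟩⟩

lemma Tw.VHom.IsSubMap.disjoint {C : Type u} [Category.{v} C] [Quiver.IsThin C] [HasPullbacks C] {A B : Tw C} {p : Tw.VHom A B}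
    (hp : p.IsSubMap) {i i' : A.ι} (hne : i ≠ i') (hm : p.map i = p.map i') (Z : C)
    (f : Z ⟶ A.obj i) (g : Z ⟶ A.obj i') : Nonempty (IsInitial Z) := by
  obtain ⟨hP⟩ := hp (p.map i') ⟨i, hm⟩ ⟨i', rfl⟩ (fun e => hne (congrArg Subtype.val e)) _ _ _
    (IsPullback.of_hasPullback _ _)
  exact isInitial_of_hom (pullback.lift f g (Subsingleton.elim _ _)) hP

section

variable {C : Type u} [Category.{v} C] [DoubleCategory.{v, w} C]

lemma IsPullbackSq.comparison [Quiver.IsThin C] {A B A' B' A₂ B₂ A₂' B₂' : C}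
    {τ : HHom A' B'} {p : A' ⟶ A} {q : B' ⟶ B} {σ : HHom A B} (h : IsPullbackSq τ p q σ)
    {τ₂ : HHom A₂' B₂'} {p₂ : A₂' ⟶ A₂} {q₂ : B₂' ⟶ B₂} {σ₂ : HHom A₂ B₂}
    (h₂ : IsPullbackSq τ₂ p₂ q₂ σ₂) (a : A ⟶ A₂) (b : B ⟶ B₂) (b' : B' ⟶ B₂')
    [IsIso a] [IsIso b] [IsIso b'] (hs : Sq σ a b σ₂) :
    ∃ e : A' ≅ A₂', Sq τ e.hom b' τ₂ := by
  have h1 := sq_vcomp h.1 hs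
  rw [Subsingleton.elim (q ≫ b) (b' ≫ q₂)] at h1
  obtain ⟨r, -, hr⟩ := h₂.2 _ _ _ h1
  have h2 := sq_vcomp h₂.1 (sq_vinv hs)
  rw [Subsingleton.elim (q₂ ≫ inv b) (inv b' ≫ q)] at h2
  obtain ⟨r', -, -⟩ := h.2 _ _ _ h2
  exact ⟨⟨r, r', Subsingleton.elim _ _, Subsingleton.elim _ _⟩, hr⟩

lemma IsPullbackSq.iso [Quiver.IsThin C] {A B A' B' A₂' : C}
    {τ : HHom A' B'} {p : A' ⟶ A} {q : B' ⟶ B} {σ : HHom A B} (h : IsPullbackSq τ p q σ)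
    {τ₂ : HHom A₂' B'} {p₂ : A₂' ⟶ A} {q₂ : B' ⟶ B} (h₂ : IsPullbackSq τ₂ p₂ q₂ σ) :
    ∃ e : A' ≅ A₂', Sq τ e.hom (𝟙 B') τ₂ :=
  h.comparison h₂ (𝟙 _) (𝟙 _) (𝟙 _) (sq_vid _)

lemma IsPullbackSq.cancel [Quiver.IsThin C] {A B A' B' A'' B'' : C}
    {τ : HHom A' B'} {p : A' ⟶ A} {q : B' ⟶ B} {σ : HHom A B} (h : IsPullbackSq τ p q σ)
    {τ' : HHom A'' B''} {p' : A'' ⟶ A} {q'' : B'' ⟶ B} (h' : IsPullbackSq τ' p' q'' σ)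
    (q' : B'' ⟶ B') : ∃ r : A'' ⟶ A', IsPullbackSq τ' r q' τ := by
  obtain rfl : q' ≫ q = q'' := Subsingleton.elim _ _
  obtain ⟨r, -, hr⟩ := h.2 _ _ _ h'.1
  refine ⟨r, hr, fun τ₁ p₁ s hs => ?_⟩
  have h1 := sq_vcomp hs h.1
  rw [Category.assoc] at h1
  obtain ⟨r₁, -, hr₁⟩ := h'.2 _ _ _ h1
  exact ⟨r₁, Subsingleton.elim _ _, hr₁⟩

namespace IsPolytopeComplex

variable {J : GrothendieckTopology C} (h : IsPolytopeComplex J)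

/-- The chosen pullback `σ^* B'` of a vertical `q : B' ⟶ B` along a horizontal `σ : A → B`. -/
noncomputable def pb {A B B' : C} (σ : HHom A B) (q : B' ⟶ B) : C :=
  ((h.pull σ).choose.functor.obj (Over.mk q)).left

/-- The vertical morphism `σ^* B' ⟶ A`. -/
noncomputable def pbV {A B B' : C} (σ : HHom A B) (q : B' ⟶ B) : h.pb σ q ⟶ A :=
  ((h.pull σ).choose.functor.obj (Over.mk q)).hom

/-- The horizontal morphism `σ^* B' → B'`. -/
noncomputable def pbH {A B B' : C} (σ : HHom A B) (q : B' ⟶ B) : HHom (h.pb σ q) B' :=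
  ((h.pull σ).choose_spec (Over.mk q)).1.choose

lemma pb_isPullbackSq {A B B' : C} (σ : HHom A B) (q : B' ⟶ B) :
    IsPullbackSq (h.pbH σ q) (h.pbV σ q) q σ :=
  ((h.pull σ).choose_spec (Over.mk q)).2 _ ((h.pull σ).choose_spec (Over.mk q)).1.choose_spec.1

lemma hpaste {J : GrothendieckTopology C} (h : IsPolytopeComplex J) {A B D A' B' D' : C} {σ : HHom A B} {σ' : HHom B D} {p : A' ⟶ A} {q : B' ⟶ B}
    {r : D' ⟶ D} {τ : HHom A' B'} {τ' : HHom B' D'} (h₁ : IsPullbackSq τ p q σ)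
    (h₂ : IsPullbackSq τ' q r σ') : IsPullbackSq (hcomp τ τ') p r (hcomp σ σ') := by
  refine ⟨sq_hcomp h₁.1 h₂.1, fun {A₁ D₁} ρ p₁ s hs => ?_⟩
  have hβ := (h.pb_isPullbackSq τ' s).1
  obtain ⟨β', e1, e2⟩ := h.groupoid (h.pbH τ' s)
  obtain ⟨σ'', e3, e4⟩ := h.groupoid σ'
  have h3 := sq_hcomp hs (sq_hinv e1 e2 e3 e4 (sq_vcomp hβ h₂.1))
  rw [hcomp_assoc, e3, hcomp_hid] at h3
  obtain ⟨r', hr, h4⟩ := h₁.2 _ _ _ h3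
  have h5 := sq_hcomp h4 hβ
  rw [hcomp_assoc, e2, hcomp_hid] at h5
  exact ⟨r', hr, h5⟩

lemma id_isPullbackSq {J : GrothendieckTopology C} (h : IsPolytopeComplex J) {B B' : C}
    (q : B' ⟶ B) : IsPullbackSq (hid B') q q (hid B) := by
  have := h.thin
  let Φ := (h.pull (hid B)).choose
  let P := Φ.inverse.obj (Over.mk q)
  let i : (Φ.functor.obj P).left ⟶ B' := (Φ.counitIso.app (Over.mk q)).hom.left
  let i' : B' ⟶ (Φ.functor.obj P).left := (Φ.counitIso.app (Over.mk q)).inv.left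
  obtain ⟨⟨ω, hω, -⟩, hω'⟩ := (h.pull (hid B)).choose_spec P
  have h1 := hω' ω hω
  have h2 := h.pb_isPullbackSq (hid B) (Φ.functor.obj P).hom
  have h3 := h.hpaste h2 h1
  rw [hid_hcomp] at h3
  obtain ⟨e, he⟩ := h3.iso h1
  obtain ⟨ω', e1, e2⟩ := h.groupoid ω
  have h4 := sq_hcomp he (sq_vid ω')
  rw [hcomp_assoc, e1, hcomp_hid] at h4
  refine ⟨sq_hid q, fun τ₁ p₁ s hs => ?_⟩
  rw [Subsingleton.elim (s ≫ q) ((s ≫ i') ≫ (Φ.functor.obj P).hom)] at hs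
  obtain ⟨r, -, hr⟩ := h2.2 _ _ _ hs
  have h5 := sq_vcomp (sq_vcomp hr h4) (sq_hid i)
  rw [Subsingleton.elim (((s ≫ i') ≫ 𝟙 _) ≫ i) s] at h5
  exact ⟨_, Subsingleton.elim _ _, h5⟩

lemma pb_isPolytope {A B B' : C} (σ : HHom A B) (q : B' ⟶ B) (hB : IsPolytope B') :
    IsPolytope (h.pb σ q) := by
  have := h.thin
  refine ⟨fun hi => ?_⟩
  obtain ⟨O, ⟨hO⟩, -⟩ := h.unique_initial
  let Φ := (h.pull σ).choose
  let f : Φ.functor.obj (Over.mk q) ⟶ Φ.functor.obj (Over.mk (hO.to B)) :=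
    Over.homMk (hi.to _) (Subsingleton.elim _ _)
  obtain ⟨hB'⟩ := isInitial_of_hom (Φ.functor.preimage f).left hO
  exact hB.false hB'

lemma pb_disjoint {A B B' B'' : C} (σ : HHom A B) (q : B' ⟶ B) (q' : B'' ⟶ B)
    (hd : ∀ Z : C, (Z ⟶ B') → (Z ⟶ B'') → Nonempty (IsInitial Z)) (Z : C)
    (f : Z ⟶ h.pb σ q) (f' : Z ⟶ h.pb σ q') : Nonempty (IsInitial Z) := by
  have := h.thin
  obtain ⟨O, ⟨hO⟩, -⟩ := h.unique_initial
  let Φ := (h.pull σ).choose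
  let Z₀ : Over A := Over.mk (f ≫ h.pbV σ q)
  let g : Z₀ ⟶ Φ.functor.obj (Over.mk q) := Over.homMk f rfl
  let g' : Z₀ ⟶ Φ.functor.obj (Over.mk q') := Over.homMk f' (Subsingleton.elim _ _)
  let W := Φ.inverse.obj Z₀
  let k : W ⟶ Over.mk q := Φ.functor.preimage ((Φ.counitIso.app Z₀).hom ≫ g)
  let k' : W ⟶ Over.mk q' := Φ.functor.preimage ((Φ.counitIso.app Z₀).hom ≫ g')
  obtain ⟨hW⟩ := hd W.left k.left k'.left
  let O₀ : Over A := Over.mk (hO.to A)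
  let m : W ⟶ Φ.inverse.obj O₀ := Over.homMk (hW.to _) (hW.hom_ext _ _)
  exact isInitial_of_hom (Φ.inverse.preimage m).left hO

end IsPolytopeComplex

/-! ### The category `SC(C)` -/

/-- The identity diagram. -/
def Span.id [Quiver.IsThin C] (A : Tw C) : Span A A where
  apex := A
  left := ⟨fun i => i, fun _ => 𝟙 _⟩
  isSubMap := fun _ i i' hne => (hne (Subtype.ext (i.2.trans i'.2.symm))).elim
  right := ⟨fun i => i, fun _ => hid _⟩

namespace IsPolytopeComplex

variable {J : GrothendieckTopology C} (h : IsPolytopeComplex J)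

/-- The index set of the apex of a composite. -/
abbrev compIdx {A B D : Tw C} (s : Span A B) (t : Span B D) : Type :=
  {x : s.apex.ι × t.apex.ι // t.left.map x.2 = s.right.map x.1}

/-- The vertical morphism to be pulled back. -/
abbrev compV {A B D : Tw C} (s : Span A B) (t : Span B D) (x : compIdx s t) :
    t.apex.obj x.1.2 ⟶ B.obj (s.right.map x.1.1) :=
  t.left.hom x.1.2 ≫ eqToHom (congrArg B.obj x.2)

/-- Composition of diagrams: the sub-map `p ∘ σ^* q` and the shuffle `τ ∘ σ̃`. -/
noncomputable def compSpan {A B D : Tw C} (s : Span A B) (t : Span B D) : Span A D where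
  apex :=
    { ι := compIdx s t
      fin := by
        have := s.apex.fin
        have := t.apex.fin
        infer_instance
      obj := fun x => h.pb (s.right.hom x.1.1) (compV s t x)
      poly := fun x => h.pb_isPolytope _ _ (t.apex.poly _) }
  left :=
    { map := fun x => s.left.map x.1.1
      hom := fun x => h.pbV (s.right.hom x.1.1) (compV s t x) ≫ s.left.hom x.1.1 }
  isSubMap := by
    have := h.thin
    have := h.hasPullbacks
    rintro j ⟨⟨⟨i, k⟩, hx⟩, hj⟩ ⟨⟨⟨i', k'⟩, hx'⟩, hj'⟩ hne Z f g -
    by_cases hi : i = i'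
    · subst hi
      have hk : k ≠ k' := by
        rintro rfl
        exact hne rfl
      exact h.pb_disjoint _ _ _
        (fun Z f g => t.isSubMap.disjoint hk (Eq.trans hx (Eq.symm hx')) Z f g) Z f g
    · exact s.isSubMap.disjoint hi (Eq.trans hj (Eq.symm hj')) Z (f ≫ h.pbV _ _) (g ≫ h.pbV _ _)
  right :=
    { map := fun x => t.right.map x.1.2
      hom := fun x => hcomp (h.pbH (s.right.hom x.1.1) (compV s t x)) (t.right.hom x.1.2) }

lemma rel_equivalence {J : GrothendieckTopology C} (h : IsPolytopeComplex J) (A B : Tw C) : Equivalence (Span.Rel (A := A) (B := B)) := by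
  have := h.thin
  refine ⟨fun s => ⟨Equiv.refl _, fun i => Iso.refl _, fun i => rfl, fun i => rfl,
    fun i => Subsingleton.elim _ _, fun i => sq_vid _⟩, ?_, ?_⟩
  · rintro s t ⟨e, ι, hl, hr, -, hs⟩
    refine ⟨e.symm, fun i => eqToIso (by simp) ≪≫ (ι (e.symm i)).symm, fun i => by simp [hl],
      fun i => by simp [hr], fun i => Subsingleton.elim _ _, fun i => ?_⟩
    obtain ⟨i, rfl⟩ := e.surjective i
    have key : ∀ (k : s.apex.ι) (hk : k = i) (a : t.apex.obj (e i) ⟶ s.apex.obj k)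
        (b : B.obj (t.right.map (e i)) ⟶ B.obj (s.right.map k)),
        Sq (t.right.hom (e i)) a b (s.right.hom k) := by
      rintro k rfl a b
      rw [Subsingleton.elim a (inv (ι k).hom),
        Subsingleton.elim b (inv (eqToHom (congrArg B.obj (hr k))))]
      exact sq_vinv (hs k)
    exact key _ (by simp) _ _
  · rintro s t r ⟨e, ι, hl, hr, -, hs⟩ ⟨e', ι', hl', hr', -, hs'⟩
    refine ⟨e.trans e', fun i => ι i ≪≫ ι' (e i), fun i => (hl i).trans (hl' (e i)),
      fun i => (hr i).trans (hr' (e i)), fun i => Subsingleton.elim _ _, fun i => ?_⟩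
    have := sq_vcomp (hs i) (hs' (e i))
    rw [eqToHom_trans] at this
    exact this

lemma compSpan_rel {A B D : Tw C} {s s' : Span A B} {t t' : Span B D} (hs : s.Rel s')
    (ht : t.Rel t') : (h.compSpan s t).Rel (h.compSpan s' t') := by
  have := h.thin
  obtain ⟨e, ι, hl, hr, -, hsq⟩ := hs
  obtain ⟨e', ι', hl', hr', -, hsq'⟩ := ht
  have hE : ∀ x : s.apex.ι × t.apex.ι, t.left.map x.2 = s.right.map x.1 ↔
      t'.left.map (e.prodCongr e' x).2 = s'.right.map (e.prodCongr e' x).1 := by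
    rintro ⟨i, k⟩
    simp [hr, hl']
  let E : compIdx s t ≃ compIdx s' t' := (e.prodCongr e').subtypeEquiv hE
  have key : ∀ x : compIdx s t, ∃ a : h.pb (s.right.hom x.1.1) (compV s t x) ≅
      h.pb (s'.right.hom (E x).1.1) (compV s' t' (E x)),
      Sq (h.pbH (s.right.hom x.1.1) (compV s t x)) a.hom (ι' x.1.2).hom
        (h.pbH (s'.right.hom (E x).1.1) (compV s' t' (E x))) := fun x =>
    (h.pb_isPullbackSq _ _).comparison (h.pb_isPullbackSq _ _) (ι x.1.1).hom
      (eqToHom (congrArg B.obj (hr x.1.1))) (ι' x.1.2).hom (hsq x.1.1)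
  choose a ha using key
  exact ⟨E, a, fun x => hl x.1.1, fun x => hr' x.1.2, fun x => Subsingleton.elim _ _,
    fun x => sq_hcomp (ha x) (hsq' x.1.2)⟩

/-- The setoid of diagrams `A ← A' → B`. -/
def spanSetoid (A B : Tw C) : Setoid (Span A B) := ⟨Span.Rel, h.rel_equivalence A B⟩

end IsPolytopeComplex

/-- The objects of the category `SC(C)`: finite families of polytopes of `C`. -/
structure SC {J : GrothendieckTopology C} (h : IsPolytopeComplex J) where
  tw : Tw C

namespace SC

variable {J : GrothendieckTopology C} {h : IsPolytopeComplex J}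

/-- A morphism of `SC(C)` is an equivalence class of diagrams `A ← A' → B`. -/
def Hom (A B : SC h) : Type (max 1 u v w) := Quotient (h.spanSetoid A.tw B.tw)

/-- The morphism represented by a diagram. -/
def Hom.mk {A B : SC h} (s : Span A.tw B.tw) : Hom A B := Quotient.mk _ s

lemma id_comp_rel {A B : Tw C} [Quiver.IsThin C] (s : Span A B) :
    (h.compSpan (Span.id A) s).Rel s := by
  let E : IsPolytopeComplex.compIdx (Span.id A) s ≃ s.apex.ι :=
    { toFun := fun x => x.1.2
      invFun := fun k => ⟨(s.left.map k, k), rfl⟩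
      left_inv := by
        rintro ⟨⟨i, k⟩, hx⟩
        have hx' : s.left.map k = i := hx
        subst hx'
        rfl
      right_inv := fun k => rfl }
  have key : ∀ x : IsPolytopeComplex.compIdx (Span.id A) s,
      ∃ a : h.pb (hid (A.obj x.1.1)) (IsPolytopeComplex.compV (Span.id A) s x) ≅
        s.apex.obj x.1.2,
      Sq (h.pbH (hid (A.obj x.1.1)) (IsPolytopeComplex.compV (Span.id A) s x)) a.hom
        (𝟙 _) (hid (s.apex.obj x.1.2)) := by
    exact fun x => (h.pb_isPullbackSq _ _).iso
      (h.id_isPullbackSq (IsPolytopeComplex.compV (Span.id A) s x))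
  choose a ha using key
  refine ⟨E, a, fun x => x.2.symm, fun x => rfl, fun x => Subsingleton.elim _ _, fun x => ?_⟩
  have := sq_hcomp (ha x) (sq_vid (s.right.hom x.1.2))
  rw [hid_hcomp] at this
  exact this

lemma comp_id_rel {A B : Tw C} [Quiver.IsThin C] (s : Span A B) :
    (h.compSpan s (Span.id B)).Rel s := by
  let E : IsPolytopeComplex.compIdx s (Span.id B) ≃ s.apex.ι :=
    { toFun := fun x => x.1.1
      invFun := fun k => ⟨(k, s.right.map k), rfl⟩
      left_inv := by
        rintro ⟨⟨i, k⟩, hx⟩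
        have hx' : k = s.right.map i := hx
        subst hx'
        rfl
      right_inv := fun k => rfl }
  have key : ∀ x : IsPolytopeComplex.compIdx s (Span.id B),
      ∃ a : h.pb (s.right.hom x.1.1) (IsPolytopeComplex.compV s (Span.id B) x) ≅
        s.apex.obj x.1.1,
      Sq (h.pbH (s.right.hom x.1.1) (IsPolytopeComplex.compV s (Span.id B) x)) a.hom
        (eqToHom (congrArg B.obj x.2)) (s.right.hom x.1.1) := fun x =>
    (h.pb_isPullbackSq _ _).comparison
      ⟨sq_vid (s.right.hom x.1.1), fun τ₁ p₁ t ht =>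
        ⟨p₁, Subsingleton.elim _ _, by rwa [Category.comp_id] at ht⟩⟩
      (𝟙 _) (𝟙 _) (eqToHom (congrArg B.obj x.2)) (sq_vid _)
  choose a ha using key
  refine ⟨E, a, fun x => rfl, fun x => x.2, fun x => Subsingleton.elim _ _, fun x => ?_⟩
  have h1 : hcomp (h.pbH (s.right.hom x.1.1) (IsPolytopeComplex.compV s (Span.id B) x))
      (hid (B.obj x.1.2)) = _ := hcomp_hid _
  have h2 := ha x
  rw [← h1] at h2
  exact h2

lemma sq_hcomp_assoc {A A' B D E : C} {τ : HHom A D} {p : A ⟶ A'} {τ₁ : HHom A' B}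
    {τ₂ : HHom B D} (hs : Sq τ p (𝟙 D) (hcomp τ₁ τ₂)) (ρ : HHom D E) :
    Sq (hcomp τ ρ) p (𝟙 E) (hcomp τ₁ (hcomp τ₂ ρ)) := by
  rw [← hcomp_assoc]
  exact sq_hcomp hs (sq_vid ρ)

lemma assoc_rel {A B D E : Tw C} [Quiver.IsThin C] (s : Span A B) (t : Span B D) (r : Span D E) :
    (h.compSpan (h.compSpan s t) r).Rel (h.compSpan s (h.compSpan t r)) := by
  let F : IsPolytopeComplex.compIdx (h.compSpan s t) r ≃
      IsPolytopeComplex.compIdx s (h.compSpan t r) :=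
    { toFun := fun x => ⟨(x.1.1.1.1, ⟨(x.1.1.1.2, x.1.2), x.2⟩), x.1.1.2⟩
      invFun := fun y => ⟨(⟨(y.1.1, y.1.2.1.1), y.2⟩, y.1.2.1.2), y.1.2.2⟩
      left_inv := fun x => rfl
      right_inv := fun y => rfl }
  have key : ∀ x : IsPolytopeComplex.compIdx (h.compSpan s t) r,
      ∃ a : (h.compSpan (h.compSpan s t) r).apex.obj x ≅
          (h.compSpan s (h.compSpan t r)).apex.obj (F x),
        Sq (h.pbH ((h.compSpan s t).right.hom x.1.1) (IsPolytopeComplex.compV (h.compSpan s t) r x))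
          a.hom (𝟙 _)
          (hcomp (h.pbH (s.right.hom (F x).1.1)
              (IsPolytopeComplex.compV s (h.compSpan t r) (F x)))
            (h.pbH (t.right.hom (F x).1.2.1.1)
              (IsPolytopeComplex.compV t r (F x).1.2))) := by
    intro x
    have h1 := h.pb_isPullbackSq ((h.compSpan s t).right.hom x.1.1)
      (IsPolytopeComplex.compV (h.compSpan s t) r x)
    have h2 := h.pb_isPullbackSq (s.right.hom (F x).1.1)
      (IsPolytopeComplex.compV s (h.compSpan t r) (F x))
    have h3 := h.pb_isPullbackSq (t.right.hom (F x).1.2.1.1)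
      (IsPolytopeComplex.compV t r (F x).1.2)
    have h4 := h.pb_isPullbackSq (s.right.hom x.1.1.1.1) (IsPolytopeComplex.compV s t x.1.1)
    obtain ⟨q, h5⟩ := h4.cancel h2
      (h.pbV (t.right.hom (F x).1.2.1.1) (IsPolytopeComplex.compV t r (F x).1.2))
    exact h1.iso (h.hpaste h5 h3)
  choose a ha using key
  refine ⟨F, a, fun x => rfl, fun x => rfl, fun x => Subsingleton.elim _ _, fun x => ?_⟩
  exact sq_hcomp_assoc (ha x) (r.right.hom x.1.2)

/-- `SC(C)` is a category; composition is induced by composition of diagrams. -/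
noncomputable instance : Category.{max 1 u v w} (SC h) where
  Hom A B := Hom A B
  id A := have := h.thin; Hom.mk (Span.id A.tw)
  comp f g := Quotient.map₂ h.compSpan (fun _ _ hs _ _ ht => h.compSpan_rel hs ht) f g
  id_comp f := by
    have := h.thin
    induction f using Quotient.inductionOn with
    | h s => exact Quotient.sound (id_comp_rel s)
  comp_id f := by
    have := h.thin
    induction f using Quotient.inductionOn with
    | h s => exact Quotient.sound (comp_id_rel s)
  assoc f g k := by
    have := h.thin
    induction f using Quotient.inductionOn with
    | h s =>
      induction g using Quotient.inductionOn with
      | h t =>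
        induction k using Quotient.inductionOn with
        | h r => exact Quotient.sound (assoc_rel s t r)

variable (h)

/-- Cofibrations of `SC(C)`: represented by a covering sub-map and a shuffle with injective set
map. -/
def cofibrations : MorphismProperty (SC h) := fun A B f =>
  ∃ s : Span A.tw B.tw, Hom.mk s = f ∧ s.left.IsCover J ∧ Function.Injective s.right.map

/-- Weak equivalences of `SC(C)`: represented by a covering sub-map and a shuffle with bijective
set map. -/
def weakEquivalences : MorphismProperty (SC h) := fun A B f =>
  ∃ s : Span A.tw B.tw, Hom.mk s = f ∧ s.left.IsCover J ∧ Function.Bijective s.right.map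

/-- The object of `SC(C)` given by a single polytope. -/
def single (a : C) (ha : IsPolytope a) : SC h := ⟨⟨Unit, inferInstance, fun _ => a, fun _ => ha⟩⟩

end SC

end

/-! ### Waldhausen categories and `K_0` -/

section

variable {E : Type u} [Category.{v} E]

/-- `E`, with the cofibrations `cof` and the weak equivalences `we`, is a Waldhausen category. -/
structure IsWaldhausen (cof we : MorphismProperty E) : Prop where
  hasZero : HasZeroObject E
  cof_of_iso {A B : E} (f : A ⟶ B) [IsIso f] : cof f
  cof_comp {A B D : E} (f : A ⟶ B) (g : B ⟶ D) : cof f → cof g → cof (f ≫ g)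
  cof_of_zero {Z A : E} (f : Z ⟶ A) : IsZero Z → cof f
  hasPushout {A B D : E} (f : A ⟶ B) (g : A ⟶ D) : cof f → HasPushout f g
  cof_pushout {A B D Q : E} {f : A ⟶ B} {g : A ⟶ D} {i : B ⟶ Q} {j : D ⟶ Q} :
    IsPushout f g i j → cof f → cof j
  we_of_iso {A B : E} (f : A ⟶ B) [IsIso f] : we f
  we_comp {A B D : E} (f : A ⟶ B) (g : B ⟶ D) : we f → we g → we (f ≫ g)
  gluing {A B D Q A' B' D' Q' : E} {f : A ⟶ B} {g : A ⟶ D} {i : B ⟶ Q} {j : D ⟶ Q}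
    {f' : A' ⟶ B'} {g' : A' ⟶ D'} {i' : B' ⟶ Q'} {j' : D' ⟶ Q'}
    (a : A ⟶ A') (b : B ⟶ B') (d : D ⟶ D') (q : Q ⟶ Q') :
    IsPushout f g i j → IsPushout f' g' i' j' → cof f → cof f' → we a → we b → we d →
    f ≫ b = a ≫ f' → g ≫ d = a ≫ g' → i ≫ q = b ≫ i' → j ≫ q = d ≫ j' → we q

/-- The defining relations of `K_0`: `[A] = [B]` for a weak equivalence `A → B`, and
`[B] = [A] + [B/A]` for a cofibration `A → B` with cofiber `B/A` (its pushout along `A → 0`). -/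
def K0Relations (cof we : MorphismProperty E) : Set (FreeAbelianGroup E) :=
  {x | ∃ (A B : E) (f : A ⟶ B), we f ∧ x = FreeAbelianGroup.of A - FreeAbelianGroup.of B} ∪
  {x | ∃ (A B Q Z : E) (f : A ⟶ B) (z : A ⟶ Z) (g : B ⟶ Q) (y : Z ⟶ Q),
    cof f ∧ IsZero Z ∧ IsPushout f z g y ∧
      x = FreeAbelianGroup.of B - (FreeAbelianGroup.of A + FreeAbelianGroup.of Q)}

/-- `K_0` of a Waldhausen category. -/
abbrev K0 (cof we : MorphismProperty E) : Type u :=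
  FreeAbelianGroup E ⧸ AddSubgroup.closure (K0Relations cof we)

/-- The class of an object in `K_0`. -/
def K0.of (cof we : MorphismProperty E) (A : E) : K0 cof we :=
  QuotientAddGroup.mk (FreeAbelianGroup.of A)

end

/-! ### The three geometries -/

/-- Lorentz form `x₀ y₀ - ⟨x', y'⟩` on `ℝ × ℝⁿ`. -/
noncomputable def lorentz {n : ℕ} (x y : ℝ × EuclideanSpace ℝ (Fin n)) : ℝ :=
  x.1 * y.1 - inner ℝ x.2 y.2

/-- Hyperbolic `n`-space: the upper sheet of the hyperboloid `x₀² - |x'|² = 1` in `ℝ × ℝⁿ`. -/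
abbrev Hyperboloid (n : ℕ) : Type :=
  {x : ℝ × EuclideanSpace ℝ (Fin n) // lorentz x x = 1 ∧ 0 < x.1}

/-- The spaces `E^n`, `S^n` and `H^n`. -/
inductive SpaceForm where
  | euclidean (n : ℕ)
  | spherical (n : ℕ)
  | hyperbolic (n : ℕ)

namespace SpaceForm

/-- The set of points: `ℝⁿ`, the unit sphere of `ℝⁿ⁺¹`, or the hyperboloid in `ℝ × ℝⁿ`. -/
abbrev Pt : SpaceForm → Type
  | euclidean n => EuclideanSpace ℝ (Fin n)
  | spherical n => Metric.sphere (0 : EuclideanSpace ℝ (Fin (n + 1))) 1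
  | hyperbolic n => Hyperboloid n

/-- The distance: Euclidean distance, angle, or hyperbolic distance. -/
noncomputable def distance : (X : SpaceForm) → X.Pt → X.Pt → ℝ
  | euclidean _ => fun x y => dist x y
  | spherical _ => fun x y => InnerProductGeometry.angle x.1 y.1
  | hyperbolic _ => fun x y => Real.arcosh (lorentz x.1 y.1)

/-- The group of isometries of `X`. -/
def isometryGroup (X : SpaceForm) : Subgroup (Equiv.Perm X.Pt) where
  carrier := {g | ∀ x y, X.distance (g x) (g y) = X.distance x y}
  mul_mem' := fun {a b} ha hb x y => (ha (b x) (b y)).trans (hb x y)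
  one_mem' := fun _ _ => rfl
  inv_mem' := fun {a} ha x y => by simpa using (ha (a⁻¹ x) (a⁻¹ y)).symm

/-- (Nondegenerate) simplices of `X`: the convex hull of `n + 1` points in general position.  On the
sphere the points have to lie in an open hemisphere.  The convex hull of points of the sphere, or of
the hyperboloid, is the radial projection to it of their convex hull in the ambient vector space. -/
def IsSimplex : (X : SpaceForm) → Set X.Pt → Prop
  | euclidean n => fun s => ∃ p : Fin (n + 1) → EuclideanSpace ℝ (Fin n),
      AffineIndependent ℝ p ∧ s = convexHull ℝ (Set.range p)
  | spherical n => fun s => ∃ p : Fin (n + 1) →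
        Metric.sphere (0 : EuclideanSpace ℝ (Fin (n + 1))) 1,
      (∃ u : EuclideanSpace ℝ (Fin (n + 1)), ∀ i, 0 < inner ℝ u (p i).1) ∧
      LinearIndependent ℝ (fun i => (p i).1) ∧
      s = {x | ∃ r : ℝ, 0 < r ∧ r • x.1 ∈ convexHull ℝ (Set.range fun i => (p i).1)}
  | hyperbolic n => fun s => ∃ p : Fin (n + 1) → Hyperboloid n,
      LinearIndependent ℝ (fun i => (p i).1) ∧
      s = {x | ∃ r : ℝ, 0 < r ∧ r • x.1 ∈ convexHull ℝ (Set.range fun i => (p i).1)}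

/-- The `n`-dimensional volume on `X`: Lebesgue measure, surface measure of the sphere, or
hyperbolic volume, which in the coordinate `y = x'` on the hyperboloid is `dy / √(1 + |y|²)`. -/
noncomputable def vol : (X : SpaceForm) → Set X.Pt → ENNReal
  | euclidean n => fun s =>
      (MeasureTheory.volume : MeasureTheory.Measure (EuclideanSpace ℝ (Fin n))) s
  | spherical n => fun s =>
      (MeasureTheory.volume :
        MeasureTheory.Measure (EuclideanSpace ℝ (Fin (n + 1)))).toSphere s
  | hyperbolic n => fun s =>
      ∫⁻ y : EuclideanSpace ℝ (Fin n) in (fun x : Hyperboloid n => x.1.2) '' s,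
        ENNReal.ofReal (1 / Real.sqrt (1 + ‖y‖ ^ 2))

/-- A finite union of simplices (possibly empty). -/
def IsSimplexUnion (X : SpaceForm) (s : Set X.Pt) : Prop :=
  ∃ F : Set (Set X.Pt), F.Finite ∧ (∀ t ∈ F, X.IsSimplex t) ∧ s = ⋃₀ F

/-- The polytopes of `X`: the nonempty finite unions of simplices. -/
abbrev Polytope (X : SpaceForm) : Type := {s : Set X.Pt // X.IsSimplexUnion s ∧ s.Nonempty}

/-- The defining relations of the scissors congruence group: `[P] = [g P]` for `g ∈ G`, and
`[P ∪ Q] = [P] + [Q]` if `P ∩ Q` has measure zero. -/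
def scissorsRelations (X : SpaceForm) (G : Subgroup (Equiv.Perm X.Pt)) :
    Set (FreeAbelianGroup X.Polytope) :=
  {x | ∃ (P Q : X.Polytope) (g : Equiv.Perm X.Pt), g ∈ G ∧ g '' P.1 = Q.1 ∧
    x = FreeAbelianGroup.of P - FreeAbelianGroup.of Q} ∪
  {x | ∃ P Q R : X.Polytope, X.vol (P.1 ∩ Q.1) = 0 ∧ R.1 = P.1 ∪ Q.1 ∧
    x = FreeAbelianGroup.of R - (FreeAbelianGroup.of P + FreeAbelianGroup.of Q)}

/-- The scissors congruence group `𝒫(X, G)`. -/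
abbrev ScissorsGroup (X : SpaceForm) (G : Subgroup (Equiv.Perm X.Pt)) : Type :=
  FreeAbelianGroup X.Polytope ⧸ AddSubgroup.closure (X.scissorsRelations G)

/-- The class of a polytope in `𝒫(X, G)`. -/
def ScissorsGroup.of (X : SpaceForm) (G : Subgroup (Equiv.Perm X.Pt)) (P : X.Polytope) :
    X.ScissorsGroup G :=
  QuotientAddGroup.mk (FreeAbelianGroup.of P)

/-- The objects of the double category of polytopes of `X` (with the action of `G`): the polytopes
and the empty set. -/
@[ext]
structure Obj (X : SpaceForm) (G : Subgroup (Equiv.Perm X.Pt)) where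
  carrier : Set X.Pt
  isSimplexUnion : X.IsSimplexUnion carrier

variable {X : SpaceForm} {G : Subgroup (Equiv.Perm X.Pt)}

/-- Objects are ordered by inclusion; the vertical morphisms are the inclusions. -/
instance : PartialOrder (X.Obj G) :=
  PartialOrder.lift Obj.carrier (fun _ _ => Obj.ext)

/-- Horizontal morphisms `P → Q` are the `g ∈ G` with `g P = Q`; a square of inclusions and
horizontal morphisms commutes if its two horizontal sides are given by the same element of `G`. -/
instance : DoubleCategory.{0, 0} (X.Obj G) where
  HHom P Q := {g : Equiv.Perm X.Pt // g ∈ G ∧ g '' P.carrier = Q.carrier}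
  hid P := ⟨1, G.one_mem, Set.image_id _⟩
  hcomp g k := ⟨k.1 * g.1, G.mul_mem k.2.1 g.2.1, by
    rw [Equiv.Perm.coe_mul, Set.image_comp, g.2.2, k.2.2]⟩
  hid_hcomp _ := Subtype.ext (mul_one _)
  hcomp_hid _ := Subtype.ext (one_mul _)
  hcomp_assoc _ _ _ := Subtype.ext (mul_assoc _ _ _).symm
  Sq g _ _ k := g.1 = k.1
  sq_vid _ := rfl
  sq_hid _ := rfl
  sq_hcomp h₁ h₂ := congrArg₂ (fun a b => b * a) h₁ h₂
  sq_vcomp h₁ h₂ := h₁.trans h₂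
  sq_hinv {_ _ _ _ g g' _ _ k k'} h₁ _ h₃ _ hs := by
    have e₁ : g'.1 * g.1 = 1 := congrArg Subtype.val h₁
    have e₃ : k'.1 * k.1 = 1 := congrArg Subtype.val h₃
    rw [eq_inv_of_mul_eq_one_left e₁, eq_inv_of_mul_eq_one_left e₃, hs]
  sq_vinv hs := hs.symm

/-- A polytope of `X`, as an object of the double category. -/
def Polytope.toObj (P : X.Polytope) : X.Obj G := ⟨P.1, P.2.1⟩

lemma Polytope.isPolytope_toObj (P : X.Polytope) : IsPolytope (P.toObj : X.Obj G) := by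
  refine ⟨fun hi => ?_⟩
  have h0 : X.IsSimplexUnion (∅ : Set X.Pt) := ⟨∅, Set.finite_empty, by simp, by simp⟩
  have hle : P.1 ⊆ ∅ := leOfHom (hi.to (⟨∅, h0⟩ : X.Obj G))
  exact P.2.2.ne_empty (Set.subset_empty_iff.mp hle)

end SpaceForm

end ScissorsCongruence

open ScissorsCongruence

/-! Geometry enters through three facts. In all three spaces a simplex is the trace of a simplicial
cone in a vector space: on the affine hyperplane at height one, on the unit sphere, or on the
hyperboloid (`ConeModel`). Cones can be cut by hyperplanes, so a simplex is a finite union of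
simplices each of which lies in a given simplex or meets it in a null set
(`ConeModel.exists_subdivision`). Moreover every point of a simplex is a limit of interior points
and simplices are closed, so inclusion up to a null set is inclusion
(`ConeModel.subset_of_null_diff`). Lastly, isometries take simplices to simplices. Hence the finite
unions of simplices form a distributive lattice on which `G` acts by automorphisms. The join is the
union, the meet is the regularized intersection, and disjointness means that the intersection is
null (`Obj.disjoint_iff_vol`). The rest is algebra in this lattice.

For the first claim, distributivity makes finite joins into a topology, and pulling back along `g`
is translation by `g⁻¹`.

For the second claim, a horizontal component `g : a' → b_j` determines `a' = g⁻¹ b_j`. So a morphism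
`A → B` is a finite set of triples `(i, g, j)` whose copies `g⁻¹ b_j` are pairwise disjoint in
`a_i`, and composition multiplies group elements (`spanRel_eq_iff`, `toRel_comp`). It is a
cofibration if the copies fill every `a_i` and every `b_j` is used at most once. To push it out
along `A → D`, each `d_k` is cut along the coarsest common refinement of all partitions transported
from the `a_i`, and the members of `B` that were not used are added (`exists_isRefinement`,
`glue_isPushout`). Gluing is `weq_glue`.

For the third claim, a cofibration cuts `A` into translates of the members of `B` that are used, and
its cofiber consists of the others. Therefore the sum of the classes of the members is defined on
`K_0` (`famCls_of_cof`, `famCls_glue`). Conversely a family is the sum of its members in `K_0`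
(`kcls_eq_sum`), and cutting `P ⊔ Q` into `P` and `Q` is a weak equivalence (`kone_sup`); this gives
the inverse. -/

namespace ScissorsCongruence

/-! ### Simplicial cones and their cuts -/

section SimplicialCone

open scoped NNReal Topology
open Set

variable {V : Type*} [NormedAddCommGroup V] [NormedSpace ℝ V]

/-- The cone spanned by a family of vectors. -/
abbrev coneSpan {ι : Type*} (p : ι → V) : Submodule ℝ≥0 V := Submodule.span ℝ≥0 (range p)

lemma coneSpan_smul_mem {ι : Type*} {p : ι → V} {v : V} {r : ℝ} (hr : 0 ≤ r)
    (hv : v ∈ coneSpan p) : r • v ∈ coneSpan p :=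
  (coneSpan p).smul_mem (⟨r, hr⟩ : ℝ≥0) hv

lemma mem_coneSpan_self {ι : Type*} (p : ι → V) (i : ι) : p i ∈ coneSpan p :=
  Submodule.subset_span (mem_range_self i)

lemma coneSpan_le {ι κ : Type*} {p : ι → V} {q : κ → V} (h : ∀ i, p i ∈ coneSpan q) :
    coneSpan p ≤ coneSpan q :=
  Submodule.span_le.2 (by rintro _ ⟨i, rfl⟩; exact h i)

lemma mem_coneSpan_iff {ι : Type*} [Fintype ι] {p : ι → V} {v : V} :
    v ∈ coneSpan p ↔ ∃ c : ι → ℝ, (∀ i, 0 ≤ c i) ∧ ∑ i, c i • p i = v := by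
  rw [Submodule.mem_span_range_iff_exists_fun]
  constructor
  · rintro ⟨c, hc⟩
    exact ⟨fun i => c i, fun i => (c i).2, hc⟩
  · rintro ⟨c, h0, hc⟩
    exact ⟨fun i => ⟨c i, h0 i⟩, hc⟩

lemma coneSpan_eq_of_basis {ι : Type*} [Fintype ι] (b : Module.Basis ι ℝ V) :
    (coneSpan b : Set V) = {v | ∀ i, 0 ≤ b.repr v i} := by
  ext v
  rw [SetLike.mem_coe, mem_coneSpan_iff]
  constructor
  · rintro ⟨c, h0, rfl⟩ i
    rw [b.repr_sum_self]
    exact h0 i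
  · intro h
    exact ⟨_, h, b.sum_repr v⟩

lemma LinearMap.sign_on_coneSpan {ι : Type*} {p : ι → V} (f : V →ₗ[ℝ] ℝ)
    (h : ∀ i, 0 ≤ f (p i)) {v : V} (hv : v ∈ coneSpan p) : 0 ≤ f v := by
  induction hv using Submodule.span_induction with
  | mem x hx => obtain ⟨i, rfl⟩ := hx; exact h i
  | zero => simp
  | add x y _ _ hx hy => rw [map_add]; exact add_nonneg hx hy
  | smul a x _ hx =>
    have : f (a • x) = (a : ℝ) * f x := f.map_smul (a : ℝ) x
    rw [this]; exact mul_nonneg a.2 hx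

section Cut

variable {ι : Type*} [DecidableEq ι] {p : ι → V} {i j : ι} {a b : ℝ}

lemma coneSpan_update_le (ha : 0 ≤ a) (hb : 0 ≤ b) (k : ι) :
    coneSpan (Function.update p k (a • p i + b • p j)) ≤ coneSpan p := by
  refine coneSpan_le fun l => ?_
  by_cases h : l = k
  · subst h
    rw [Function.update_self]
    exact add_mem (coneSpan_smul_mem ha (mem_coneSpan_self p i))
      (coneSpan_smul_mem hb (mem_coneSpan_self p j))
  · rw [Function.update_of_ne h]
    exact mem_coneSpan_self p l

/-- With `q = a • p i + b • p j`, the hypothesis says that `p i` runs out first: `c i / a` copies of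
`q` use up the term of `p i` and leave the nonnegative coefficient `c j - b * (c i / a)` on `p j`.
-/
lemma mem_coneSpan_update [Fintype ι] (hij : i ≠ j) (ha : 0 < a) (hb : 0 < b) {c : ι → ℝ}
    (hc : ∀ k, 0 ≤ c k) (h : c i / a ≤ c j / b) :
    ∑ k, c k • p k ∈ coneSpan (Function.update p i (a • p i + b • p j)) := by
  have hj : j ∈ Finset.univ.erase i := by simp [hij.symm]
  rw [← Finset.add_sum_erase _ _ (Finset.mem_univ i), ← Finset.add_sum_erase _ _ hj, ← add_assoc]
  set q := Function.update p i (a • p i + b • p j) with hq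
  refine add_mem ?_ (sum_mem fun k hk => ?_)
  · have : c i • p i + c j • p j = (c i / a) • q i + (c j - b * (c i / a)) • q j := by
      rw [hq, Function.update_self, Function.update_of_ne hij.symm]
      rw [smul_add, smul_smul, smul_smul, div_mul_cancel₀ _ ha.ne', add_assoc, ← add_smul]
      congr 2
      ring
    rw [this]
    refine add_mem (coneSpan_smul_mem (div_nonneg (hc i) ha.le) (mem_coneSpan_self q i))
      (coneSpan_smul_mem ?_ (mem_coneSpan_self q j))
    rw [le_div_iff₀ hb] at h
    linarith
  · have hk' : k ≠ i := by
      rintro rfl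
      simp at hk
    have := mem_coneSpan_self q k
    rw [hq, Function.update_of_ne hk'] at this
    exact coneSpan_smul_mem (hc k) this

/-- The cone is cut through a point of the edge from `p i` to `p j`. Which half contains a vector
depends on which of its two coefficients runs out first. -/
lemma coneSpan_eq_union_update [Fintype ι] (hij : i ≠ j) (ha : 0 < a) (hb : 0 < b) :
    (coneSpan p : Set V) = (coneSpan (Function.update p i (a • p i + b • p j)) : Set V) ∪
      (coneSpan (Function.update p j (a • p i + b • p j)) : Set V) := by
  refine subset_antisymm (fun v hv => ?_)
    (union_subset (coneSpan_update_le ha.le hb.le i) (coneSpan_update_le ha.le hb.le j))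
  obtain ⟨c, hc, rfl⟩ := mem_coneSpan_iff.1 hv
  rcases le_total (c i / a) (c j / b) with h | h
  · exact Or.inl (mem_coneSpan_update hij ha hb hc h)
  · right
    rw [add_comm (a • p i)]
    exact mem_coneSpan_update hij.symm hb ha hc h

end Cut

lemma linearIndependent_update_of_coeff {ι : Type*} [Fintype ι] [DecidableEq ι] {p : ι → V}
    (hp : LinearIndependent ℝ p) (i : ι) (c : ι → ℝ) (hc : c i ≠ 0) :
    LinearIndependent ℝ (Function.update p i (∑ k, c k • p k)) := by
  rw [Fintype.linearIndependent_iff] at hp ⊢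
  intro g hg
  -- Expanding the new vector turns a relation `g` of the updated family into a relation of `p`,
  -- with coefficient `g i * c i` at `i` and `g k + g i * c k` elsewhere.
  have e : ∑ k, Function.update (fun k => g k + g i * c k) i (g i * c i) k • p k = 0 := by
    rw [← hg, ← Finset.add_sum_erase _ _ (Finset.mem_univ i),
      ← Finset.add_sum_erase _ (fun k => g k • Function.update p i (∑ k, c k • p k) k)
        (Finset.mem_univ i), Function.update_self, Function.update_self,
      ← Finset.add_sum_erase _ (fun k => c k • p k) (Finset.mem_univ i), smul_add, smul_smul,
      Finset.smul_sum, add_assoc, ← Finset.sum_add_distrib]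
    congr 1
    refine Finset.sum_congr rfl fun k hk => ?_
    have : k ≠ i := by
      rintro rfl
      simp at hk
    rw [Function.update_of_ne this, Function.update_of_ne this, smul_smul, add_smul, add_comm]
  have h := hp _ e
  have hi : g i = 0 := by
    have := h i
    rw [Function.update_self] at this
    exact (mul_eq_zero.1 this).resolve_right hc
  intro k
  by_cases hk : k = i
  · rw [hk, hi]
  · have := h k
    rw [Function.update_of_ne hk, hi] at this
    simpa using this

end SimplicialCone

/-! ### Cone models: subdivision and regularity of simplices -/

/-- A description of the simplices of a space as the traces of simplicial cones of a vector space,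
together with the properties of a volume which are needed to compare them. -/
structure ConeModel (T : Type) (IsS : Set T → Prop) (vol : Set T → ENNReal) (V : Type)
    [NormedAddCommGroup V] [NormedSpace ℝ V] [FiniteDimensional ℝ V] where
  /-- the embedding of the space in the vector space -/
  emb : T → V
  /-- a homogeneous function which is `1` on the space -/
  size : V → ℝ
  continuous_size : Continuous size
  size_emb (x : T) : size (emb x) = 1
  size_smul (r : ℝ) (hr : 0 < r) (v : V) : size (r • v) = r * size v
  -- The sum can vanish on the sphere, for antipodal points.
  add_mem (r s : ℝ) (hr : 0 < r) (hs : 0 < s) (x y : T) : r • emb x + s • emb y ≠ 0 →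
    ∃ t : ℝ, 0 < t ∧ ∃ z : T, t • emb z = r • emb x + s • emb y
  isSimplex_iff (s : Set T) : IsS s ↔ ∃ p : Fin (Module.finrank ℝ V) → T,
    LinearIndependent ℝ (emb ∘ p) ∧ s = emb ⁻¹' (coneSpan (emb ∘ p) : Set V)
  -- Only the null sets of the volume matter, so these few properties replace a measure.
  vol_empty : vol ∅ = 0
  vol_mono {s t : Set T} : s ⊆ t → vol t = 0 → vol s = 0
  vol_union {s t : Set T} : vol s = 0 → vol t = 0 → vol (s ∪ t) = 0
  vol_hyperplane (f : V →ₗ[ℝ] ℝ) : f ≠ 0 → vol (emb ⁻¹' {v | f v = 0}) = 0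
  vol_open (O : Set V) : IsOpen O → (emb ⁻¹' O).Nonempty → vol (emb ⁻¹' O) ≠ 0

namespace ConeModel

open Set
open scoped NNReal Topology

variable {T : Type} {IsS : Set T → Prop} {vol : Set T → ENNReal} {V : Type}
  [NormedAddCommGroup V] [NormedSpace ℝ V] [FiniteDimensional ℝ V] (M : ConeModel T IsS vol V)

/-- The open cone over the space. -/
def K : Set V := {v | ∃ t : ℝ, 0 < t ∧ ∃ z : T, t • M.emb z = v}

lemma emb_mem_K (x : T) : M.emb x ∈ M.K := ⟨1, one_pos, x, one_smul _ _⟩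

lemma smul_mem_K {v : V} (hv : v ∈ M.K) {r : ℝ} (hr : 0 < r) : r • v ∈ M.K := by
  obtain ⟨t, ht, z, rfl⟩ := hv
  exact ⟨r * t, mul_pos hr ht, z, mul_smul _ _ _⟩

lemma add_mem_K {v w : V} (hv : v ∈ M.K) (hw : w ∈ M.K) (h : v + w ≠ 0) : v + w ∈ M.K := by
  obtain ⟨t, ht, z, rfl⟩ := hv
  obtain ⟨t', ht', z', rfl⟩ := hw
  exact M.add_mem _ _ ht ht' _ _ h

lemma emb_ne_zero (x : T) : M.emb x ≠ 0 := by
  intro h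
  have h1 := M.size_emb x
  -- Homogeneity with factor `2` at the zero vector would give `1 = 2`.
  have h2 := M.size_smul 2 two_pos (M.emb x)
  rw [h, smul_zero, ← h, h1] at h2
  norm_num at h2

lemma size_pos {v : V} (hv : v ∈ M.K) : 0 < M.size v := by
  obtain ⟨t, ht, z, rfl⟩ := hv
  rw [M.size_smul t ht, M.size_emb, mul_one]
  exact ht

lemma exists_emb_eq {v : V} (hv : v ∈ M.K) : ∃ z, M.emb z = (M.size v)⁻¹ • v := by
  obtain ⟨t, ht, z, rfl⟩ := hv
  refine ⟨z, ?_⟩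
  rw [M.size_smul t ht, M.size_emb, mul_one, smul_smul, inv_mul_cancel₀ ht.ne', one_smul]

lemma mem_K_of_mem_coneSpan {ι : Type*} {p : ι → V} (hp : ∀ i, p i ∈ M.K) {v : V}
    (hv : v ∈ coneSpan p) : v = 0 ∨ v ∈ M.K := by
  induction hv using Submodule.span_induction with
  | mem x hx => obtain ⟨i, rfl⟩ := hx; exact Or.inr (hp i)
  | zero => exact Or.inl rfl
  | add x y _ _ hx hy =>
    by_cases h : x + y = 0
    · exact Or.inl h
    rcases hx with rfl | hx
    · rwa [zero_add]
    rcases hy with rfl | hy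
    · rw [add_zero]; exact Or.inr hx
    exact Or.inr (M.add_mem_K hx hy h)
  | smul a x _ hx =>
    rcases hx with rfl | hx
    · exact Or.inl (smul_zero _)
    rcases eq_or_ne a 0 with rfl | ha
    · exact Or.inl (zero_smul _ _)
    · exact Or.inr (M.smul_mem_K hx (r := (a : ℝ)) (by exact_mod_cast pos_iff_ne_zero.2 ha))

/-- Generators of a simplicial cone over a simplex of the space. -/
def IsGen (p : Fin (Module.finrank ℝ V) → V) : Prop := LinearIndependent ℝ p ∧ ∀ i, p i ∈ M.K

/-- Rescaling the generators onto the space does not change the cone. Hence cuts may produce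
generators of any length. -/
lemma IsGen.isSimplex {p : Fin (Module.finrank ℝ V) → V} (hp : M.IsGen p) :
    IsS (M.emb ⁻¹' (coneSpan p : Set V)) := by
  choose t ht z hz using hp.2
  obtain rfl : p = fun i => t i • M.emb (z i) := funext fun i => (hz i).symm
  refine (M.isSimplex_iff _).2 ⟨z, ?_, ?_⟩
  · have := hp.1.units_smul (fun i => (Units.mk0 (t i) (ht i).ne')⁻¹)
    convert this using 1
    ext1 i
    change M.emb (z i) = (t i)⁻¹ • t i • M.emb (z i)
    rw [smul_smul, inv_mul_cancel₀ (ht i).ne', one_smul]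
  · congr 1
    refine congrArg SetLike.coe (le_antisymm (coneSpan_le fun i => ?_) (coneSpan_le fun i => ?_))
    · exact coneSpan_smul_mem (ht i).le (mem_coneSpan_self (M.emb ∘ z) i)
    · have := coneSpan_smul_mem (inv_nonneg.2 (ht i).le)
        (mem_coneSpan_self (fun i => t i • M.emb (z i)) i)
      rwa [smul_smul, inv_mul_cancel₀ (ht i).ne', one_smul] at this

lemma exists_isGen {s : Set T} (hs : IsS s) :
    ∃ p, M.IsGen p ∧ s = M.emb ⁻¹' (coneSpan p : Set V) := by
  obtain ⟨p, hp, rfl⟩ := (M.isSimplex_iff _).1 hs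
  exact ⟨_, ⟨hp, fun i => M.emb_mem_K _⟩, rfl⟩

lemma IsGen.update {p : Fin (Module.finrank ℝ V) → V} (hp : M.IsGen p)
    {i j k : Fin (Module.finrank ℝ V)} (hij : i ≠ j) (hk : k = i ∨ k = j) {a b : ℝ} (ha : 0 < a)
    (hb : 0 < b) : M.IsGen (Function.update p k (a • p i + b • p j)) := by
  have e : a • p i + b • p j = ∑ l, (Pi.single i a + Pi.single j b : _ → ℝ) l • p l := by
    simp [add_smul, Finset.sum_add_distrib, Pi.single_apply, ite_smul]
  have hli : LinearIndependent ℝ (Function.update p k (a • p i + b • p j)) := by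
    rw [e]
    refine linearIndependent_update_of_coeff hp.1 k _ ?_
    rcases hk with rfl | rfl
    · simpa [Pi.single_apply, hij] using ha.ne'
    · simpa [Pi.single_apply, hij.symm] using hb.ne'
  refine ⟨hli, fun l => ?_⟩
  by_cases hl : l = k
  · subst hl
    -- Linear independence excludes the zero sum, which `add_mem_K` does not allow.
    have h0 := hli.ne_zero l
    rw [Function.update_self] at h0 ⊢
    exact M.add_mem_K (M.smul_mem_K (hp.2 i) ha) (M.smul_mem_K (hp.2 j) hb) h0
  · rw [Function.update_of_ne hl]
    exact hp.2 l

/-- A simplicial cone can be subdivided by a hyperplane. -/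
lemma exists_subdivision_sign (f : V →ₗ[ℝ] ℝ) (n : ℕ) (p : Fin (Module.finrank ℝ V) → V)
    (hp : M.IsGen p) (hn : (Finset.univ.filter fun i => f (p i) ≠ 0).card = n) :
    ∃ F : Set (Fin (Module.finrank ℝ V) → V), F.Finite ∧
      (∀ q ∈ F, M.IsGen q ∧ ((∀ v ∈ coneSpan q, 0 ≤ f v) ∨ ∀ v ∈ coneSpan q, f v ≤ 0)) ∧
      (coneSpan p : Set V) = ⋃ q ∈ F, (coneSpan q : Set V) := by
  induction n using Nat.strong_induction_on generalizing p with
  | h n ih =>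
  by_cases h1 : ∀ i, 0 ≤ f (p i)
  · exact ⟨{p}, finite_singleton _, fun q hq => by
      rw [mem_singleton_iff.1 hq]
      exact ⟨hp, Or.inl fun v hv => LinearMap.sign_on_coneSpan f h1 hv⟩, by simp⟩
  by_cases h2 : ∀ i, f (p i) ≤ 0
  · exact ⟨{p}, finite_singleton _, fun q hq => by
      rw [mem_singleton_iff.1 hq]
      exact ⟨hp, Or.inr fun v hv => by
        simpa using LinearMap.sign_on_coneSpan (-f) (fun i => by simpa using h2 i) hv⟩, by simp⟩
  push Not at h1 h2
  obtain ⟨j, hj⟩ := h1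
  obtain ⟨i, hi⟩ := h2
  have hij : i ≠ j := by
    rintro rfl
    exact lt_asymm hi hj
  -- The edge crosses the hyperplane `f = 0` in the direction of `q`; both coefficients are positive
  -- because `f (p j) < 0 < f (p i)`.
  set q := (-f (p j)) • p i + f (p i) • p j with hq
  have ha : 0 < -f (p j) := neg_pos.2 hj
  have hfq : f q = 0 := by
    simp only [hq, map_add, map_smul, smul_eq_mul]
    ring
  -- The induction is on the number of generators off the hyperplane. It drops when an end of the
  -- edge is replaced by `q`.
  have key : ∀ k, f (p k) ≠ 0 →
      (Finset.univ.filter fun l => f (Function.update p k q l) ≠ 0).card < n := by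
    intro k hk
    rw [← hn]
    refine Finset.card_lt_card ((Finset.ssubset_iff_of_subset fun l hl => ?_).2 ⟨k, ?_, ?_⟩)
    · by_cases h : l = k
      · subst h
        simp [hfq] at hl
      · simpa [Function.update_of_ne h] using hl
    · simpa using hk
    · simp [hfq]
  obtain ⟨F₁, hF₁, hF₁', e₁⟩ := ih _ (key i hi.ne') _ (hp.update M hij (Or.inl rfl) ha hi) rfl
  obtain ⟨F₂, hF₂, hF₂', e₂⟩ := ih _ (key j hj.ne) _ (hp.update M hij (Or.inr rfl) ha hi) rfl
  refine ⟨F₁ ∪ F₂, hF₁.union hF₂, ?_, ?_⟩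
  · rintro r (hr | hr)
    exacts [hF₁' r hr, hF₂' r hr]
  · rw [biUnion_union, ← e₁, ← e₂]
    exact coneSpan_eq_union_update hij ha hi

/-- A simplicial cone can be subdivided by finitely many hyperplanes. -/
lemma exists_subdivision_signs (L : List (V →ₗ[ℝ] ℝ)) (p : Fin (Module.finrank ℝ V) → V)
    (hp : M.IsGen p) :
    ∃ F : Set (Fin (Module.finrank ℝ V) → V), F.Finite ∧
      (∀ q ∈ F, M.IsGen q ∧
        ∀ f ∈ L, (∀ v ∈ coneSpan q, 0 ≤ f v) ∨ ∀ v ∈ coneSpan q, f v ≤ 0) ∧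
      (coneSpan p : Set V) = ⋃ q ∈ F, (coneSpan q : Set V) := by
  induction L with
  | nil => exact ⟨{p}, finite_singleton _, by simpa using hp, by simp⟩
  | cons f L ih =>
    obtain ⟨F, hF, hF', e⟩ := ih
    have : ∀ q : F, ∃ F' : Set (Fin (Module.finrank ℝ V) → V), F'.Finite ∧
        (∀ r ∈ F', M.IsGen r ∧ ((∀ v ∈ coneSpan r, 0 ≤ f v) ∨ ∀ v ∈ coneSpan r, f v ≤ 0)) ∧
        (coneSpan q.1 : Set V) = ⋃ r ∈ F', (coneSpan r : Set V) :=
      fun q => M.exists_subdivision_sign f _ q.1 (hF' q q.2).1 rfl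
    choose F' h1 h2 h3 using this
    have := hF.to_subtype
    refine ⟨⋃ q : F, F' q, finite_iUnion h1, fun r hr => ?_, ?_⟩
    · obtain ⟨q, hq⟩ := mem_iUnion.1 hr
      refine ⟨(h2 q r hq).1, fun f' hf' => ?_⟩
      rcases List.mem_cons.1 hf' with rfl | hf'
      · exact (h2 q r hq).2
      · have hsub : (coneSpan r : Set V) ⊆ coneSpan q.1 := by
          rw [h3 q]
          exact subset_biUnion_of_mem
            (u := fun r : Fin (Module.finrank ℝ V) → V => (coneSpan r : Set V)) hq
        rcases (hF' q q.2).2 f' hf' with h | h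
        · exact Or.inl fun v hv => h v (hsub hv)
        · exact Or.inr fun v hv => h v (hsub hv)
    · rw [e, biUnion_eq_iUnion]
      simp_rw [h3, mem_iUnion, iUnion_exists]
      ext v
      simp only [mem_iUnion]
      constructor
      · rintro ⟨q, r, hr, hv⟩
        exact ⟨r, q, hr, hv⟩
      · rintro ⟨r, q, hr, hv⟩
        exact ⟨q, r, hr, hv⟩

/-- The basis of the vector space given by the generators of a simplicial cone. -/
noncomputable def IsGen.basis {p : Fin (Module.finrank ℝ V) → V} (hp : M.IsGen p) :
    Module.Basis (Fin (Module.finrank ℝ V)) ℝ V :=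
  basisOfTopLeSpanOfCardEqFinrank p
    (hp.1.span_eq_top_of_card_eq_finrank' (by simp)).ge (by simp)

lemma IsGen.coneSpan_eq {p : Fin (Module.finrank ℝ V) → V} (hp : M.IsGen p) :
    (coneSpan p : Set V) = {v | ∀ i, 0 ≤ (hp.basis M).coord i v} := by
  have := coneSpan_eq_of_basis (hp.basis M)
  rwa [IsGen.basis, coe_basisOfTopLeSpanOfCardEqFinrank] at this

/-- A simplex is a finite union of simplices which are contained in a given simplex or meet it in
a null set. -/
lemma exists_subdivision (M : ConeModel T IsS vol V) {s t : Set T} (hs : IsS s) (ht : IsS t) :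
    ∃ F : Set (Set T), F.Finite ∧ (∀ r ∈ F, IsS r ∧ (r ⊆ t ∨ vol (r ∩ t) = 0)) ∧ s = ⋃₀ F := by
  obtain ⟨p, hp, rfl⟩ := M.exists_isGen hs
  obtain ⟨q, hq, rfl⟩ := M.exists_isGen ht
  -- The cuts are made along the facet hyperplanes of the cone over `t`.
  obtain ⟨F, hF, hF', e⟩ := M.exists_subdivision_signs (List.ofFn (hq.basis M).coord) p hp
  refine ⟨(fun r => M.emb ⁻¹' (coneSpan r : Set V)) '' F, hF.image _, ?_, ?_⟩
  · rintro _ ⟨r, hr, rfl⟩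
    refine ⟨(hF' r hr).1.isSimplex M, ?_⟩
    by_cases h : ∀ i, ∀ v ∈ coneSpan r, 0 ≤ (hq.basis M).coord i v
    · left
      refine preimage_mono fun v hv => ?_
      rw [hq.coneSpan_eq M]
      exact fun i => h i v hv
    · right
      push Not at h
      obtain ⟨i, v, hv, hlt⟩ := h
      -- This coordinate is negative somewhere on the piece, hence nonpositive on all of it, while
      -- it is nonnegative on `t`. So the two meet inside a hyperplane.
      have h2 := ((hF' r hr).2 ((hq.basis M).coord i) (by simp [List.mem_ofFn])).resolve_left
        fun h => (h v hv).not_gt hlt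
      refine M.vol_mono (fun x hx => ?_) (M.vol_hyperplane ((hq.basis M).coord i) fun h0 => ?_)
      · refine le_antisymm (h2 _ hx.1) ?_
        have := hx.2
        rw [mem_preimage, hq.coneSpan_eq M] at this
        exact this i
      · rw [h0] at hlt
        simp at hlt
  · rw [e, sUnion_image, preimage_iUnion₂]

lemma isClosed_coneSpan {p : Fin (Module.finrank ℝ V) → V} (hp : M.IsGen p) :
    IsClosed (coneSpan p : Set V) := by
  rw [hp.coneSpan_eq M, ofPred_forall]
  exact isClosed_iInter fun i => isClosed_le continuous_const
    ((hp.basis M).coord i).continuous_of_finiteDimensional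

lemma isClosed_of_finite (M : ConeModel T IsS vol V) {F : Set (Set T)} (hF : F.Finite)
    (hF' : ∀ r ∈ F, IsS r) : ∃ C : Set V, IsClosed C ∧ ⋃₀ F = M.emb ⁻¹' C := by
  choose! p hp e using fun r hr => M.exists_isGen (hF' r hr)
  refine ⟨⋃ r ∈ F, (coneSpan (p r) : Set V),
    hF.isClosed_biUnion fun r hr => M.isClosed_coneSpan (hp r hr), ?_⟩
  rw [preimage_iUnion₂, sUnion_eq_biUnion]
  exact iUnion₂_congr e

/-- A simplex which is contained in a finite union of simplices up to a null set is contained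
in it. -/
lemma subset_of_null_diff (M : ConeModel T IsS vol V) {s : Set T} (hs : IsS s) {F : Set (Set T)}
    (hF : F.Finite) (hF' : ∀ r ∈ F, IsS r) (h0 : vol (s \ ⋃₀ F) = 0) : s ⊆ ⋃₀ F := by
  obtain ⟨C, hC, e⟩ := M.isClosed_of_finite hF hF'
  obtain ⟨p, hp, rfl⟩ := M.exists_isGen hs
  rw [e] at h0 ⊢
  by_contra hx
  obtain ⟨x, hx, hxC⟩ := not_subset.1 hx
  set b := hp.basis M
  -- All coordinates of `m` are `1`, so adding a positive multiple of it moves `x` into the interior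
  -- of the cone.
  set m := ∑ i, p i with hm
  have hbp : ⇑b = p := coe_basisOfTopLeSpanOfCardEqFinrank _ _ _
  have hbm : ∀ i, b.coord i m = 1 := by
    intro i
    have := b.repr_sum_self (fun _ => (1 : ℝ))
    simp only [hbp, one_smul, ← hm] at this
    rw [Module.Basis.coord_apply, this]
  let I : Set V := {v | ∀ i, 0 < b.coord i v}
  have hI : IsOpen I := by
    simp only [I, ofPred_forall]
    exact isOpen_iInter_of_finite fun i => isOpen_lt continuous_const
      (b.coord i).continuous_of_finiteDimensional
  have hxI : ∀ i, 0 ≤ b.coord i (M.emb x) := by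
    have := hx
    rw [mem_preimage, hp.coneSpan_eq M] at this
    exact this
  -- One coordinate is needed below to see that the moved vector is not zero. It exists because `emb
  -- x` is a nonzero vector.
  have hne : (Nonempty (Fin (Module.finrank ℝ V))) := by
    by_contra h
    rw [not_nonempty_iff] at h
    have : M.emb x = ∑ i, b.repr (M.emb x) i • b i := (b.sum_repr _).symm
    rw [Finset.univ_eq_empty, Finset.sum_empty] at this
    exact M.emb_ne_zero x this
  obtain ⟨i₀⟩ := hne
  -- The moved point, normalized to size one. By continuity it stays outside the closed set `C` for
  -- small `ε`.
  let γ : ℝ → V := fun ε => (M.size (M.emb x + ε • m))⁻¹ • (M.emb x + ε • m)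
  have hγ0 : γ 0 = M.emb x := by simp [γ, M.size_emb]
  have hγ : ContinuousAt γ 0 := by
    have hc : Continuous fun ε : ℝ => M.emb x + ε • m := by fun_prop
    refine ContinuousAt.smul (ContinuousAt.inv₀ (M.continuous_size.comp hc).continuousAt ?_)
      hc.continuousAt
    simp [M.size_emb]
  have hev : ∀ᶠ ε in 𝓝[>] (0 : ℝ), γ ε ∈ Cᶜ := by
    refine (hγ.mono_left nhdsWithin_le_nhds).eventually_mem (hC.isOpen_compl.mem_nhds ?_)
    rw [hγ0]
    exact hxC
  obtain ⟨ε, hεC, hε⟩ := (hev.and self_mem_nhdsWithin).exists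
  have hε : 0 < ε := hε
  have hcoord : ∀ i, 0 < b.coord i (M.emb x + ε • m) := fun i => by
    rw [map_add, map_smul, hbm, smul_eq_mul, mul_one]
    exact add_pos_of_nonneg_of_pos (hxI i) hε
  have hmem : M.emb x + ε • m ∈ M.K := by
    refine (M.mem_K_of_mem_coneSpan hp.2 (v := M.emb x + ε • m) ?_).resolve_left fun h => ?_
    · have : M.emb x + ε • m ∈ (coneSpan p : Set V) := by
        rw [hp.coneSpan_eq M]
        exact fun i => (hcoord i).le
      exact this
    · have := hcoord i₀
      rw [h, map_zero] at this
      exact lt_irrefl _ this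
  obtain ⟨z, hz⟩ := M.exists_emb_eq hmem
  -- The interior of the cone minus `C` is open and meets the space, but its trace lies in the null
  -- set of `h0`.
  refine M.vol_open (Cᶜ ∩ I) (hC.isOpen_compl.inter hI) ⟨z, ?_, ?_⟩ (M.vol_mono ?_ h0)
  · rw [hz]; exact hεC
  · rw [hz]
    intro i
    rw [map_smul]
    exact mul_pos (inv_pos.2 (M.size_pos hmem)) (hcoord i)
  · rintro y ⟨hyC, hyI⟩
    refine ⟨?_, hyC⟩
    rw [mem_preimage, hp.coneSpan_eq M]
    exact fun i => (hyI i).le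

end ConeModel

end ScissorsCongruence

namespace ScissorsCongruence

/-! ### Cone models of the three geometries -/

section Models

open Set MeasureTheory
open scoped NNReal Topology Pointwise

lemma mem_convexHull_range_iff {E ι : Type*} [AddCommGroup E] [Module ℝ E] [Fintype ι]
    {p : ι → E} {x : E} :
    x ∈ convexHull ℝ (range p) ↔
      ∃ c : ι → ℝ, (∀ i, 0 ≤ c i) ∧ ∑ i, c i = 1 ∧ ∑ i, c i • p i = x := by
  constructor
  · refine fun hx => convexHull_min (t := {x | ∃ c : ι → ℝ, (∀ i, 0 ≤ c i) ∧ ∑ i, c i = 1 ∧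
      ∑ i, c i • p i = x}) ?_ ?_ hx
    · classical
      rintro _ ⟨i, rfl⟩
      exact ⟨Pi.single i 1, fun j => by by_cases h : j = i <;> simp [h],
        by simp, by simp [Pi.single_apply, ite_smul]⟩
    · rintro _ ⟨c, h0, h1, rfl⟩ _ ⟨d, k0, k1, rfl⟩ a b ha hb hab
      refine ⟨fun i => a * c i + b * d i,
        fun i => add_nonneg (mul_nonneg ha (h0 i)) (mul_nonneg hb (k0 i)), ?_, ?_⟩
      · rw [Finset.sum_add_distrib, ← Finset.mul_sum, ← Finset.mul_sum, h1, k1]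
        simpa using hab
      · simp only [add_smul, mul_smul, Finset.sum_add_distrib, Finset.smul_sum]
  · rintro ⟨c, h0, h1, rfl⟩
    exact (convex_convexHull ℝ _).sum_mem (fun i _ => h0 i) h1
      fun i _ => subset_convexHull ℝ _ (mem_range_self i)

/-- A conic combination with nonzero value has positive total weight, and dividing by this weight
makes it convex. So the radial projection of a convex hull is the trace of the cone. -/
lemma exists_smul_mem_convexHull_iff {V ι : Type*} [NormedAddCommGroup V] [NormedSpace ℝ V]
    [Fintype ι] {p : ι → V} {x : V} (hx : x ≠ 0) :
    (∃ r : ℝ, 0 < r ∧ r • x ∈ convexHull ℝ (range p)) ↔ x ∈ coneSpan p := by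
  rw [mem_coneSpan_iff]
  constructor
  · rintro ⟨r, hr, h⟩
    obtain ⟨c, h0, -, h2⟩ := mem_convexHull_range_iff.1 h
    refine ⟨fun i => r⁻¹ * c i, fun i => mul_nonneg (inv_nonneg.2 hr.le) (h0 i), ?_⟩
    simp only [mul_smul]
    rw [← Finset.smul_sum, h2, smul_smul, inv_mul_cancel₀ hr.ne', one_smul]
  · rintro ⟨c, h0, rfl⟩
    have hpos : 0 < ∑ i, c i := by
      refine lt_of_le_of_ne (Finset.sum_nonneg fun i _ => h0 i) fun h => hx ?_
      have := (Finset.sum_eq_zero_iff_of_nonneg fun i _ => h0 i).1 h.symm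
      exact Finset.sum_eq_zero fun i hi => by rw [this i hi, zero_smul]
    refine ⟨(∑ i, c i)⁻¹, inv_pos.2 hpos, mem_convexHull_range_iff.2
      ⟨fun i => (∑ i, c i)⁻¹ * c i, fun i => mul_nonneg (inv_nonneg.2 hpos.le) (h0 i), ?_, ?_⟩⟩
    · rw [← Finset.mul_sum, inv_mul_cancel₀ hpos.ne']
    · simp only [mul_smul, Finset.smul_sum]

lemma volume_ker_eq_zero {E : Type*} [NormedAddCommGroup E] [NormedSpace ℝ E] [MeasurableSpace E]
    [BorelSpace E] [FiniteDimensional ℝ E] (μ : Measure E) [μ.IsAddHaarMeasure]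
    (φ : E →ₗ[ℝ] ℝ) (hφ : φ ≠ 0) : μ {x | φ x = 0} = 0 :=
  Measure.addHaar_submodule μ (LinearMap.ker φ) fun h => hφ (LinearMap.ker_eq_top.1 h)

/-- Changes the index type from `Fin (n + 1)` to the `Fin (finrank ℝ V)` of `ConeModel`. The
predicate is given for all lengths so that the equation can be substituted. -/
lemma exists_fin_finrank_iff {V : Type*} [AddCommGroup V] [Module ℝ V] {d : ℕ}
    (hd : Module.finrank ℝ V = d) {T : Type*} {Φ : ∀ k : ℕ, (Fin k → T) → Prop} :
    (∃ p : Fin d → T, Φ d p) ↔ ∃ p : Fin (Module.finrank ℝ V) → T, Φ _ p := by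
  subst hd
  rfl

/-! #### Euclidean space -/

/-- The first coordinate of a linear relation at height one says that the weights sum to zero, which
is the constraint in an affine relation. -/
lemma linearIndependent_prod_one_iff {E ι : Type*} [AddCommGroup E] [Module ℝ E] [Fintype ι]
    {p : ι → E} :
    LinearIndependent ℝ (fun i => ((1 : ℝ), p i)) ↔ AffineIndependent ℝ p := by
  rw [Fintype.linearIndependent_iff, affineIndependent_iff]
  constructor
  · classical
    intro h s w h0 h1 e he
    have := h (fun i => if i ∈ s then w i else 0) (by
      simp only [ite_smul, zero_smul, Prod.smul_mk, smul_eq_mul, mul_one, ← Finset.sum_filter,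
        Finset.filter_mem_eq_inter, Finset.univ_inter]
      rw [Prod.ext_iff]
      simp [Prod.fst_sum, Prod.snd_sum, h0, h1]) e
    simpa [he] using this
  · intro h w hw i
    rw [Prod.ext_iff] at hw
    simp only [Prod.smul_mk, Prod.fst_sum, Prod.snd_sum, smul_eq_mul, mul_one] at hw
    exact h Finset.univ w hw.1 hw.2 i (Finset.mem_univ i)

/-- The model of Euclidean space as an affine hyperplane. -/
noncomputable def euclideanModel (n : ℕ) :
    ConeModel (SpaceForm.euclidean n).Pt (SpaceForm.euclidean n).IsSimplex
      (SpaceForm.euclidean n).vol (ℝ × EuclideanSpace ℝ (Fin n)) where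
  emb x := (1, x)
  size v := v.1
  continuous_size := continuous_fst
  size_emb _ := rfl
  size_smul _ _ _ := rfl
  add_mem r s hr hs x y _ := by
    have h : r + s ≠ 0 := (add_pos hr hs).ne'
    refine ⟨r + s, add_pos hr hs, (r + s)⁻¹ • (r • x + s • y), ?_⟩
    ext1
    · simp
    · simp only [Prod.smul_mk, Prod.snd_add]
      rw [smul_smul, mul_inv_cancel₀ h, one_smul]
  isSimplex_iff s := by
    have hd : Module.finrank ℝ (ℝ × EuclideanSpace ℝ (Fin n)) = n + 1 := by
      simp [add_comm]
    refine Iff.trans ?_ (exists_fin_finrank_iff hd (Φ := fun k p =>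
      LinearIndependent ℝ ((fun x : EuclideanSpace ℝ (Fin n) => ((1 : ℝ), x)) ∘ p) ∧
      s = (fun x : EuclideanSpace ℝ (Fin n) => ((1 : ℝ), x)) ⁻¹'
        (coneSpan ((fun x : EuclideanSpace ℝ (Fin n) => ((1 : ℝ), x)) ∘ p) : Set _)))
    refine exists_congr fun p => and_congr linearIndependent_prod_one_iff.symm ?_
    -- At height one the first coordinate of a conic combination is its total weight, so it is a
    -- convex combination.
    suffices h : convexHull ℝ (range p) = (fun x : EuclideanSpace ℝ (Fin n) => ((1 : ℝ), x)) ⁻¹'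
        (coneSpan ((fun x : EuclideanSpace ℝ (Fin n) => ((1 : ℝ), x)) ∘ p) : Set _) by rw [h]
    ext x
    rw [mem_convexHull_range_iff, mem_preimage, SetLike.mem_coe, mem_coneSpan_iff]
    refine exists_congr fun c => and_congr_right fun _ => ?_
    rw [Prod.ext_iff]
    simp [Prod.fst_sum, Prod.snd_sum]
  vol_empty := measure_empty
  vol_mono h h0 := measure_mono_null h h0
  vol_union h h' := measure_union_null h h'
  vol_hyperplane f hf := by
    change volume {x : EuclideanSpace ℝ (Fin n) | f (1, x) = 0} = 0
    set φ := f.comp (LinearMap.inr ℝ ℝ (EuclideanSpace ℝ (Fin n))) with hφ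
    have key : ∀ x, f (1, x) = f (1, 0) + φ x := fun x => by
      rw [hφ, LinearMap.comp_apply, ← map_add]
      simp
    -- If the linear part vanishes, `f` is a nonzero constant at height one and the section is
    -- empty. Otherwise the section is empty or a translate of the kernel of `φ`.
    by_cases h : φ = 0
    · have h1 : f (1, 0) ≠ 0 := fun h1 => hf (by
        refine LinearMap.ext fun v => ?_
        have : v = v.1 • ((1 : ℝ), (0 : EuclideanSpace ℝ (Fin n))) + (0, v.2) := by
          ext1 <;> simp
        rw [this, map_add, map_smul, h1, smul_zero, zero_add]
        exact LinearMap.congr_fun h v.2)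
      have e : {x : EuclideanSpace ℝ (Fin n) | f (1, x) = 0} = ∅ :=
        eq_empty_of_forall_notMem fun x hx => h1 (by
          have hx : f (1, x) = 0 := hx
          rwa [key, h, LinearMap.zero_apply, add_zero] at hx)
      rw [e, measure_empty]
    · rcases eq_empty_or_nonempty {x : EuclideanSpace ℝ (Fin n) | f (1, x) = 0} with h0 | ⟨x₀, hx₀⟩
      · rw [h0, measure_empty]
      have hx₀ : f (1, 0) + φ x₀ = 0 := by rw [← key]; exact hx₀
      have e : {x : EuclideanSpace ℝ (Fin n) | f (1, x) = 0} =
          (fun x => x + (-x₀)) ⁻¹' {x | φ x = 0} := by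
        ext x
        rw [mem_preimage, mem_ofPred_eq, mem_ofPred_eq, key, map_add, map_neg]
        constructor <;> intro h <;> linarith
      rw [e, measure_preimage_add_right]
      exact volume_ker_eq_zero _ φ h
  vol_open O hO hne :=
    (hO.preimage (by fun_prop : Continuous fun x : EuclideanSpace ℝ (Fin n) => ((1 : ℝ), x))
      ).measure_ne_zero _ hne

/-! #### The sphere -/

/-- The model of the sphere in the ambient vector space. -/
noncomputable def sphericalModel (n : ℕ) :
    ConeModel (SpaceForm.spherical n).Pt (SpaceForm.spherical n).IsSimplex
      (SpaceForm.spherical n).vol (EuclideanSpace ℝ (Fin (n + 1))) where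
  emb x := x.1
  size v := ‖v‖
  continuous_size := continuous_norm
  size_emb x := by simp
  size_smul r hr v := by rw [norm_smul, Real.norm_of_nonneg hr.le]
  add_mem r s hr hs x y h := by
    set v := r • x.1 + s • y.1 with hv
    have hn : ‖v‖ ≠ 0 := norm_ne_zero_iff.2 h
    refine ⟨‖v‖, norm_pos_iff.2 h, ⟨‖v‖⁻¹ • v, ?_⟩, ?_⟩
    · rw [mem_sphere_zero_iff_norm, norm_smul, norm_inv, norm_norm, inv_mul_cancel₀ hn]
    · change ‖v‖ • ‖v‖⁻¹ • v = v
      rw [smul_smul, mul_inv_cancel₀ hn, one_smul]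
  isSimplex_iff s := by
    have hd : Module.finrank ℝ (EuclideanSpace ℝ (Fin (n + 1))) = n + 1 := by simp
    refine Iff.trans ?_ (exists_fin_finrank_iff hd
      (T := Metric.sphere (0 : EuclideanSpace ℝ (Fin (n + 1))) 1) (Φ := fun k p =>
      LinearIndependent ℝ
        ((fun x : Metric.sphere (0 : EuclideanSpace ℝ (Fin (n + 1))) 1 => x.1) ∘ p)
      ∧ s = (fun x : Metric.sphere (0 : EuclideanSpace ℝ (Fin (n + 1))) 1 => x.1) ⁻¹' (coneSpan
        ((fun x : Metric.sphere (0 : EuclideanSpace ℝ (Fin (n + 1))) 1 => x.1) ∘ p) : Set _)))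
    refine exists_congr fun p => ?_
    have hs : {x : Metric.sphere (0 : EuclideanSpace ℝ (Fin (n + 1))) 1 |
        ∃ r : ℝ, 0 < r ∧ r • x.1 ∈ convexHull ℝ (range fun i => (p i).1)} =
        (fun x : Metric.sphere (0 : EuclideanSpace ℝ (Fin (n + 1))) 1 => x.1) ⁻¹' (coneSpan
        ((fun x : Metric.sphere (0 : EuclideanSpace ℝ (Fin (n + 1))) 1 => x.1) ∘ p) : Set _) := by
      ext x
      exact exists_smul_mem_convexHull_iff (ne_zero_of_mem_unit_sphere x)
    rw [← hs]
    constructor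
    · rintro ⟨-, h⟩
      exact h
    -- The hemisphere condition is automatic: the functional which is `1` on the basis formed by the
    -- vertices is the inner product with some vector.
    · rintro ⟨h1, h2⟩
      refine ⟨?_, h1, h2⟩
      let b := basisOfLinearIndependentOfCardEqFinrank h1 (by simp)
      have hb : ⇑b = fun i => (p i).1 := coe_basisOfLinearIndependentOfCardEqFinrank _ _
      let f : EuclideanSpace ℝ (Fin (n + 1)) →ₗ[ℝ] ℝ := b.constr ℝ fun _ => (1 : ℝ)
      refine ⟨(InnerProductSpace.toDual ℝ _).symm (LinearMap.toContinuousLinearMap f), fun i => ?_⟩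
      rw [InnerProductSpace.toDual_symm_apply]
      have : f (b i) = 1 := b.constr_basis ℝ _ i
      rw [hb] at this
      change 0 < f (p i).1
      rw [this]
      exact one_pos
  vol_empty := measure_empty
  vol_mono h h0 := measure_mono_null h h0
  vol_union h h' := measure_union_null h h'
  vol_hyperplane f hf := by
    change (volume : Measure (EuclideanSpace ℝ (Fin (n + 1)))).toSphere
      {x | f x.1 = 0} = 0
    have hc : Continuous f := f.continuous_of_finiteDimensional
    have hm : MeasurableSet {x : Metric.sphere (0 : EuclideanSpace ℝ (Fin (n + 1))) 1 |
        f x.1 = 0} :=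
      (isClosed_eq (hc.comp continuous_subtype_val) continuous_const).measurableSet
    rw [Measure.toSphere_apply' _ hm]
    -- Surface measure is a multiple of the volume of the cone over the set, and this cone lies in
    -- the hyperplane `f = 0`.
    refine mul_eq_zero_of_right _ (measure_mono_null ?_ (volume_ker_eq_zero volume f hf))
    rintro _ ⟨r, -, _, ⟨x, hx, rfl⟩, rfl⟩
    change f (r • x.1) = 0
    rw [map_smul, show f x.1 = 0 from hx, smul_zero]
  vol_open O hO hne := (hO.preimage continuous_subtype_val).measure_ne_zero _ hne

/-! #### Hyperbolic space -/

section Hyperbolic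

variable {n : ℕ}

/-- The Lorentz form as a bilinear form. -/
noncomputable def lorentzForm (n : ℕ) : LinearMap.BilinForm ℝ (ℝ × EuclideanSpace ℝ (Fin n)) :=
  LinearMap.mk₂ ℝ lorentz
    (fun x x' y => by simp only [lorentz, Prod.fst_add, Prod.snd_add, inner_add_left]; ring)
    (fun c x y => by
      simp only [lorentz, Prod.smul_fst, Prod.smul_snd, inner_smul_left, smul_eq_mul]
      simp; ring)
    (fun x y y' => by simp only [lorentz, Prod.fst_add, Prod.snd_add, inner_add_right]; ring)
    (fun c x y => by
      simp only [lorentz, Prod.smul_fst, Prod.smul_snd, inner_smul_right, smul_eq_mul]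
      ring)

lemma lorentzForm_apply (x y : ℝ × EuclideanSpace ℝ (Fin n)) : lorentzForm n x y = lorentz x y :=
  rfl

lemma lorentz_comm (x y : ℝ × EuclideanSpace ℝ (Fin n)) : lorentz x y = lorentz y x := by
  rw [lorentz, lorentz, real_inner_comm, mul_comm]

lemma continuous_lorentz_self :
    Continuous fun x : ℝ × EuclideanSpace ℝ (Fin n) => lorentz x x := by
  unfold lorentz
  fun_prop

lemma lorentz_smul_self (r : ℝ) (x : ℝ × EuclideanSpace ℝ (Fin n)) :
    lorentz (r • x) (r • x) = r ^ 2 * lorentz x x := by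
  rw [← lorentzForm_apply, map_smul, map_smul, LinearMap.smul_apply, lorentzForm_apply]
  simp only [smul_eq_mul]
  ring

/-- The reversed Cauchy–Schwarz inequality, from `(1 + ‖x'‖²)(1 + ‖y'‖²) ≥ (1 + ‖x'‖ ‖y'‖)²`. -/
lemma one_le_lorentz (x y : Hyperboloid n) : 1 ≤ lorentz x.1 y.1 := by
  have hx := x.2.1
  have hy := y.2.1
  simp only [lorentz, real_inner_self_eq_norm_sq] at hx hy ⊢
  have h1 := real_inner_le_norm x.1.2 y.1.2
  have h2 : 1 + ‖x.1.2‖ * ‖y.1.2‖ ≤ x.1.1 * y.1.1 := by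
    refine (abs_le_of_sq_le_sq' ?_ (mul_pos x.2.2 y.2.2).le).2
    have e : (x.1.1 * y.1.1) ^ 2 = (1 + ‖x.1.2‖ ^ 2) * (1 + ‖y.1.2‖ ^ 2) := by
      linear_combination y.1.1 ^ 2 * hx + (1 + ‖x.1.2‖ ^ 2) * hy
    rw [e]
    nlinarith [sq_nonneg (‖x.1.2‖ - ‖y.1.2‖)]
  linarith

/-- The point of the hyperboloid with given coordinate. -/
noncomputable def Hyperboloid.ofCoord (y : EuclideanSpace ℝ (Fin n)) : Hyperboloid n :=
  ⟨(Real.sqrt (1 + ‖y‖ ^ 2), y), by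
    simp only [lorentz, real_inner_self_eq_norm_sq]
    rw [Real.mul_self_sqrt (by positivity)]
    ring, Real.sqrt_pos.2 (by positivity)⟩

lemma Hyperboloid.ofCoord_coord (x : Hyperboloid n) : Hyperboloid.ofCoord x.1.2 = x := by
  have hx := x.2.1
  simp only [lorentz, real_inner_self_eq_norm_sq] at hx
  refine Subtype.ext (Prod.ext ?_ rfl)
  change Real.sqrt (1 + ‖x.1.2‖ ^ 2) = x.1.1
  rw [show 1 + ‖x.1.2‖ ^ 2 = x.1.1 ^ 2 by linarith, Real.sqrt_sq x.2.2.le]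

lemma coord_image_preimage (O : Set (ℝ × EuclideanSpace ℝ (Fin n))) :
    (fun x : Hyperboloid n => x.1.2) '' ((fun x => x.1) ⁻¹' O) =
      (fun y => (Hyperboloid.ofCoord y).1) ⁻¹' O := by
  ext y
  constructor
  · rintro ⟨x, hx, rfl⟩
    rw [mem_preimage, Hyperboloid.ofCoord_coord]
    exact hx
  · exact fun hy => ⟨Hyperboloid.ofCoord y, hy, rfl⟩

/-- The density is positive everywhere, so hyperbolic null sets are the Lebesgue null sets in the
coordinate `x'`. -/
lemma hyperbolic_vol_eq_zero_iff (s : Set (Hyperboloid n)) :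
    (SpaceForm.hyperbolic n).vol s = 0 ↔
      volume ((fun x : Hyperboloid n => x.1.2) '' s) = 0 := by
  change (∫⁻ y : EuclideanSpace ℝ (Fin n) in _, ENNReal.ofReal (1 / Real.sqrt (1 + ‖y‖ ^ 2))) = 0
    ↔ _
  rw [lintegral_eq_zero_iff (by fun_prop), ← Measure.restrict_eq_zero, Filter.EventuallyEq,
    ae_iff]
  have : {a : EuclideanSpace ℝ (Fin n) |
      ¬ENNReal.ofReal (1 / Real.sqrt (1 + ‖a‖ ^ 2)) = (0 : EuclideanSpace ℝ (Fin n) → ENNReal) a} =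
      univ := by
    refine eq_univ_of_forall fun a => ?_
    have : 0 < 1 / Real.sqrt (1 + ‖a‖ ^ 2) := by positivity
    simpa using this
  rw [this, Measure.measure_univ_eq_zero]

/-- A plane section of the hyperboloid is a null set: its dilates are pairwise disjoint. -/
lemma volume_hyperboloid_section (a : ℝ) (ha : a ≠ 0) (φ : EuclideanSpace ℝ (Fin n) →ₗ[ℝ] ℝ) :
    volume {y | a * Real.sqrt (1 + ‖y‖ ^ 2) + φ y = 0} = 0 := by
  let S : Ioi (0 : ℝ) → Set (EuclideanSpace ℝ (Fin n)) := fun r =>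
    {y | a * Real.sqrt (r.1 ^ 2 + ‖y‖ ^ 2) + φ y = 0}
  have hφ : Continuous φ := φ.continuous_of_finiteDimensional
  have hm : ∀ r, MeasurableSet (S r) := fun r =>
    (isClosed_eq (by fun_prop) continuous_const).measurableSet
  have hd : Pairwise (Function.onFun Disjoint S) := by
    intro r s hrs
    refine Set.disjoint_left.2 fun y hr hs => hrs ?_
    have hr : a * Real.sqrt (r.1 ^ 2 + ‖y‖ ^ 2) + φ y = 0 := hr
    have hs : a * Real.sqrt (s.1 ^ 2 + ‖y‖ ^ 2) + φ y = 0 := hs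
    have h1 : Real.sqrt (r.1 ^ 2 + ‖y‖ ^ 2) = Real.sqrt (s.1 ^ 2 + ‖y‖ ^ 2) :=
      mul_left_cancel₀ ha (by linarith)
    rw [Real.sqrt_inj (by positivity) (by positivity)] at h1
    have h2 : r.1 ^ 2 = s.1 ^ 2 := by linarith
    exact Subtype.ext ((pow_left_inj₀ (le_of_lt r.2) (le_of_lt s.2) two_ne_zero).1 h2)
  have hsub : ∀ r : Ioi (0 : ℝ), r.1 • {y : EuclideanSpace ℝ (Fin n) |
      a * Real.sqrt (1 + ‖y‖ ^ 2) + φ y = 0} ⊆ S r := by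
    rintro ⟨r, hr⟩ _ ⟨y, hy, rfl⟩
    have hr : 0 < r := hr
    have hy : a * Real.sqrt (1 + ‖y‖ ^ 2) + φ y = 0 := hy
    change a * Real.sqrt (r ^ 2 + ‖r • y‖ ^ 2) + φ (r • y) = 0
    have : r ^ 2 + ‖r • y‖ ^ 2 = r ^ 2 * (1 + ‖y‖ ^ 2) := by
      rw [norm_smul, Real.norm_of_nonneg hr.le]; ring
    rw [this, Real.sqrt_mul (by positivity), Real.sqrt_sq hr.le, map_smul, smul_eq_mul]
    linear_combination r * hy
  -- Only countably many disjoint measurable sets have positive measure, but there are uncountably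
  -- many radii. So some `S r` is null, and so is the section, whose dilate by `r` lies in it.
  have hcount := Measure.countable_meas_pos_of_disjoint_iUnion (μ := volume) hm hd
  have : ∃ r, ¬ 0 < volume (S r) := by
    by_contra! h
    rw [show {r | 0 < volume (S r)} = univ from eq_univ_of_forall h] at hcount
    have := Cardinal.mk_le_aleph0_iff.2 (Set.countable_univ_iff.1 hcount)
    rw [Cardinal.mk_Ioi_real] at this
    exact this.not_gt Cardinal.aleph0_lt_continuum
  obtain ⟨r, hr⟩ := this
  have h0 := measure_mono_null (hsub r) (nonpos_iff_eq_zero.1 (not_lt.1 hr))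
  rw [Measure.addHaar_smul, mul_eq_zero] at h0
  refine h0.resolve_left ?_
  have : r.1 ≠ 0 := ne_of_gt r.2
  simp [this]

/-- The model of hyperbolic space in the ambient vector space. -/
noncomputable def hyperbolicModel (n : ℕ) :
    ConeModel (SpaceForm.hyperbolic n).Pt (SpaceForm.hyperbolic n).IsSimplex
      (SpaceForm.hyperbolic n).vol (ℝ × EuclideanSpace ℝ (Fin n)) where
  emb x := x.1
  size v := Real.sqrt (lorentz v v)
  continuous_size := Real.continuous_sqrt.comp continuous_lorentz_self
  size_emb x := by rw [x.2.1, Real.sqrt_one]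
  size_smul r hr v := by
    rw [lorentz_smul_self, Real.sqrt_mul (sq_nonneg r), Real.sqrt_sq hr.le]
  add_mem r s hr hs x y _ := by
    set v := r • x.1 + s • y.1 with hv
    have h1 : 0 < lorentz v v := by
      have e : lorentz v v = r ^ 2 * lorentz x.1 x.1 + 2 * r * s * lorentz x.1 y.1 +
          s ^ 2 * lorentz y.1 y.1 := by
        rw [hv]
        simp only [← lorentzForm_apply, map_add, map_smul, LinearMap.add_apply,
          LinearMap.smul_apply, smul_eq_mul]
        simp only [lorentzForm_apply]
        rw [lorentz_comm y.1 x.1]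
        ring
      rw [e, x.2.1, y.2.1]
      -- This makes the cross term positive.
      have := one_le_lorentz x y
      positivity
    have h0 : 0 < v.1 := add_pos (mul_pos hr x.2.2) (mul_pos hs y.2.2)
    have hq := Real.sqrt_pos.2 h1
    refine ⟨Real.sqrt (lorentz v v), hq, ⟨(Real.sqrt (lorentz v v))⁻¹ • v, ?_, ?_⟩, ?_⟩
    · rw [lorentz_smul_self, inv_pow, Real.sq_sqrt h1.le, inv_mul_cancel₀ h1.ne']
    · exact mul_pos (inv_pos.2 hq) h0
    · change Real.sqrt (lorentz v v) • (Real.sqrt (lorentz v v))⁻¹ • v = v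
      rw [smul_smul, mul_inv_cancel₀ hq.ne', one_smul]
  isSimplex_iff s := by
    have hd : Module.finrank ℝ (ℝ × EuclideanSpace ℝ (Fin n)) = n + 1 := by simp [add_comm]
    refine Iff.trans ?_ (exists_fin_finrank_iff hd
      (T := Hyperboloid n) (Φ := fun k p =>
      LinearIndependent ℝ ((fun x : Hyperboloid n => x.1) ∘ p)
      ∧ s = (fun x : Hyperboloid n => x.1) ⁻¹' (coneSpan
        ((fun x : Hyperboloid n => x.1) ∘ p) : Set _)))
    refine exists_congr fun p => ?_
    have hs : {x : Hyperboloid n |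
        ∃ r : ℝ, 0 < r ∧ r • x.1 ∈ convexHull ℝ (range fun i => (p i).1)} =
        (fun x : Hyperboloid n => x.1) ⁻¹' (coneSpan
        ((fun x : Hyperboloid n => x.1) ∘ p) : Set _) := by
      ext x
      refine exists_smul_mem_convexHull_iff fun h => ?_
      have := x.2.2
      rw [h] at this
      exact lt_irrefl _ this
    rw [← hs]
    rfl
  vol_empty := by
    rw [hyperbolic_vol_eq_zero_iff, image_empty, measure_empty]
  vol_mono h h0 := by
    rw [hyperbolic_vol_eq_zero_iff] at h0 ⊢
    exact measure_mono_null (image_mono h) h0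
  vol_union h h' := by
    rw [hyperbolic_vol_eq_zero_iff] at h h' ⊢
    rw [image_union]
    exact measure_union_null h h'
  vol_hyperplane f hf := by
    rw [hyperbolic_vol_eq_zero_iff, coord_image_preimage]
    set φ := f.comp (LinearMap.inr ℝ ℝ (EuclideanSpace ℝ (Fin n))) with hφ
    have key : ∀ v : ℝ × EuclideanSpace ℝ (Fin n), f v = f (1, 0) * v.1 + φ v.2 := fun v => by
      have : v = v.1 • ((1 : ℝ), (0 : EuclideanSpace ℝ (Fin n))) + (0, v.2) := by
        ext1 <;> simp
      conv_lhs => rw [this, map_add, map_smul, smul_eq_mul, mul_comm]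
      rfl
    have e : (fun y => (Hyperboloid.ofCoord y).1) ⁻¹' {v | f v = 0} =
        {y : EuclideanSpace ℝ (Fin n) | f (1, 0) * Real.sqrt (1 + ‖y‖ ^ 2) + φ y = 0} := by
      ext y
      rw [mem_preimage, mem_ofPred_eq, key]
      rfl
    rw [e]
    -- A hyperplane through the time axis is linear in the coordinate `x'`; any other one gives a
    -- curved section.
    by_cases ha : f (1, 0) = 0
    · have hφ0 : φ ≠ 0 := fun h => hf (LinearMap.ext fun v => by rw [key, ha, h]; simp)
      simpa [ha] using volume_ker_eq_zero volume φ hφ0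
    · exact volume_hyperboloid_section _ ha φ
  vol_open O hO hne := by
    rw [Ne, hyperbolic_vol_eq_zero_iff, coord_image_preimage]
    have hc : Continuous fun y : EuclideanSpace ℝ (Fin n) => (Hyperboloid.ofCoord y).1 := by
      change Continuous fun y : EuclideanSpace ℝ (Fin n) => (Real.sqrt (1 + ‖y‖ ^ 2), y)
      fun_prop
    refine (hO.preimage hc).measure_ne_zero _ ?_
    obtain ⟨x, hx⟩ := hne
    refine ⟨x.1.2, ?_⟩
    rw [mem_preimage, Hyperboloid.ofCoord_coord]
    exact hx

end Hyperbolic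

/-! #### Isometries -/

/-- A bijection which preserves a bilinear form that is nondegenerate against the space takes
simplices to simplices. -/
lemma ConeModel.isSimplex_image {T : Type} {IsS : Set T → Prop} {vol : Set T → ENNReal} {V : Type}
    [NormedAddCommGroup V] [NormedSpace ℝ V] [FiniteDimensional ℝ V] (M : ConeModel T IsS vol V)
    (B : LinearMap.BilinForm ℝ V) (hB : ∀ v, (∀ x, B v (M.emb x) = 0) → v = 0)
    (g : Equiv.Perm T) (hg : ∀ x y, B (M.emb (g x)) (M.emb (g y)) = B (M.emb x) (M.emb y))
    {s : Set T} (hs : IsS s) : IsS (g '' s) := by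
  obtain ⟨p, hp, rfl⟩ := (M.isSimplex_iff _).1 hs
  -- `g` is not assumed linear. Still, it preserves linear relations among points, since a vector is
  -- zero when its pairings with all points vanish and `g` is onto. Independence uses `d = 0`,
  -- membership in the cone uses `d = 1`.
  have key : ∀ (c : Fin (Module.finrank ℝ V) → ℝ) (d : ℝ) (x : T),
      ∑ i, c i • M.emb (p i) - d • M.emb x = 0 ↔
        ∑ i, c i • M.emb (g (p i)) - d • M.emb (g x) = 0 := by
    intro c d x
    have e : ∀ y, B (∑ i, c i • M.emb (g (p i)) - d • M.emb (g x)) (M.emb (g y)) =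
        B (∑ i, c i • M.emb (p i) - d • M.emb x) (M.emb y) := by
      intro y
      simp [map_sub, map_sum, LinearMap.sum_apply, hg]
    constructor
    · intro h
      refine hB _ fun y => ?_
      obtain ⟨y, rfl⟩ := g.surjective y
      rw [e, h]
      simp
    · intro h
      refine hB _ fun y => ?_
      rw [← e, h]
      simp
  refine (M.isSimplex_iff _).2 ⟨g ∘ p, ?_, ?_⟩
  · rw [Fintype.linearIndependent_iff] at hp ⊢
    intro c hc i
    refine hp c ?_ i
    have := (key c 0 (p i)).2 (by simpa using hc)
    simpa using this
  · ext y
    obtain ⟨x, rfl⟩ := g.surjective y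
    rw [g.injective.mem_set_image, mem_preimage, mem_preimage, SetLike.mem_coe, SetLike.mem_coe,
      mem_coneSpan_iff, mem_coneSpan_iff]
    refine exists_congr fun c => and_congr_right fun _ => ?_
    have := key c 1 x
    simp only [one_smul, sub_eq_zero] at this
    exact this

namespace SpaceForm

/-- An isometry of `ℝⁿ` is affine (Mazur–Ulam), so it preserves affine independence and convex
hulls. -/
lemma isSimplex_image_euclidean {n : ℕ} {g : Equiv.Perm (euclidean n).Pt}
    (hg : g ∈ (euclidean n).isometryGroup) {s : Set (euclidean n).Pt}
    (hs : (euclidean n).IsSimplex s) : (euclidean n).IsSimplex (g '' s) := by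
  obtain ⟨p, hp, rfl⟩ := hs
  let φ : EuclideanSpace ℝ (Fin n) ≃ᵢ EuclideanSpace ℝ (Fin n) :=
    ⟨g, Isometry.of_dist_eq hg⟩
  let ψ := φ.toRealAffineIsometryEquiv
  have hψ : ⇑ψ.toAffineEquiv.toAffineMap = g := φ.coeFn_toRealAffineIsometryEquiv
  refine ⟨g ∘ p, ?_, ?_⟩
  · have := hp.map' ψ.toAffineEquiv.toAffineMap ψ.injective
    rw [hψ] at this
    exact this
  · have := ψ.toAffineEquiv.toAffineMap.image_convexHull (range p)
    rw [hψ, ← range_comp] at this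
    exact this

lemma isSimplex_image_spherical {n : ℕ} {g : Equiv.Perm (spherical n).Pt}
    (hg : g ∈ (spherical n).isometryGroup) {s : Set (spherical n).Pt}
    (hs : (spherical n).IsSimplex s) : (spherical n).IsSimplex (g '' s) := by
  refine (sphericalModel n).isSimplex_image (innerₗ _) (fun v hv => ?_) g (fun x y => ?_) hs
  · by_contra h
    have hn : ‖v‖ ≠ 0 := norm_ne_zero_iff.2 h
    have := hv ⟨‖v‖⁻¹ • v, by
      rw [mem_sphere_zero_iff_norm, norm_smul, norm_inv, norm_norm, inv_mul_cancel₀ hn]⟩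
    change inner ℝ v (‖v‖⁻¹ • v) = 0 at this
    rw [inner_smul_right, real_inner_self_eq_norm_sq] at this
    simp [h] at this
  · have h : InnerProductGeometry.angle (g x).1 (g y).1 = InnerProductGeometry.angle x.1 y.1 :=
      hg x y
    have h' := congrArg Real.cos h
    rw [InnerProductGeometry.cos_angle, InnerProductGeometry.cos_angle] at h'
    change inner ℝ (g x).1 (g y).1 = inner ℝ x.1 y.1
    have hn : ∀ z : Metric.sphere (0 : EuclideanSpace ℝ (Fin (n + 1))) 1, ‖z.1‖ = 1 :=
      fun z => mem_sphere_zero_iff_norm.1 z.2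
    simpa only [hn, mul_one, div_one] using h'

lemma isSimplex_image_hyperbolic {n : ℕ} {g : Equiv.Perm (hyperbolic n).Pt}
    (hg : g ∈ (hyperbolic n).isometryGroup) {s : Set (hyperbolic n).Pt}
    (hs : (hyperbolic n).IsSimplex s) : (hyperbolic n).IsSimplex (g '' s) := by
  refine (hyperbolicModel n).isSimplex_image (lorentzForm n) (fun v hv => ?_) g (fun x y => ?_) hs
  -- Pairing with the base point kills the time coordinate of `v`; pairing with the point over `v.2`
  -- then gives `‖v.2‖² = 0`.
  · have h1 : lorentz v (Hyperboloid.ofCoord 0).1 = 0 := hv (Hyperboloid.ofCoord 0)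
    have h2 : lorentz v (Hyperboloid.ofCoord v.2).1 = 0 := hv (Hyperboloid.ofCoord v.2)
    simp only [lorentz, Hyperboloid.ofCoord] at h1 h2
    have h3 : v.1 = 0 := by simpa using h1
    rw [h3, zero_mul, zero_sub, neg_eq_zero, inner_self_eq_zero] at h2
    exact Prod.ext h3 h2
  · have h : Real.arcosh (lorentz (g x).1 (g y).1) = Real.arcosh (lorentz x.1 y.1) := hg x y
    exact Real.arcosh_injOn (one_le_lorentz _ _) (one_le_lorentz _ _) h

lemma isSimplex_image {X : SpaceForm} {g : Equiv.Perm X.Pt} (hg : g ∈ X.isometryGroup)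
    {s : Set X.Pt} (hs : X.IsSimplex s) : X.IsSimplex (g '' s) := by
  cases X with
  | euclidean n => exact isSimplex_image_euclidean hg hs
  | spherical n => exact isSimplex_image_spherical hg hs
  | hyperbolic n => exact isSimplex_image_hyperbolic hg hs

/-- Together with `isSimplex_image`, this is all that is used about the three geometries from here
on. -/
lemma exists_coneModel (X : SpaceForm) : ∃ (V : Type) (_ : NormedAddCommGroup V)
    (_ : NormedSpace ℝ V) (_ : FiniteDimensional ℝ V),
    Nonempty (ConeModel X.Pt X.IsSimplex X.vol V) := by
  cases X with
  | euclidean n => exact ⟨_, _, _, _, ⟨euclideanModel n⟩⟩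
  | spherical n => exact ⟨_, _, _, _, ⟨sphericalModel n⟩⟩
  | hyperbolic n => exact ⟨_, _, _, _, ⟨hyperbolicModel n⟩⟩

end SpaceForm

end Models

end ScissorsCongruence

namespace ScissorsCongruence

namespace SpaceForm

/-! ### Finite unions of simplices up to null sets -/

section Unions

open Set

variable {X : SpaceForm}

lemma vol_empty : X.vol ∅ = 0 := by
  obtain ⟨V, _, _, _, ⟨M⟩⟩ := X.exists_coneModel
  exact M.vol_empty

lemma vol_mono_null {s t : Set X.Pt} (h : s ⊆ t) (h0 : X.vol t = 0) : X.vol s = 0 := by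
  obtain ⟨V, _, _, _, ⟨M⟩⟩ := X.exists_coneModel
  exact M.vol_mono h h0

lemma vol_union_null {s t : Set X.Pt} (hs : X.vol s = 0) (ht : X.vol t = 0) :
    X.vol (s ∪ t) = 0 := by
  obtain ⟨V, _, _, _, ⟨M⟩⟩ := X.exists_coneModel
  exact M.vol_union hs ht

lemma vol_biUnion_null {ι : Type*} {F : Set ι} (hF : F.Finite) {f : ι → Set X.Pt}
    (h : ∀ i ∈ F, X.vol (f i) = 0) : X.vol (⋃ i ∈ F, f i) = 0 := by
  induction F, hF using Set.Finite.induction_on with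
  | empty => simpa using vol_empty
  | insert _ _ ih =>
    rw [biUnion_insert]
    exact vol_union_null (h _ (mem_insert _ _)) (ih fun i hi => h i (mem_insert_of_mem _ hi))

lemma isSimplexUnion_empty : X.IsSimplexUnion ∅ := ⟨∅, finite_empty, by simp, by simp⟩

lemma IsSimplexUnion.union {s t : Set X.Pt} (hs : X.IsSimplexUnion s) (ht : X.IsSimplexUnion t) :
    X.IsSimplexUnion (s ∪ t) := by
  obtain ⟨F, hF, hF', rfl⟩ := hs
  obtain ⟨F', h, h', rfl⟩ := ht
  refine ⟨F ∪ F', hF.union h, ?_, (sUnion_union _ _).symm⟩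
  rintro r (hr | hr)
  exacts [hF' r hr, h' r hr]

lemma IsSimplexUnion.image {g : Equiv.Perm X.Pt} (hg : g ∈ X.isometryGroup) {s : Set X.Pt}
    (hs : X.IsSimplexUnion s) : X.IsSimplexUnion (g '' s) := by
  obtain ⟨F, hF, hF', rfl⟩ := hs
  refine ⟨(fun r => g '' r) '' F, hF.image _, ?_, by rw [image_sUnion]⟩
  rintro _ ⟨r, hr, rfl⟩
  exact isSimplex_image hg (hF' r hr)

/-- The regularity of polytopes: lower-dimensional discrepancies cannot occur. All the lattice laws
below are checked up to null sets through this lemma. -/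
lemma IsSimplexUnion.subset_of_null {s t : Set X.Pt} (hs : X.IsSimplexUnion s)
    (ht : X.IsSimplexUnion t) (h : X.vol (s \ t) = 0) : s ⊆ t := by
  obtain ⟨V, _, _, _, ⟨M⟩⟩ := X.exists_coneModel
  obtain ⟨F, hF, hF', rfl⟩ := hs
  obtain ⟨F', hF₁, hF₁', rfl⟩ := ht
  exact sUnion_subset fun r hr => M.subset_of_null_diff (hF' r hr) hF₁ hF₁'
    (M.vol_mono (sdiff_subset_sdiff_left (subset_sUnion_of_mem hr)) h)

/-- A finite union of simplices has a subdivision which is adapted to finitely many simplices. -/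
lemma IsSimplexUnion.exists_subdivision {s : Set X.Pt} (hs : X.IsSimplexUnion s)
    {T : Set (Set X.Pt)} (hT : T.Finite) (hT' : ∀ t ∈ T, X.IsSimplex t) :
    ∃ F : Set (Set X.Pt), F.Finite ∧ (∀ r ∈ F, X.IsSimplex r) ∧ s = ⋃₀ F ∧
      ∀ r ∈ F, ∀ t ∈ T, r ⊆ t ∨ X.vol (r ∩ t) = 0 := by
  obtain ⟨V, _, _, _, ⟨M⟩⟩ := X.exists_coneModel
  induction T, hT using Set.Finite.induction_on with
  | empty =>
    obtain ⟨F, hF, hF', e⟩ := hs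
    exact ⟨F, hF, hF', e, by simp⟩
  | @insert t T _ _ ih =>
    obtain ⟨F, hF, hF', rfl, h⟩ := ih fun t ht => hT' t (mem_insert_of_mem _ ht)
    have := fun r : F => M.exists_subdivision (hF' r r.2) (hT' t (mem_insert _ _))
    choose D h1 h2 h3 using this
    have := hF.to_subtype
    refine ⟨⋃ r : F, D r, finite_iUnion h1, fun q hq => ?_, ?_, fun q hq t' ht' => ?_⟩
    · obtain ⟨r, hr⟩ := mem_iUnion.1 hq
      exact (h2 r q hr).1
    · rw [sUnion_iUnion, sUnion_eq_iUnion]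
      exact iUnion_congr h3
    · obtain ⟨r, hr⟩ := mem_iUnion.1 hq
      rcases ht' with rfl | ht'
      · exact (h2 r q hr).2
      · have hsub : q ⊆ r.1 := by
          rw [h3 r]
          exact subset_sUnion_of_mem hr
        rcases h r r.2 t' ht' with h | h
        · exact Or.inl (hsub.trans h)
        · exact Or.inr (vol_mono_null (inter_subset_inter_left _ hsub) h)

/-- An intersection of polytopes can have lower-dimensional parts. The set `m` keeps the pieces of
an adapted subdivision of `s` which lie in `t`. -/
lemma IsSimplexUnion.exists_inf {s t : Set X.Pt} (hs : X.IsSimplexUnion s)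
    (ht : X.IsSimplexUnion t) :
    ∃ m, X.IsSimplexUnion m ∧ m ⊆ s ∩ t ∧ X.vol ((s ∩ t) \ m) = 0 := by
  obtain ⟨T, hT, hT', rfl⟩ := ht
  obtain ⟨F, hF, hF', rfl, h⟩ := hs.exists_subdivision hT hT'
  refine ⟨⋃₀ {r ∈ F | r ⊆ ⋃₀ T}, ⟨_, hF.subset (sep_subset _ _), fun r hr => hF' r hr.1, rfl⟩,
    sUnion_subset fun r hr => subset_inter (subset_sUnion_of_mem hr.1) hr.2, ?_⟩
  -- What is lost lies in pieces that are not contained in the union of `T`; such a piece lies in no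
  -- member of `T`, so it meets each one in a null set.
  refine vol_mono_null (t := ⋃ r ∈ {r ∈ F | ¬ r ⊆ ⋃₀ T}, ⋃ t ∈ T, r ∩ t) ?_ ?_
  · rintro x ⟨⟨⟨r, hr, hxr⟩, t, ht, hxt⟩, hx⟩
    have : ¬ r ⊆ ⋃₀ T := fun h => hx ⟨r, ⟨hr, h⟩, hxr⟩
    exact mem_biUnion (show r ∈ {r ∈ F | ¬ r ⊆ ⋃₀ T} from ⟨hr, this⟩)
      (mem_biUnion ht ⟨hxr, hxt⟩)
  · refine vol_biUnion_null (hF.subset (sep_subset _ _)) fun r hr =>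
      vol_biUnion_null hT fun t ht => ?_
    exact (h r hr.1 t ht).resolve_left fun h' => hr.2 (h'.trans (subset_sUnion_of_mem ht))

end Unions

/-! ### The distributive lattice of polytopes and the action of the group -/

section Lattice

open Set

variable {X : SpaceForm} {G : Subgroup (Equiv.Perm X.Pt)}

lemma Obj.le_of_null {P Q : X.Obj G} (h : X.vol (P.carrier \ Q.carrier) = 0) : P ≤ Q :=
  P.isSimplexUnion.subset_of_null Q.isSimplexUnion h

/-- The regularized intersection: the greatest finite union of simplices which is contained in the
intersection. -/
noncomputable def Obj.meet (P Q : X.Obj G) : X.Obj G :=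
  ⟨(P.isSimplexUnion.exists_inf Q.isSimplexUnion).choose,
    (P.isSimplexUnion.exists_inf Q.isSimplexUnion).choose_spec.1⟩

lemma Obj.meet_subset (P Q : X.Obj G) : (P.meet Q).carrier ⊆ P.carrier ∩ Q.carrier :=
  (P.isSimplexUnion.exists_inf Q.isSimplexUnion).choose_spec.2.1

lemma Obj.vol_diff_meet (P Q : X.Obj G) :
    X.vol ((P.carrier ∩ Q.carrier) \ (P.meet Q).carrier) = 0 :=
  (P.isSimplexUnion.exists_inf Q.isSimplexUnion).choose_spec.2.2

noncomputable instance : Lattice (X.Obj G) :=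
  { (inferInstance : PartialOrder (X.Obj G)) with
    sup := fun P Q => ⟨P.carrier ∪ Q.carrier, P.isSimplexUnion.union Q.isSimplexUnion⟩
    inf := Obj.meet
    le_sup_left := fun _ _ => subset_union_left
    le_sup_right := fun _ _ => subset_union_right
    sup_le := fun _ _ _ => union_subset
    inf_le_left := fun P Q => (P.meet_subset Q).trans inter_subset_left
    inf_le_right := fun P Q => (P.meet_subset Q).trans inter_subset_right
    -- A lower bound lies in the intersection, hence in the meet up to a null set, hence in the
    -- meet.
    le_inf := fun _ Q R h h' => Obj.le_of_null
      (vol_mono_null (sdiff_subset_sdiff_left (subset_inter h h')) (Q.vol_diff_meet R)) }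

lemma Obj.sup_carrier (P Q : X.Obj G) : (P ⊔ Q).carrier = P.carrier ∪ Q.carrier := rfl

/-- The law holds for sets, and a meet differs from the intersection by a null set only. -/
noncomputable instance : DistribLattice (X.Obj G) :=
  { (inferInstance : Lattice (X.Obj G)) with
    le_sup_inf := fun P Q R => Obj.le_of_null (vol_mono_null (by
      rintro x ⟨hx, hx'⟩
      have h1 := Obj.meet_subset _ _ hx
      simp only [Obj.sup_carrier, mem_union, mem_inter_iff, not_or] at h1 hx'
      exact ⟨⟨h1.1.resolve_left hx'.1, h1.2.resolve_left hx'.1⟩, hx'.2⟩) (Q.vol_diff_meet R)) }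

instance : OrderBot (X.Obj G) where
  bot := ⟨∅, isSimplexUnion_empty⟩
  bot_le _ := empty_subset _

lemma Obj.bot_carrier : (⊥ : X.Obj G).carrier = ∅ := rfl

lemma Obj.ne_bot_iff {P : X.Obj G} : P ≠ ⊥ ↔ P.carrier.Nonempty := by
  rw [nonempty_iff_ne_empty, Ne, Ne, Obj.ext_iff, Obj.bot_carrier]

/-- Matches the disjointness required of sub-maps with the null intersections in the relations of
the scissors congruence group. -/
lemma Obj.disjoint_iff_vol {P Q : X.Obj G} :
    Disjoint P Q ↔ X.vol (P.carrier ∩ Q.carrier) = 0 := by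
  rw [disjoint_iff]
  constructor
  · intro h
    have := P.vol_diff_meet Q
    rwa [show P.meet Q = ⊥ from h, Obj.bot_carrier, sdiff_empty] at this
  · intro h
    refine le_bot_iff.1 (Obj.le_of_null (vol_mono_null ?_ h))
    exact sdiff_subset.trans (P.meet_subset Q)

lemma Obj.finset_sup_carrier {ι : Type*} (t : Finset ι) (U : ι → X.Obj G) :
    (t.sup U).carrier = ⋃ i ∈ t, (U i).carrier := by
  classical
  induction t using Finset.induction_on with
  | empty => simp [Obj.bot_carrier]
  | insert a t _ ih => rw [Finset.sup_insert, Obj.sup_carrier, ih, Finset.set_biUnion_insert]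

section Action

variable [hG : Fact (G ≤ X.isometryGroup)]

instance : MulAction G (X.Obj G) where
  smul g P := ⟨g.1 '' P.carrier, P.isSimplexUnion.image (hG.out g.2)⟩
  one_smul _ := Obj.ext (image_id _)
  mul_smul g k P := Obj.ext (image_comp g.1 k.1 P.carrier)

/-- Elements of the group act by order automorphisms. -/
def Obj.smulIso (g : G) : X.Obj G ≃o X.Obj G where
  toEquiv := MulAction.toPerm g
  map_rel_iff' := image_subset_image_iff g.1.injective

lemma Obj.smul_le_smul {g : G} {P Q : X.Obj G} : g • P ≤ g • Q ↔ P ≤ Q :=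
  (Obj.smulIso g).le_iff_le

lemma Obj.smul_inf (g : G) (P Q : X.Obj G) : g • (P ⊓ Q) = g • P ⊓ g • Q :=
  (Obj.smulIso g).map_inf P Q

lemma Obj.smul_bot (g : G) : g • (⊥ : X.Obj G) = ⊥ := (Obj.smulIso g).map_bot

lemma Obj.smul_eq_bot {g : G} {P : X.Obj G} : g • P = ⊥ ↔ P = ⊥ := by
  rw [smul_eq_iff_eq_inv_smul, Obj.smul_bot]

lemma Obj.smul_disjoint {g : G} {P Q : X.Obj G} : Disjoint (g • P) (g • Q) ↔ Disjoint P Q := by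
  rw [disjoint_iff, disjoint_iff, ← Obj.smul_inf, Obj.smul_eq_bot]

lemma Obj.smul_finset_sup {ι : Type*} (g : G) (t : Finset ι) (U : ι → X.Obj G) :
    g • t.sup U = t.sup fun i => g • U i := map_finset_sup (Obj.smulIso g) t U

lemma Obj.inv_smul_le {g : G} {P Q : X.Obj G} : g⁻¹ • P ≤ Q ↔ P ≤ g • Q := by
  rw [← Obj.smul_le_smul (g := g), smul_inv_smul]

end Action

end Lattice

/-! ### The topology and the polytope complex -/

section Complex

open DoubleCategory

variable {X : SpaceForm} {G : Subgroup (Equiv.Perm X.Pt)}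

lemma isInitial_iff {P : X.Obj G} : Nonempty (IsInitial P) ↔ P = ⊥ :=
  ⟨fun ⟨h⟩ => le_bot_iff.1 (leOfHom (h.to ⊥)), fun h => ⟨h ▸ isInitialBot⟩⟩

lemma isPolytope_iff {P : X.Obj G} : IsPolytope P ↔ P ≠ ⊥ := by
  rw [IsPolytope, ← not_nonempty_iff, isInitial_iff]

variable (X G) in
/-- The topology in which a sieve is covering if finitely many of its members have the whole object
as union. -/
noncomputable def topology : GrothendieckTopology (X.Obj G) where
  sieves P := {S | ∃ t : Finset (X.Obj G), (∀ Y ∈ t, ∃ f : Y ⟶ P, S f) ∧ t.sup id = P}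
  top_mem' P := ⟨{P}, fun Y hY => by
    rw [Finset.mem_singleton.1 hY]
    exact ⟨𝟙 P, trivial⟩, by simp⟩
  pullback_stable' P Q S f := by
    classical
    rintro ⟨t, ht, e⟩
    refine ⟨t.image (Q ⊓ ·), fun Y hY => ?_, ?_⟩
    · obtain ⟨Z, hZ, rfl⟩ := Finset.mem_image.1 hY
      obtain ⟨g, hg⟩ := ht Z hZ
      refine ⟨homOfLE inf_le_left, ?_⟩
      rw [Sieve.pullback_apply, Subsingleton.elim (_ ≫ f) ((homOfLE inf_le_right : Q ⊓ Z ⟶ Z) ≫ g)]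
      exact S.downward_closed hg _
    · rw [Finset.sup_image]
      change t.sup (fun Z => Q ⊓ Z) = Q
      -- Stability under pullback is distributivity of the lattice.
      rw [← Finset.sup_inf_distrib_left]
      change Q ⊓ t.sup id = Q
      rw [e]
      exact inf_eq_left.2 (leOfHom f)
  transitive' P S hS R hR := by
    classical
    obtain ⟨t, ht, e⟩ := hS
    have : ∀ Y : t, ∃ s : Finset (X.Obj G), (∀ Z ∈ s, ∃ f : Z ⟶ P, R f) ∧ s.sup id = Y.1 := by
      rintro ⟨Y, hY⟩
      obtain ⟨f, hf⟩ := ht Y hY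
      obtain ⟨s, hs, e⟩ := hR hf
      refine ⟨s, fun Z hZ => ?_, e⟩
      obtain ⟨g, hg⟩ := hs Z hZ
      exact ⟨_, hg⟩
    choose s hs es using this
    refine ⟨t.attach.biUnion s, fun Z hZ => ?_, ?_⟩
    · obtain ⟨Y, -, hY⟩ := Finset.mem_biUnion.1 hZ
      exact hs Y Z hY
    · rw [Finset.sup_biUnion, ← e]
      simp only [es]
      exact Finset.sup_attach t id

/-- The sieve generated by the family also contains smaller objects. Each of them lies in some `U
i`, by which it is replaced. -/
lemma isCovering_iff {P : X.Obj G} {ι : Type*} (U : ι → X.Obj G) (f : ∀ i, U i ⟶ P) :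
    IsCovering (topology X G) U f ↔ ∃ t : Finset ι, t.sup U = P := by
  classical
  constructor
  · rintro ⟨t, ht, e⟩
    have : ∀ Y : t, ∃ i, Y.1 ≤ U i := by
      rintro ⟨Y, hY⟩
      obtain ⟨g, Z, k, l, ⟨i⟩, -⟩ := ht Y hY
      exact ⟨i, leOfHom k⟩
    choose i hi using this
    refine ⟨t.attach.image i, le_antisymm (Finset.sup_le fun j _ => leOfHom (f j)) ?_⟩
    rw [← e]
    refine Finset.sup_le fun Y hY => (hi ⟨Y, hY⟩).trans (Finset.le_sup (f := U) ?_)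
    exact Finset.mem_image_of_mem _ (Finset.mem_attach _ _)
  · rintro ⟨t, e⟩
    refine ⟨t.image U, fun Y hY => ?_, by rw [Finset.sup_image]; exact e⟩
    obtain ⟨i, -, rfl⟩ := Finset.mem_image.1 hY
    exact ⟨f i, Sieve.ofArrows_mk _ _ i⟩

lemma isCovering_iff_of_finite {P : X.Obj G} {ι : Type*} [Fintype ι] (U : ι → X.Obj G)
    (f : ∀ i, U i ⟶ P) : IsCovering (topology X G) U f ↔ Finset.univ.sup U = P := by
  rw [isCovering_iff]
  refine ⟨fun ⟨t, e⟩ => le_antisymm (Finset.sup_le fun j _ => leOfHom (f j)) ?_, fun h => ⟨_, h⟩⟩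
  rw [← e]
  exact Finset.sup_mono (Finset.subset_univ t)

lemma isPullback_inf {P Q R : X.Obj G} (f : P ⟶ R) (g : Q ⟶ R) :
    IsPullback (homOfLE inf_le_left : P ⊓ Q ⟶ P) (homOfLE inf_le_right) f g :=
  ⟨⟨Subsingleton.elim _ _⟩, ⟨PullbackCone.IsLimit.mk _
    (fun s => homOfLE (le_inf (leOfHom s.fst) (leOfHom s.snd)))
    (fun _ => Subsingleton.elim _ _) (fun _ => Subsingleton.elim _ _)
    (fun _ _ _ _ => Subsingleton.elim _ _)⟩⟩

instance : HasPullbacks (X.Obj G) :=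
  have : ∀ {P Q R : X.Obj G} {f : P ⟶ R} {g : Q ⟶ R}, HasLimit (cospan f g) :=
    (isPullback_inf _ _).hasPullback
  hasPullbacks_of_hasLimit_cospan _

/-- The group element of a horizontal morphism. -/
def elt {P Q : X.Obj G} (σ : HHom P Q) : G := ⟨σ.1, σ.2.1⟩

lemma sq_iff {A B A' B' : X.Obj G} {σ : HHom A B} {p : A ⟶ A'} {q : B ⟶ B'} {τ : HHom A' B'} :
    Sq σ p q τ ↔ elt σ = elt τ :=
  (Subtype.ext_iff (a1 := elt σ) (a2 := elt τ)).symm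

lemma HHom_ext {P Q : X.Obj G} {σ τ : HHom P Q} (h : elt σ = elt τ) : σ = τ :=
  Subtype.ext (Subtype.ext_iff.1 h :)

variable [hG : Fact (G ≤ X.isometryGroup)]

lemma elt_smul {P Q : X.Obj G} (σ : HHom P Q) : elt σ • P = Q := Obj.ext σ.2.2

/-- The horizontal morphism given by a group element. -/
def hmk (g : G) {P Q : X.Obj G} (h : g • P = Q) : HHom P Q :=
  ⟨g.1, g.2, congrArg Obj.carrier h⟩

lemma source_eq {P Q : X.Obj G} (σ : HHom P Q) : P = (elt σ)⁻¹ • Q :=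
  eq_inv_smul_iff.2 (elt_smul σ)

/-- The source of a horizontal morphism is the translate of its target by the inverse group element,
so an inclusion of targets gives one of sources. -/
lemma isPullbackSq_of_elt {A B A' B' : X.Obj G} (τ : HHom A' B') (p : A' ⟶ A) (q : B' ⟶ B)
    (σ : HHom A B) (h : elt τ = elt σ) : IsPullbackSq τ p q σ := by
  refine ⟨sq_iff.2 h, fun {A₁ B₁} τ₁ p₁ s hs => ?_⟩
  have hs := sq_iff.1 hs
  refine ⟨homOfLE ?_, Subsingleton.elim _ _, sq_iff.2 (hs.trans h.symm)⟩
  rw [source_eq τ₁, source_eq τ, hs, h]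
  exact Obj.smul_le_smul.2 (leOfHom s)

/-- Translation of slices. -/
def overFunctor {A B : X.Obj G} (g : G) (h : g • A = B) : Over A ⥤ Over B where
  obj P := Over.mk (homOfLE (by rw [← h]; exact Obj.smul_le_smul.2 (leOfHom P.hom)) :
    g • P.left ⟶ B)
  map f := Over.homMk (homOfLE (Obj.smul_le_smul.2 (leOfHom f.left))) (Subsingleton.elim _ _)
  map_id _ := Over.OverMorphism.ext (Subsingleton.elim _ _)
  map_comp _ _ := Over.OverMorphism.ext (Subsingleton.elim _ _)

/-- Translation of slices is an equivalence. -/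
def overEquivalence {A B : X.Obj G} (g : G) (h : g • A = B) : Over B ≌ Over A :=
  have h' : g⁻¹ • B = A := by rw [← h, inv_smul_smul]
  CategoryTheory.Equivalence.mk (overFunctor g⁻¹ h') (overFunctor g h)
    (NatIso.ofComponents
      (fun P => Over.isoMk (eqToIso (smul_inv_smul g P.left).symm) (Subsingleton.elim _ _))
      fun _ => Over.OverMorphism.ext (Subsingleton.elim _ _))
    (NatIso.ofComponents
      (fun P => Over.isoMk (eqToIso (inv_smul_smul g P.left)) (Subsingleton.elim _ _))
      fun _ => Over.OverMorphism.ext (Subsingleton.elim _ _))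

variable (X G) in
-- Pullback along `g` is translation by `g⁻¹`, which is an isomorphism of slices and preserves
-- finite joins. For (B), a finite subfamily of the refinement involves finitely many `U i`, and
-- these contain its members.
lemma isPolytopeComplex : IsPolytopeComplex (topology X G) where
  thin := inferInstance
  unique_initial := ⟨⊥, isInitial_iff.2 rfl, fun _ h => isInitial_iff.1 h⟩
  hasPullbacks := inferInstance
  groupoid {A B} σ := ⟨hmk (elt σ)⁻¹ (source_eq σ).symm,
    HHom_ext (inv_mul_cancel _), HHom_ext (mul_inv_cancel _)⟩
  pull {A B} σ := by
    refine ⟨overEquivalence (elt σ) (elt_smul σ), fun P => ⟨⟨hmk (elt σ) (smul_inv_smul _ _),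
      sq_iff.2 rfl, fun τ hτ => Subtype.ext hτ⟩, fun τ hτ =>
        isPullbackSq_of_elt _ _ _ _ (sq_iff.1 hτ)⟩⟩
  cover_pull {P Q} σ {ι} U f V g τ h hU := by
    obtain ⟨t, ht⟩ := (isCovering_iff U f).1 hU
    refine (isCovering_iff V g).2 ⟨t, ?_⟩
    have e : (elt σ)⁻¹ • t.sup U = Q := by rw [ht, ← source_eq]
    rw [← e, Obj.smul_finset_sup]
    refine Finset.sup_congr rfl fun i _ => ?_
    rw [← sq_iff.1 (h i).1, ← source_eq]
  cover_of_refinement {P ι} U f κ V g h hV := by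
    classical
    obtain ⟨t, ht⟩ := (isCovering_iff _ _).1 hV
    refine (isCovering_iff U f).2 ⟨t.image Sigma.fst,
      le_antisymm (Finset.sup_le fun i _ => leOfHom (f i)) ?_⟩
    rw [← ht]
    exact Finset.sup_le fun x hx => (leOfHom (g x.1 x.2)).trans
      (Finset.le_sup (f := U) (Finset.mem_image_of_mem _ hx))

end Complex

end SpaceForm

end ScissorsCongruence

/-! ### Morphisms of families as relations -/

namespace ScissorsCongruence

namespace SpaceForm

open DoubleCategory

variable {X : SpaceForm} {G : Subgroup (Equiv.Perm X.Pt)}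

/-- A relation between families: `(i, g, j)` stands for the copy `g⁻¹ b_j` of `b_j` in `a_i`. -/
abbrev FamRel (A B : Tw (X.Obj G)) : Type := Set (A.ι × G × B.ι)

/-- The identity relation. -/
def idRel (A : Tw (X.Obj G)) : FamRel A A := {x | x.2.1 = 1 ∧ x.1 = x.2.2}

/-- Composition of relations. -/
def compRel {A B D : Tw (X.Obj G)} (R : FamRel A B) (S : FamRel B D) : FamRel A D :=
  {x | ∃ g j k, (x.1, g, j) ∈ R ∧ (j, k, x.2.2) ∈ S ∧ x.2.1 = k * g}

lemma mem_idRel {A : Tw (X.Obj G)} {i : A.ι} {g : G} {j : A.ι} :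
    (i, g, j) ∈ idRel A ↔ g = 1 ∧ i = j := Iff.rfl

lemma mem_compRel {A B D : Tw (X.Obj G)} {R : FamRel A B} {S : FamRel B D} {i : A.ι} {g : G}
    {l : D.ι} : (i, g, l) ∈ compRel R S ↔
      ∃ k j k', (i, k, j) ∈ R ∧ (j, k', l) ∈ S ∧ g = k' * k := Iff.rfl

/-- Every member of the target has at most one copy in the source. -/
def IsInj {A B : Tw (X.Obj G)} (R : FamRel A B) : Prop :=
  ∀ ⦃i g i' g' j⦄, (i, g, j) ∈ R → (i', g', j) ∈ R → i = i' ∧ g = g'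

/-- Every member of the target has a copy in the source. -/
def IsOnto {A B : Tw (X.Obj G)} (R : FamRel A B) : Prop := ∀ j, ∃ i g, (i, g, j) ∈ R

lemma obj_ne_bot (A : Tw (X.Obj G)) (i : A.ι) : A.obj i ≠ ⊥ := isPolytope_iff.1 (A.poly i)

/-- The relation of a diagram. -/
def spanRel {A B : Tw (X.Obj G)} (s : Span A B) : FamRel A B :=
  Set.range fun x => (s.left.map x, elt (s.right.hom x), s.right.map x)

lemma span_disjoint {A B : Tw (X.Obj G)} (s : Span A B) {x x' : s.apex.ι} (hne : x ≠ x')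
    (hm : s.left.map x = s.left.map x') : Disjoint (s.apex.obj x) (s.apex.obj x') :=
  disjoint_iff.2 (isInitial_iff.1 (s.isSubMap.disjoint hne hm _ (homOfLE inf_le_left)
    (homOfLE inf_le_right)))

lemma surjective_iff {A B : Tw (X.Obj G)} (s : Span A B) :
    Function.Surjective s.right.map ↔ IsOnto (spanRel s) := by
  constructor
  · intro h j
    obtain ⟨x, rfl⟩ := h j
    exact ⟨_, _, x, rfl⟩
  · intro h j
    obtain ⟨i, g, x, e⟩ := h j
    exact ⟨x, (Prod.mk.inj (Prod.mk.inj e).2).2⟩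

variable [hG : Fact (G ≤ X.isometryGroup)]

/-- The relations which come from diagrams. -/
structure IsSubRel {A B : Tw (X.Obj G)} (R : FamRel A B) : Prop where
  finite : R.Finite
  le : ∀ ⦃i g j⦄, (i, g, j) ∈ R → g⁻¹ • B.obj j ≤ A.obj i
  disj : ∀ ⦃i g j g' j'⦄, (i, g, j) ∈ R → (i, g', j') ∈ R → (g, j) ≠ (g', j') →
    Disjoint (g⁻¹ • B.obj j) (g'⁻¹ • B.obj j')

/-- The copies in every member of the source cover it. -/
def IsCov {A B : Tw (X.Obj G)} (R : FamRel A B) : Prop :=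
  ∀ i c, (∀ g j, (i, g, j) ∈ R → g⁻¹ • B.obj j ≤ c) → A.obj i ≤ c

lemma smul_obj_ne_bot (A : Tw (X.Obj G)) (i : A.ι) (g : G) : g • A.obj i ≠ ⊥ :=
  fun h => obj_ne_bot A i (Obj.smul_eq_bot.1 h)

/-- A nonempty object below two copies in the same member forces them to agree. -/
lemma IsSubRel.eq_of_le {A B : Tw (X.Obj G)} {R : FamRel A B} (hR : IsSubRel R) {i : A.ι}
    {g g' : G} {j j' : B.ι} (h : (i, g, j) ∈ R) (h' : (i, g', j') ∈ R) {c : X.Obj G} (hc : c ≠ ⊥)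
    (hle : c ≤ g⁻¹ • B.obj j) (hle' : c ≤ g'⁻¹ • B.obj j') : g = g' ∧ j = j' := by
  by_contra hne
  exact hc (le_bot_iff.1 (hR.disj h h' (fun e => hne (Prod.mk.inj e)) hle hle'))

/-- Two distinct members with the same triple would be the same nonempty subset `g⁻¹ b_j` of `a_i`,
yet disjoint. -/
lemma span_triple_injective {A B : Tw (X.Obj G)} (s : Span A B) :
    Function.Injective fun x => (s.left.map x, elt (s.right.hom x), s.right.map x) := by
  intro x x' e
  simp only [Prod.mk.injEq] at e
  by_contra hne
  have := span_disjoint s hne e.1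
  rw [source_eq (s.right.hom x), source_eq (s.right.hom x'), e.2.1, e.2.2, disjoint_self] at this
  exact smul_obj_ne_bot _ _ _ this

lemma spanRel_isSubRel {A B : Tw (X.Obj G)} (s : Span A B) : IsSubRel (spanRel s) where
  finite := by
    have := s.apex.fin
    exact Set.finite_range _
  le := by
    rintro i g j ⟨x, e⟩
    simp only [Prod.mk.injEq] at e
    obtain ⟨rfl, rfl, rfl⟩ := e
    rw [← source_eq]
    exact leOfHom (s.left.hom x)
  disj := by
    rintro i g j g' j' ⟨x, e⟩ ⟨x', e'⟩ hne
    simp only [Prod.mk.injEq] at e e'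
    obtain ⟨rfl, rfl, rfl⟩ := e
    obtain ⟨e1, rfl, rfl⟩ := e'
    rw [← source_eq, ← source_eq]
    refine span_disjoint s ?_ e1.symm
    rintro rfl
    exact hne rfl

/-- The triple of a member of the apex determines the member as an object, so diagrams with the same
set of triples have matching apices. -/
lemma spanRel_eq_iff {A B : Tw (X.Obj G)} (s t : Span A B) : s.Rel t ↔ spanRel s = spanRel t := by
  constructor
  · rintro ⟨e, ι, hl, hr, -, hs⟩
    refine Set.Subset.antisymm ?_ ?_
    · rintro _ ⟨x, rfl⟩
      exact ⟨e x, by simp only [hl, hr, sq_iff.1 (hs x)]⟩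
    · rintro _ ⟨x, rfl⟩
      obtain ⟨x, rfl⟩ := e.surjective x
      exact ⟨x, by simp only [hl, hr, sq_iff.1 (hs x)]⟩
  · intro h
    let e : s.apex.ι ≃ t.apex.ι := (Equiv.ofInjective _ (span_triple_injective s)).trans
      ((Equiv.setCongr h).trans (Equiv.ofInjective _ (span_triple_injective t)).symm)
    have he : ∀ x, (t.left.map (e x), elt (t.right.hom (e x)), t.right.map (e x)) =
        (s.left.map x, elt (s.right.hom x), s.right.map x) := fun x =>
      congrArg Subtype.val ((Equiv.ofInjective _ (span_triple_injective t)).apply_symm_apply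
        (Equiv.setCongr h (Equiv.ofInjective _ (span_triple_injective s) x)))
    simp only [Prod.mk.injEq] at he
    refine ⟨e, fun x => eqToIso ?_, fun x => (he x).1.symm, fun x => (he x).2.2.symm,
      fun x => Subsingleton.elim _ _, fun x => sq_iff.2 (he x).2.1.symm⟩
    rw [source_eq (s.right.hom x), source_eq (t.right.hom (e x)), (he x).2.1, (he x).2.2]

/-- The diagram of a relation. -/
def ofRelSpan {A B : Tw (X.Obj G)} (R : FamRel A B) (hR : IsSubRel R) : Span A B where
  apex :=
    { ι := R
      fin := hR.finite.to_subtype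
      obj := fun x => x.1.2.1⁻¹ • B.obj x.1.2.2
      poly := fun x => isPolytope_iff.2 (smul_obj_ne_bot _ _ _) }
  left := ⟨fun x => x.1.1, fun x => homOfLE (hR.le x.2)⟩
  isSubMap := by
    rintro i ⟨⟨⟨i₁, g, j⟩, h⟩, e⟩ ⟨⟨⟨i₂, g', j'⟩, h'⟩, e'⟩ hne Z f f' -
    obtain rfl : i₁ = i := e
    obtain rfl : i₂ = i₁ := e'
    refine isInitial_iff.2 (le_bot_iff.1 (hR.disj h h' ?_ (leOfHom f) (leOfHom f')))
    rintro ⟨rfl, rfl⟩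
    exact hne rfl
  right := ⟨fun x => x.1.2.2, fun x => hmk x.1.2.1 (smul_inv_smul _ _)⟩

lemma spanRel_ofRelSpan {A B : Tw (X.Obj G)} (R : FamRel A B) (hR : IsSubRel R) :
    spanRel (ofRelSpan R hR) = R := by
  ext ⟨i, g, j⟩
  constructor
  · rintro ⟨x, e⟩
    have : x.1 = (i, g, j) := e
    rw [← this]
    exact x.2
  · intro h
    exact ⟨⟨_, h⟩, rfl⟩

lemma isCover_iff {A B : Tw (X.Obj G)} (s : Span A B) :
    s.left.IsCover (topology X G) ↔ IsCov (spanRel s) := by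
  have := s.apex.fin
  constructor
  · intro h i c hc
    obtain ⟨t, ht⟩ := (isCovering_iff _ _).1 (h i)
    rw [← ht]
    refine Finset.sup_le fun x _ => ?_
    rw [source_eq (s.right.hom x.1)]
    exact hc _ _ ⟨x.1, Prod.ext x.2 rfl⟩
  · intro h i
    cases nonempty_fintype {x : s.apex.ι // s.left.map x = i}
    refine (isCovering_iff_of_finite _ _).2
      (le_antisymm (Finset.sup_le fun x _ => leOfHom (s.left.fiberHom i x)) (h i _ ?_))
    rintro g j ⟨x, e⟩
    simp only [Prod.mk.injEq] at e
    obtain ⟨e, rfl, rfl⟩ := e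
    rw [← source_eq]
    exact Finset.le_sup (f := fun x : {x : s.apex.ι // s.left.map x = i} => s.apex.obj x.1)
      (Finset.mem_univ ⟨x, e⟩)

lemma injective_iff {A B : Tw (X.Obj G)} (s : Span A B) :
    Function.Injective s.right.map ↔ IsInj (spanRel s) := by
  constructor
  · rintro h i g i' g' j ⟨x, e⟩ ⟨x', e'⟩
    simp only [Prod.mk.injEq] at e e'
    obtain ⟨rfl, rfl, e⟩ := e
    obtain ⟨rfl, rfl, e'⟩ := e'
    obtain rfl := h (e.trans e'.symm)
    exact ⟨rfl, rfl⟩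
  · intro h x x' e
    have := h ⟨x, rfl⟩ ⟨x', by rw [e]⟩
    exact span_triple_injective s (by simp only [this.1, this.2, e])

variable (X G) in
/-- The category of families of polytopes. -/
abbrev Fam : Type 1 := SC (isPolytopeComplex X G)

variable {A B D : Fam X G}

/-- The relation of a morphism. -/
noncomputable def toRel (f : A ⟶ B) : FamRel A.tw B.tw :=
  Quotient.lift spanRel (fun s t h => (spanRel_eq_iff s t).1 h) f

lemma exists_mk_eq (f : A ⟶ B) : ∃ s : Span A.tw B.tw, (SC.Hom.mk s : A ⟶ B) = f :=
  Quotient.exists_rep f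

lemma toRel_isSubRel (f : A ⟶ B) : IsSubRel (toRel f) := by
  obtain ⟨s, rfl⟩ := exists_mk_eq f
  exact spanRel_isSubRel s

lemma toRel_injective {f f' : A ⟶ B} (h : toRel f = toRel f') : f = f' := by
  obtain ⟨s, rfl⟩ := exists_mk_eq f
  obtain ⟨t, rfl⟩ := exists_mk_eq f'
  exact Quotient.sound ((spanRel_eq_iff s t).2 h)

/-- The morphism of a relation. -/
noncomputable def ofRel (R : FamRel A.tw B.tw) (hR : IsSubRel R) : A ⟶ B :=
  SC.Hom.mk (ofRelSpan R hR)

@[simp] lemma toRel_ofRel (R : FamRel A.tw B.tw) (hR : IsSubRel R) :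
    toRel (ofRel R hR : A ⟶ B) = R := spanRel_ofRelSpan R hR

lemma toRel_id : toRel (𝟙 A) = idRel A.tw := by
  ext ⟨i, g, j⟩
  constructor
  · rintro ⟨x, e⟩
    simp only [Prod.mk.injEq] at e
    exact ⟨e.2.1.symm, e.1.symm.trans e.2.2⟩
  · intro h
    obtain ⟨rfl, rfl⟩ := mem_idRel.1 h
    exact ⟨i, rfl⟩

/-- The pulled back horizontal morphism has the same group element as the one along which it is
pulled back, so matching triples compose by multiplication in `G`. -/
lemma toRel_comp (f : A ⟶ B) (f' : B ⟶ D) : toRel (f ≫ f') = compRel (toRel f) (toRel f') := by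
  obtain ⟨s, rfl⟩ := exists_mk_eq f
  obtain ⟨t, rfl⟩ := exists_mk_eq f'
  change spanRel ((isPolytopeComplex X G).compSpan s t) = compRel (spanRel s) (spanRel t)
  have key : ∀ x : IsPolytopeComplex.compIdx s t,
      elt (((isPolytopeComplex X G).compSpan s t).right.hom x) =
      elt (t.right.hom x.1.2) * elt (s.right.hom x.1.1) := by
    intro x
    have e : elt (((isPolytopeComplex X G).compSpan s t).right.hom x) = elt (t.right.hom x.1.2) *
      elt ((isPolytopeComplex X G).pbH (s.right.hom x.1.1) (IsPolytopeComplex.compV s t x)) := rfl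
    rw [e]
    refine congrArg (elt (t.right.hom x.1.2) * ·) ?_
    exact sq_iff.1 ((isPolytopeComplex X G).pb_isPullbackSq (s.right.hom x.1.1)
      (IsPolytopeComplex.compV s t x)).1
  ext ⟨i, g, l⟩
  constructor
  · rintro ⟨x, e⟩
    simp only [Prod.mk.injEq] at e
    obtain ⟨rfl, rfl, rfl⟩ := e
    exact ⟨_, _, _, ⟨x.1.1, rfl⟩, ⟨x.1.2, Prod.ext x.2 rfl⟩, key x⟩
  · rintro ⟨k, j, k', ⟨x, e⟩, ⟨y, e'⟩, rfl⟩
    simp only [Prod.mk.injEq] at e e'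
    obtain ⟨rfl, rfl, rfl⟩ := e
    obtain ⟨e', rfl, rfl⟩ := e'
    exact ⟨⟨(x, y), e'⟩, Prod.ext rfl (Prod.ext (key ⟨(x, y), e'⟩) rfl)⟩

variable (X G) in
/-- Cofibrations of families. -/
abbrev cof : MorphismProperty (Fam X G) := SC.cofibrations (isPolytopeComplex X G)

variable (X G) in
/-- Weak equivalences of families. -/
abbrev weq : MorphismProperty (Fam X G) := SC.weakEquivalences (isPolytopeComplex X G)

lemma cof_iff (f : A ⟶ B) : cof X G f ↔ IsCov (toRel f) ∧ IsInj (toRel f) := by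
  constructor
  · rintro ⟨s, rfl, h1, h2⟩
    exact ⟨(isCover_iff s).1 h1, (injective_iff s).1 h2⟩
  · obtain ⟨s, rfl⟩ := exists_mk_eq f
    rintro ⟨h1, h2⟩
    exact ⟨s, rfl, (isCover_iff s).2 h1, (injective_iff s).2 h2⟩

lemma weq_iff (f : A ⟶ B) :
    weq X G f ↔ IsCov (toRel f) ∧ IsInj (toRel f) ∧ IsOnto (toRel f) := by
  constructor
  · rintro ⟨s, rfl, h1, h2⟩
    exact ⟨(isCover_iff s).1 h1, (injective_iff s).1 h2.1, (surjective_iff s).1 h2.2⟩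
  · obtain ⟨s, rfl⟩ := exists_mk_eq f
    rintro ⟨h1, h2, h3⟩
    exact ⟨s, rfl, (isCover_iff s).2 h1, (injective_iff s).2 h2, (surjective_iff s).2 h3⟩

end SpaceForm

end ScissorsCongruence

/-! ### Common refinements, zero objects and isomorphisms -/

namespace ScissorsCongruence

namespace SpaceForm

variable {X : SpaceForm} {G : Subgroup (Equiv.Perm X.Pt)}

/-- Finitely many finite partitions of an object have a coarsest common refinement. -/
lemma exists_common_refinement (d : X.Obj G) {𝓤 : Set (Set (X.Obj G))} (h𝓤 : 𝓤.Finite)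
    (hfin : ∀ U ∈ 𝓤, U.Finite) (hdisj : ∀ U ∈ 𝓤, ∀ u ∈ U, ∀ u' ∈ U, u ≠ u' → Disjoint u u')
    (hcov : ∀ U ∈ 𝓤, ∀ c, (∀ u ∈ U, u ≤ c) → d ≤ c) :
    ∃ W : Set (X.Obj G), W.Finite ∧ (∀ w ∈ W, w ≠ ⊥) ∧ (∀ w ∈ W, w ≤ d) ∧
      (∀ w ∈ W, ∀ w' ∈ W, w ≠ w' → Disjoint w w') ∧ (∀ c, (∀ w ∈ W, w ≤ c) → d ≤ c) ∧
      (∀ w ∈ W, ∀ U ∈ 𝓤, ∃ u ∈ U, w ≤ u) ∧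
      ∀ t, t ≠ ⊥ → t ≤ d → (∀ U ∈ 𝓤, ∃ u ∈ U, t ≤ u) → ∃ w ∈ W, t ≤ w := by
  induction 𝓤, h𝓤 using Set.Finite.induction_on with
  | empty =>
    -- Parts have to be nonempty, so the empty object gets the empty partition.
    by_cases hd : d = ⊥
    · subst hd
      exact ⟨∅, Set.finite_empty, by simp, by simp, by simp, by simp, by simp,
        fun t ht h => (ht (le_bot_iff.1 h)).elim⟩
    · exact ⟨{d}, Set.finite_singleton d, by simpa using hd, by simp, by simp, by simp, by simp,
        fun t _ h _ => ⟨d, rfl, h⟩⟩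
  | @insert U 𝓤 _ _ ih =>
    obtain ⟨W, h1, h2, h3, h4, h5, h6, h7⟩ := ih
      (fun V hV => hfin V (Set.mem_insert_of_mem _ hV))
      (fun V hV => hdisj V (Set.mem_insert_of_mem _ hV))
      (fun V hV => hcov V (Set.mem_insert_of_mem _ hV))
    have hU := Set.mem_insert U 𝓤
    -- The new parts are the nonempty meets of an old part with a part of `U`.
    refine ⟨Set.image2 (· ⊓ ·) W U \ {⊥}, ((h1.image2 _ (hfin U hU)).subset Set.sdiff_subset),
      fun w hw => hw.2, ?_, ?_, ?_, ?_, ?_⟩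
    · rintro _ ⟨⟨w, hw, u, hu, rfl⟩, -⟩
      exact inf_le_left.trans (h3 w hw)
    · rintro _ ⟨⟨w, hw, u, hu, rfl⟩, -⟩ _ ⟨⟨w', hw', u', hu', rfl⟩, -⟩ hne
      by_cases e : w = w'
      · have e' : u ≠ u' := by
          rintro rfl
          exact hne (by rw [e])
        exact (hdisj U hU u hu u' hu' e').mono inf_le_right inf_le_right
      · exact (h4 w hw w' hw' e).mono inf_le_left inf_le_left
    · intro c hc
      refine h5 c fun w hw => ?_
      have hle : d ≤ (hfin U hU).toFinset.sup id :=
        hcov U hU _ fun u hu => Finset.le_sup (f := id) ((hfin U hU).mem_toFinset.2 hu)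
      -- The old part lies below the join of `U`, so by distributivity it is the join of its meets
      -- with the parts of `U`.
      rw [← inf_eq_left.2 ((h3 w hw).trans hle), Finset.sup_inf_distrib_left]
      refine Finset.sup_le fun u hu => ?_
      by_cases h0 : w ⊓ u = ⊥
      · exact h0.le.trans bot_le
      · exact hc _ ⟨⟨w, hw, u, (hfin U hU).mem_toFinset.1 hu, rfl⟩, h0⟩
    · rintro _ ⟨⟨w, hw, u, hu, rfl⟩, -⟩ V hV
      rcases hV with rfl | hV
      · exact ⟨u, hu, inf_le_right⟩
      · obtain ⟨v, hv, hle⟩ := h6 w hw V hV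
        exact ⟨v, hv, inf_le_left.trans hle⟩
    · intro t ht htd h
      obtain ⟨w, hw, hle⟩ := h7 t ht htd fun V hV => h V (Set.mem_insert_of_mem _ hV)
      obtain ⟨u, hu, hle'⟩ := h U hU
      exact ⟨w ⊓ u, ⟨⟨w, hw, u, hu, rfl⟩, fun h0 => ht (le_bot_iff.1
        ((le_inf hle hle').trans (le_of_eq h0)))⟩, le_inf hle hle'⟩

variable [hG : Fact (G ≤ X.isometryGroup)]

section Basic

variable {A B D : Fam X G}

lemma hom_ext {f f' : A ⟶ B} (h : ∀ i g j, (i, g, j) ∈ toRel f ↔ (i, g, j) ∈ toRel f') :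
    f = f' := toRel_injective (Set.ext fun x => h x.1 x.2.1 x.2.2)

lemma mem_comp_iff {f : A ⟶ B} {f' : B ⟶ D} {i : A.tw.ι} {g : G} {l : D.tw.ι} :
    (i, g, l) ∈ toRel (f ≫ f') ↔
      ∃ k j k', (i, k, j) ∈ toRel f ∧ (j, k', l) ∈ toRel f' ∧ g = k' * k := by
  rw [toRel_comp, mem_compRel]

lemma isSubRel_empty (A B : Tw (X.Obj G)) : IsSubRel (∅ : FamRel A B) :=
  ⟨Set.finite_empty, fun _ _ _ h => h.elim, fun _ _ _ _ _ h => h.elim⟩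

/-- The empty relation is a morphism between any two families. On a zero object it equals the
identity, which contains a triple for every index. -/
lemma isZero_iff (Z : Fam X G) : IsZero Z ↔ IsEmpty Z.tw.ι := by
  constructor
  · refine fun h => ⟨fun i => ?_⟩
    have e : 𝟙 Z = ofRel ∅ (isSubRel_empty _ _) := h.eq_of_src _ _
    have hi : (i, (1 : G), i) ∈ toRel (𝟙 Z) := by
      rw [toRel_id]
      exact ⟨rfl, rfl⟩
    rw [e, toRel_ofRel] at hi
    exact hi
  · intro h
    refine ⟨fun Y => ⟨⟨⟨ofRel ∅ (isSubRel_empty _ _)⟩, fun f => hom_ext fun i => h.elim i⟩⟩,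
      fun Y => ⟨⟨⟨ofRel ∅ (isSubRel_empty _ _)⟩, fun f => hom_ext fun _ _ i => h.elim i⟩⟩⟩

/-- The empty family. -/
def zeroFam : Fam X G := ⟨⟨Empty, inferInstance, Empty.elim, fun i => i.elim⟩⟩

lemma isZero_zeroFam : IsZero (zeroFam : Fam X G) :=
  (isZero_iff _).2 (inferInstanceAs (IsEmpty Empty))

lemma weq.cof {f : A ⟶ B} (h : weq X G f) : cof X G f := by
  rw [weq_iff] at h
  exact (cof_iff f).2 ⟨h.1, h.2.1⟩

lemma isCov_comp {f : A ⟶ B} {f' : B ⟶ D} (h : IsCov (toRel f)) (h' : IsCov (toRel f')) :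
    IsCov (toRel (f ≫ f')) := by
  refine fun i c hc => h i c fun g j hj => Obj.inv_smul_le.2 (h' j _ fun k l hl => ?_)
  rw [← Obj.inv_smul_le, ← mul_smul, ← mul_inv_rev]
  exact hc _ _ (mem_comp_iff.2 ⟨_, _, _, hj, hl, rfl⟩)

lemma isInj_comp {f : A ⟶ B} {f' : B ⟶ D} (h : IsInj (toRel f)) (h' : IsInj (toRel f')) :
    IsInj (toRel (f ≫ f')) := by
  intro i g i' g' l hl hl'
  obtain ⟨k, j, k₁, h1, h2, rfl⟩ := mem_comp_iff.1 hl
  obtain ⟨k', j', k₁', h1', h2', rfl⟩ := mem_comp_iff.1 hl'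
  obtain ⟨rfl, rfl⟩ := h' h2 h2'
  obtain ⟨rfl, rfl⟩ := h h1 h1'
  exact ⟨rfl, rfl⟩

lemma isOnto_comp {f : A ⟶ B} {f' : B ⟶ D} (h : IsOnto (toRel f)) (h' : IsOnto (toRel f')) :
    IsOnto (toRel (f ≫ f')) := by
  intro l
  obtain ⟨j, k, hj⟩ := h' l
  obtain ⟨i, g, hi⟩ := h j
  exact ⟨i, _, mem_comp_iff.2 ⟨_, _, _, hi, hj, rfl⟩⟩

lemma cof_comp {f : A ⟶ B} {f' : B ⟶ D} (h : cof X G f) (h' : cof X G f') :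
    cof X G (f ≫ f') := by
  rw [cof_iff] at *
  exact ⟨isCov_comp h.1 h'.1, isInj_comp h.2 h'.2⟩

lemma weq_comp {f : A ⟶ B} {f' : B ⟶ D} (h : weq X G f) (h' : weq X G f') :
    weq X G (f ≫ f') := by
  rw [weq_iff] at *
  exact ⟨isCov_comp h.1 h'.1, isInj_comp h.2.1 h'.2.1, isOnto_comp h.2.2 h'.2.2⟩

/-- The identity relations, written as composites with the inverse, provide for every `i` a single
copy which fills `a_i`, and for every `j` a triple of the inverse which determines the only copy of
`b_j`. -/
lemma weq_of_isIso (f : A ⟶ B) [IsIso f] : weq X G f := by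
  have h1 : ∀ i, (i, (1 : G), i) ∈ toRel (f ≫ inv f) := fun i => by
    rw [IsIso.hom_inv_id, toRel_id]
    exact ⟨rfl, rfl⟩
  have h2 : ∀ j, (j, (1 : G), j) ∈ toRel (inv f ≫ f) := fun j => by
    rw [IsIso.inv_hom_id, toRel_id]
    exact ⟨rfl, rfl⟩
  refine (weq_iff f).2 ⟨fun i c hc => ?_, fun i g i' g' j h h' => ?_, fun j => ?_⟩
  · obtain ⟨g, j, k, h, h', e⟩ := mem_comp_iff.1 (h1 i)
    obtain rfl := eq_inv_of_mul_eq_one_left e.symm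
    have := (toRel_isSubRel (inv f)).le h'
    rw [Obj.inv_smul_le] at this
    exact this.trans (hc g j h)
  · obtain ⟨k, i₀, k', hk, hk', -⟩ := mem_comp_iff.1 (h2 j)
    have key : ∀ i g, (i, g, j) ∈ toRel f → k * g = 1 ∧ i = i₀ := fun i g h => by
      have : (i, k * g, i₀) ∈ toRel (f ≫ inv f) := mem_comp_iff.2 ⟨_, _, _, h, hk, rfl⟩
      rw [IsIso.hom_inv_id, toRel_id] at this
      exact this
    exact ⟨(key i g h).2.trans (key i' g' h').2.symm,
      mul_left_cancel ((key i g h).1.trans (key i' g' h').1.symm)⟩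
  · obtain ⟨k, i₀, k', hk, hk', -⟩ := mem_comp_iff.1 (h2 j)
    exact ⟨_, _, hk'⟩

/-- Covering localizes to a part `x` of a member: the relation is finite, so distributivity applies
to the join of the copies. -/
lemma IsCov.inf_le {A B : Tw (X.Obj G)} {R : FamRel A B} (hR : IsCov R) (hR' : IsSubRel R)
    {i : A.ι} {x c : X.Obj G} (h : ∀ g j, (i, g, j) ∈ R → g⁻¹ • B.obj j ⊓ x ≤ c) :
    A.obj i ⊓ x ≤ c := by
  classical
  have hle : A.obj i ≤ hR'.finite.toFinset.sup fun y =>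
      if y.1 = i then y.2.1⁻¹ • B.obj y.2.2 else ⊥ := by
    refine hR i _ fun g j hj => ?_
    have := Finset.le_sup (f := fun y : A.ι × G × B.ι =>
      if y.1 = i then y.2.1⁻¹ • B.obj y.2.2 else ⊥) (hR'.finite.mem_toFinset.2 hj)
    simpa using this
  refine (inf_le_inf_right x hle).trans ?_
  rw [Finset.sup_inf_distrib_right]
  refine Finset.sup_le fun y hy => ?_
  obtain ⟨i', g, j⟩ := y
  by_cases e : i' = i
  · subst e
    simpa using h g j (hR'.finite.mem_toFinset.1 hy)
  · simp [e]

end Basic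

/-! ### Pushouts along cofibrations, in terms of relations -/

section Pushout

/-- A partition of the members of `D` which is the coarsest one such that all copies in `A` of the
parts are contained in the parts given by `R`. -/
structure IsRefinement {A B D : Tw (X.Obj G)} (R : FamRel A B) (S : FamRel A D)
    (W : D.ι → Set (X.Obj G)) : Prop where
  finite : ∀ k, (W k).Finite
  ne_bot : ∀ ⦃k w⦄, w ∈ W k → w ≠ ⊥
  le : ∀ ⦃k w⦄, w ∈ W k → w ≤ D.obj k
  disj : ∀ ⦃k w w'⦄, w ∈ W k → w' ∈ W k → w ≠ w' → Disjoint w w'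
  cov : ∀ k c, (∀ w ∈ W k, w ≤ c) → D.obj k ≤ c
  refines : ∀ ⦃k w i g⦄, w ∈ W k → (i, g, k) ∈ S →
    ∃ h j, (i, h, j) ∈ R ∧ w ≤ g • h⁻¹ • B.obj j
  maximal : ∀ ⦃k t⦄, t ≠ ⊥ → t ≤ D.obj k →
    (∀ i g, (i, g, k) ∈ S → ∃ h j, (i, h, j) ∈ R ∧ t ≤ g • h⁻¹ • B.obj j) → ∃ w ∈ W k, t ≤ w

/-- For each copy `g⁻¹ d_k` in `a_i` the partition of `a_i` given by `R`, translated by `g`, covers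
`d_k`. There are finitely many such partitions, and `W k` is their coarsest common refinement. -/
lemma exists_isRefinement {A B D : Tw (X.Obj G)} {R : FamRel A B} {S : FamRel A D}
    (hR : IsSubRel R) (hS : IsSubRel S) (hcov : IsCov R) : ∃ W, IsRefinement R S W := by
  let P : D.ι → A.ι × G × D.ι → Set (X.Obj G) := fun k x =>
    (fun y : A.ι × G × B.ι => x.2.1 • y.2.1⁻¹ • B.obj y.2.2) '' {y ∈ R | y.1 = x.1}
  have key := fun k => exists_common_refinement (D.obj k) (𝓤 := P k '' {x ∈ S | x.2.2 = k})
    ((hS.finite.subset (Set.sep_subset _ _)).image _)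
    (by
      rintro _ ⟨x, -, rfl⟩
      exact (hR.finite.subset (Set.sep_subset _ _)).image _)
    (by
      rintro _ ⟨x, -, rfl⟩ _ ⟨⟨i, h, j⟩, ⟨hy, e⟩, rfl⟩ _ ⟨⟨i', h', j'⟩, ⟨hy', e'⟩, rfl⟩ hne
      obtain rfl : i' = i := Eq.trans e' (Eq.symm e)
      refine Obj.smul_disjoint.2 (hR.disj hy hy' ?_)
      rintro ⟨⟩
      exact hne rfl)
    (by
      rintro _ ⟨⟨i, g, k'⟩, ⟨hx, rfl⟩, rfl⟩ c hc
      refine (Obj.inv_smul_le.1 (hS.le hx)).trans ?_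
      have : A.obj i ≤ g⁻¹ • c := hcov i _ fun h j hj => by
        have := hc _ ⟨_, ⟨hj, rfl⟩, rfl⟩
        rw [← Obj.smul_le_smul (g := g), smul_inv_smul]
        exact this
      rwa [← Obj.smul_le_smul (g := g), smul_inv_smul] at this)
  choose W h1 h2 h3 h4 h5 h6 h7 using key
  refine ⟨W, h1, h2, h3, fun k w w' hw hw' => h4 k w hw w' hw', h5, ?_, ?_⟩
  · intro k w i g hw hi
    obtain ⟨_, ⟨⟨i', h, j⟩, ⟨hy, e⟩, rfl⟩, hle⟩ := h6 k w hw _ ⟨_, ⟨hi, rfl⟩, rfl⟩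
    obtain rfl : i' = i := e
    exact ⟨h, j, hy, hle⟩
  · intro k t ht htd h
    refine h7 k t ht htd ?_
    rintro _ ⟨⟨i, g, k'⟩, ⟨hx, rfl⟩, rfl⟩
    obtain ⟨l, j, hj, hle⟩ := h i g hx
    exact ⟨_, ⟨(i, l, j), ⟨hj, rfl⟩, rfl⟩, hle⟩

variable {A B D : Tw (X.Obj G)} {R : FamRel A B} {S : FamRel A D} {W : D.ι → Set (X.Obj G)}

/-- The members of `B` which have no copy in `A`. -/
abbrev Compl (R : FamRel A B) : Type := {j : B.ι // ∀ i g, (i, g, j) ∉ R}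

/-- The pushout: the partition of `D` together with the members of `B` which have no copy
in `A`. -/
abbrev glueTw (hW : IsRefinement R S W) : Tw (X.Obj G) where
  ι := (Σ k, W k) ⊕ Compl R
  fin := by
    have := D.fin
    have := B.fin
    have := fun k => (hW.finite k).to_subtype
    infer_instance
  obj := Sum.elim (fun x => x.2.1) fun j => B.obj j.1
  poly := by
    rintro (⟨k, w⟩ | j)
    · exact isPolytope_iff.2 (hW.ne_bot w.2)
    · exact B.poly j.1

/-- The relation of the map from `D` to the pushout. -/
def glueRight (hW : IsRefinement R S W) : FamRel D (glueTw hW) :=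
  {x | match x with
    | (k, γ, Sum.inl y) => γ = 1 ∧ k = y.1
    | (_, _, Sum.inr _) => False}

/-- The relation of the map from `B` to the pushout. -/
def glueLeft (hW : IsRefinement R S W) : FamRel B (glueTw hW) :=
  {x | match x with
    | (j, γ, Sum.inl y) => ∃ i g h, (i, g, y.1) ∈ S ∧ (i, h, j) ∈ R ∧ g = γ * h ∧
        γ⁻¹ • y.2.1 ≤ B.obj j
    | (j, γ, Sum.inr j') => γ = 1 ∧ j = j'.1}

variable {hW : IsRefinement R S W}

lemma mem_glueRight_inl {k : D.ι} {γ : G} {y : Σ k, W k} :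
    (k, γ, Sum.inl y) ∈ glueRight hW ↔ γ = 1 ∧ k = y.1 := Iff.rfl

lemma mem_glueLeft_inl {j : B.ι} {γ : G} {y : Σ k, W k} :
    (j, γ, Sum.inl y) ∈ glueLeft hW ↔ ∃ i g h, (i, g, y.1) ∈ S ∧ (i, h, j) ∈ R ∧ g = γ * h ∧
        γ⁻¹ • y.2.1 ≤ B.obj j := Iff.rfl

lemma mem_glueLeft_inr {j : B.ι} {γ : G} {y : Compl R} :
    (j, γ, Sum.inr y) ∈ glueLeft hW ↔ γ = 1 ∧ j = y.1 := Iff.rfl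

lemma glueRight_isSubRel : IsSubRel (glueRight hW) where
  finite := by
    have := D.fin
    have := (glueTw hW).fin
    refine ((Set.finite_univ (α := D.ι)).prod ((Set.finite_singleton (1 : G)).prod
      (Set.finite_univ (α := (glueTw hW).ι)))).subset ?_
    rintro ⟨k, γ, y | y⟩ h
    · exact ⟨trivial, h.1, trivial⟩
    · exact h.elim
  le := by
    rintro k γ (⟨k', w⟩ | y) h
    · obtain ⟨rfl, rfl⟩ := mem_glueRight_inl.1 h
      rw [inv_one, one_smul]
      exact hW.le w.2
    · exact h.elim
  disj := by
    rintro k γ (⟨k₁, w⟩ | y) γ' (⟨k₂, w'⟩ | y') h h' hne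
    · obtain ⟨rfl, rfl⟩ := mem_glueRight_inl.1 h
      obtain ⟨rfl, e⟩ := mem_glueRight_inl.1 h'
      dsimp only at e
      subst e
      refine Obj.smul_disjoint.2 (hW.disj w.2 w'.2 fun e => hne ?_)
      obtain rfl : w = w' := Subtype.ext e
      rfl
    · exact h'.elim
    · exact h.elim
    · exact h.elim

lemma glueRight_isCov : IsCov (glueRight hW) := by
  refine fun k c hc => hW.cov k c fun w hw => ?_
  have := hc 1 (Sum.inl ⟨k, w, hw⟩) (mem_glueRight_inl.2 ⟨rfl, rfl⟩)
  rwa [inv_one, one_smul] at this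

lemma glueRight_isInj : IsInj (glueRight hW) := by
  rintro k γ k' γ' (⟨l, w⟩ | y) h h'
  · exact ⟨h.2.trans h'.2.symm, h.1.trans h'.1.symm⟩
  · exact h.elim

/-- By injectivity `i` and `h` depend only on `j`, so all parts placed in `b_j` come from the same
`a_i`. Parts from different copies of members of `D` are disjoint by `hS`, parts of one copy by the
partition. -/
lemma glueLeft_isSubRel (hR : IsSubRel R) (hS : IsSubRel S) (hinj : IsInj R) :
    IsSubRel (glueLeft hW) where
  finite := by
    have := B.fin
    have := (glueTw hW).fin
    refine ((Set.finite_univ (α := B.ι)).prod (((Set.finite_singleton (1 : G)).union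
      (Set.Finite.image2 (fun g h => g * h⁻¹) (hS.finite.image fun x => x.2.1)
        (hR.finite.image fun x => x.2.1))).prod
      (Set.finite_univ (α := (glueTw hW).ι)))).subset ?_
    rintro ⟨j, γ, y | y⟩ h
    · obtain ⟨i, g, l, hi, hj, rfl, -⟩ := mem_glueLeft_inl.1 h
      exact ⟨trivial, Or.inr ⟨_, ⟨_, hi, rfl⟩, _, ⟨_, hj, rfl⟩, mul_inv_cancel_right γ l⟩, trivial⟩
    · exact ⟨trivial, Or.inl h.1, trivial⟩
  le := by
    rintro j γ (y | y) h
    · obtain ⟨i, g, l, hi, hj, rfl, hle⟩ := mem_glueLeft_inl.1 h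
      exact hle
    · obtain ⟨rfl, rfl⟩ := mem_glueLeft_inr.1 h
      rw [inv_one, one_smul]
      exact le_rfl
  disj := by
    rintro j γ (⟨k, w⟩ | y) γ' (⟨k', w'⟩ | y') h h' hne
    · obtain ⟨i, g, l, hi, hj, rfl, hle⟩ := mem_glueLeft_inl.1 h
      obtain ⟨i', g', l', hi', hj', rfl, hle'⟩ := mem_glueLeft_inl.1 h'
      obtain ⟨rfl, rfl⟩ := hinj hj hj'
      by_cases e : ((γ * l, k) : G × D.ι) = (γ' * l, k')
      · obtain ⟨e1, rfl⟩ := Prod.mk.inj e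
        obtain rfl := mul_right_cancel e1
        refine Obj.smul_disjoint.2 (hW.disj w.2 w'.2 fun e => hne ?_)
        obtain rfl : w = w' := Subtype.ext e
        rfl
      · have := hS.disj hi hi' e
        rw [mul_inv_rev, mul_inv_rev, mul_smul, mul_smul, Obj.smul_disjoint] at this
        exact this.mono (Obj.smul_le_smul.2 (hW.le w.2)) (Obj.smul_le_smul.2 (hW.le w'.2))
    · obtain ⟨i, g, l, hi, hj, rfl, hle⟩ := mem_glueLeft_inl.1 h
      obtain ⟨rfl, rfl⟩ := mem_glueLeft_inr.1 h'
      exact (y'.2 _ _ hj).elim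
    · obtain ⟨i, g, l, hi, hj, rfl, hle⟩ := mem_glueLeft_inl.1 h'
      obtain ⟨rfl, rfl⟩ := mem_glueLeft_inr.1 h
      exact (y.2 _ _ hj).elim
    · obtain ⟨rfl, rfl⟩ := mem_glueLeft_inr.1 h
      obtain ⟨rfl, e⟩ := mem_glueLeft_inr.1 h'
      exact (hne (by rw [Subtype.ext e])).elim

/-- Both sides list the parts of all copies in `a_i` of members of `D`: by `refines` each part lies
in the copy of some `b_j`, and by `hinj` this copy of `b_j` is the only one. -/
lemma glue_comm (hinj : IsInj R) : compRel R (glueLeft hW) = compRel S (glueRight hW) := by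
  ext ⟨i, γ, y⟩
  rw [mem_compRel, mem_compRel]
  constructor
  · rintro ⟨l, j, γ', hj, hy, rfl⟩
    rcases y with y | y
    · obtain ⟨i', g, l', hi', hj', rfl, -⟩ := mem_glueLeft_inl.1 hy
      obtain ⟨rfl, rfl⟩ := hinj hj hj'
      exact ⟨_, _, 1, hi', mem_glueRight_inl.2 ⟨rfl, rfl⟩, (one_mul _).symm⟩
    · obtain ⟨rfl, rfl⟩ := mem_glueLeft_inr.1 hy
      exact (y.2 _ _ hj).elim
  · rintro ⟨g, k, γ', hk, hy, rfl⟩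
    rcases y with y | y
    · obtain ⟨rfl, rfl⟩ := mem_glueRight_inl.1 hy
      obtain ⟨l, j, hj, hle⟩ := hW.refines y.2.2 hk
      refine ⟨l, j, g * l⁻¹, hj, mem_glueLeft_inl.2 ⟨i, g, l, hk, hj, by group, ?_⟩, by group⟩
      rw [Obj.inv_smul_le, mul_smul]
      exact hle
    · exact hy.elim

/-- The relation of the map out of the pushout. -/
def glueDesc (hW : IsRefinement R S W) {T : Tw (X.Obj G)} (U : FamRel B T) (V : FamRel D T) :
    FamRel (glueTw hW) T :=
  {x | match x with
    | (Sum.inl y, γ, l) => (y.1, γ, l) ∈ V ∧ γ⁻¹ • T.obj l ≤ y.2.1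
    | (Sum.inr j, γ, l) => (j.1, γ, l) ∈ U}

variable {T : Tw (X.Obj G)} {U : FamRel B T} {V : FamRel D T}

lemma mem_glueDesc_inl {y : Σ k, W k} {γ : G} {l : T.ι} :
    (Sum.inl y, γ, l) ∈ glueDesc hW U V ↔ (y.1, γ, l) ∈ V ∧ γ⁻¹ • T.obj l ≤ y.2.1 := Iff.rfl

lemma mem_glueDesc_inr {y : Compl R} {γ : G} {l : T.ι} :
    (Sum.inr y, γ, l) ∈ glueDesc hW U V ↔ (y.1, γ, l) ∈ U := Iff.rfl

lemma glueDesc_isSubRel (hU : IsSubRel U) (hV : IsSubRel V) : IsSubRel (glueDesc hW U V) where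
  finite := by
    have := (glueTw hW).fin
    refine ((Set.finite_univ (α := (glueTw hW).ι)).prod
      ((hU.finite.image Prod.snd).union (hV.finite.image Prod.snd))).subset ?_
    rintro ⟨y | y, γ, l⟩ h
    · exact ⟨trivial, Or.inr ⟨_, h.1, rfl⟩⟩
    · exact ⟨trivial, Or.inl ⟨_, h, rfl⟩⟩
  le := by
    rintro (y | y) γ l h
    · exact h.2
    · exact hU.le h
  disj := by
    rintro (y | y) γ l γ' l' h h' hne
    · exact hV.disj h.1 h'.1 hne
    · exact hU.disj h h' hne

/-- A copy of `t_l` in `d_k`, carried to any `a_i` in which `d_k` has a copy, factors through some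
`b_j` by commutativity. So it respects all the partitions, and since `W k` is the coarsest
refinement it lies in one part. -/
lemma exists_part_of_mem (hW : IsRefinement R S W) (hU : IsSubRel U) (hV : IsSubRel V)
    (hcomm : compRel R U = compRel S V) {k : D.ι} {γ : G} {l : T.ι} (h : (k, γ, l) ∈ V) :
    ∃ w ∈ W k, γ⁻¹ • T.obj l ≤ w := by
  refine hW.maximal (smul_obj_ne_bot _ _ _) (hV.le h) fun i g hi => ?_
  have : (i, γ * g, l) ∈ compRel R U := by
    rw [hcomm]
    exact ⟨_, _, _, hi, h, rfl⟩
  obtain ⟨l', j, γ', hj, hl, e⟩ := mem_compRel.1 this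
  refine ⟨l', j, hj, ?_⟩
  have := hU.le hl
  rw [← mul_smul, ← Obj.inv_smul_le, ← mul_smul, ← mul_inv_rev]
  have e' : γ' = γ * (g * l'⁻¹) := by rw [← mul_assoc, e, mul_inv_cancel_right]
  rwa [e'] at this

lemma glueRight_desc (hU : IsSubRel U) (hV : IsSubRel V) (hcomm : compRel R U = compRel S V) :
    compRel (glueRight hW) (glueDesc hW U V) = V := by
  ext ⟨k, γ, l⟩
  rw [mem_compRel]
  constructor
  · rintro ⟨γ₁, (y | y), γ₂, h, h', rfl⟩
    · obtain ⟨rfl, rfl⟩ := mem_glueRight_inl.1 h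
      rw [mul_one]
      exact h'.1
    · exact h.elim
  · intro h
    obtain ⟨w, hw, hle⟩ := exists_part_of_mem hW hU hV hcomm h
    exact ⟨1, Sum.inl ⟨k, w, hw⟩, γ, mem_glueRight_inl.2 ⟨rfl, rfl⟩, ⟨h, hle⟩, (mul_one _).symm⟩

/-- If `b_j` has a copy in `a_i`, then its copies of `t_l` are carried to `a_i` and, by
commutativity, to some part of some `d_k`. A nonempty object cannot lie in two disjoint copies
inside `a_i`, so that part belongs to the same `b_j`. -/
lemma glueLeft_desc (hR : IsSubRel R) (hU : IsSubRel U) (hV : IsSubRel V)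
    (hcomm : compRel R U = compRel S V) :
    compRel (glueLeft hW) (glueDesc hW U V) = U := by
  ext ⟨j, γ, l⟩
  rw [mem_compRel]
  constructor
  · rintro ⟨γ₁, (⟨k, w⟩ | y), γ₂, h, h', rfl⟩
    · obtain ⟨i, g, m, hi, hj, rfl, hle⟩ := mem_glueLeft_inl.1 h
      obtain ⟨hv, hle'⟩ := mem_glueDesc_inl.1 h'
      have : (i, γ₂ * (γ₁ * m), l) ∈ compRel R U := by
        rw [hcomm]
        exact ⟨_, _, _, hi, hv, rfl⟩
      obtain ⟨m', j', γ₃, hj', hl, e⟩ := mem_compRel.1 this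
      obtain ⟨rfl, rfl⟩ := hR.eq_of_le hj hj' (smul_obj_ne_bot T l (γ₂ * (γ₁ * m))⁻¹)
        (by
          rw [mul_inv_rev, mul_inv_rev, mul_smul, mul_smul, Obj.smul_le_smul]
          exact (Obj.smul_le_smul.2 hle').trans hle)
        (by
          rw [e, mul_inv_rev, mul_smul, Obj.smul_le_smul]
          exact hU.le hl)
      rw [← mul_assoc] at e
      rwa [mul_right_cancel e]
    · obtain ⟨rfl, rfl⟩ := mem_glueLeft_inr.1 h
      rw [mul_one]
      exact h'
  · intro h
    by_cases hj : ∀ i g, (i, g, j) ∉ R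
    · exact ⟨1, Sum.inr ⟨j, hj⟩, γ, mem_glueLeft_inr.2 ⟨rfl, rfl⟩, h, (mul_one _).symm⟩
    push Not at hj
    obtain ⟨i, m, hj⟩ := hj
    have : (i, γ * m, l) ∈ compRel S V := by
      rw [← hcomm]
      exact ⟨_, _, _, hj, h, rfl⟩
    obtain ⟨g, k, γ₂, hk, hl, e⟩ := mem_compRel.1 this
    obtain ⟨w, hw, hle⟩ := exists_part_of_mem hW hU hV hcomm hl
    obtain ⟨m', j', hj', hle'⟩ := hW.refines hw hk
    have hle'' : g⁻¹ • w ≤ m'⁻¹ • B.obj j' := Obj.inv_smul_le.2 hle'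
    obtain ⟨rfl, rfl⟩ := hR.eq_of_le hj hj' (smul_obj_ne_bot T l (γ * m)⁻¹)
      (by
        rw [mul_inv_rev, mul_smul, Obj.smul_le_smul]
        exact hU.le h)
      (by
        rw [e, mul_inv_rev, mul_smul]
        exact (Obj.smul_le_smul.2 hle).trans hle'')
    refine ⟨g * m⁻¹, Sum.inl ⟨k, w, hw⟩, γ₂, mem_glueLeft_inl.2 ⟨i, g, m, hk, hj, by group, ?_⟩,
      mem_glueDesc_inl.2 ⟨hl, hle⟩, ?_⟩
    · rw [Obj.inv_smul_le, mul_smul]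
      exact hle'
    · rw [← mul_assoc, ← e, mul_inv_cancel_right]

lemma eq_glueDesc {Q : FamRel (glueTw hW) T} (hQ : IsSubRel Q)
    (hU : compRel (glueLeft hW) Q = U) (hV : compRel (glueRight hW) Q = V) :
    Q = glueDesc hW U V := by
  subst hU hV
  ext ⟨y, γ, l⟩
  rcases y with ⟨k, w⟩ | y
  · rw [mem_glueDesc_inl]
    constructor
    · exact fun h => ⟨⟨1, _, γ, mem_glueRight_inl.2 ⟨rfl, rfl⟩, h, (mul_one _).symm⟩, hQ.le h⟩
    · rintro ⟨⟨γ₁, (⟨k', w'⟩ | y), γ₂, h, h', e⟩, hle⟩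
      · obtain ⟨rfl, e'⟩ := mem_glueRight_inl.1 h
        dsimp only at e e' hle
        subst e'
        rw [mul_one] at e
        subst e
        -- A nonempty copy lies in only one of the disjoint parts, so `Q` is determined by its
        -- composites.
        by_cases hw : w.1 = w'.1
        · rw [Subtype.ext hw]
          exact h'
        · exact (smul_obj_ne_bot _ _ _ (le_bot_iff.1 (hW.disj w.2 w'.2 hw hle (hQ.le h')))).elim
      · exact h.elim
  · rw [mem_glueDesc_inr]
    constructor
    · exact fun h => ⟨1, _, γ, mem_glueLeft_inr.2 ⟨rfl, rfl⟩, h, (mul_one _).symm⟩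
    · rintro ⟨γ₁, (y' | y'), γ₂, h, h', e⟩
      · obtain ⟨i, g, m, hi, hj, -, -⟩ := mem_glueLeft_inl.1 h
        exact (y.2 _ _ hj).elim
      · obtain ⟨rfl, e'⟩ := mem_glueLeft_inr.1 h
        obtain rfl := Subtype.ext e'
        dsimp only at e
        rw [mul_one] at e
        rwa [e]

end Pushout

/-! ### Pushouts along cofibrations, in the category of families -/

section PushoutCat

variable {A B D : Fam X G} {f : A ⟶ B} {g : A ⟶ D} {W : D.tw.ι → Set (X.Obj G)}

/-- The pushout of families. -/
abbrev glue (hW : IsRefinement (toRel f) (toRel g) W) : Fam X G := ⟨glueTw hW⟩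

/-- The map from `B` to the pushout. -/
noncomputable def glueInl (hf : cof X G f) (hW : IsRefinement (toRel f) (toRel g) W) :
    B ⟶ glue hW :=
  ofRel (glueLeft hW)
    (glueLeft_isSubRel (toRel_isSubRel f) (toRel_isSubRel g) ((cof_iff f).1 hf).2)

/-- The map from `D` to the pushout. -/
noncomputable def glueInr (hW : IsRefinement (toRel f) (toRel g) W) : D ⟶ glue hW :=
  ofRel (glueRight hW) glueRight_isSubRel

lemma toRel_glueInl (hf : cof X G f) (hW : IsRefinement (toRel f) (toRel g) W) :
    toRel (glueInl hf hW) = glueLeft hW := toRel_ofRel _ _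

lemma toRel_glueInr (hW : IsRefinement (toRel f) (toRel g) W) :
    toRel (glueInr hW) = glueRight hW := toRel_ofRel _ _

lemma glueInr_cof (hW : IsRefinement (toRel f) (toRel g) W) : cof X G (glueInr hW) := by
  rw [cof_iff, toRel_glueInr]
  exact ⟨glueRight_isCov, glueRight_isInj⟩

lemma glue_isPushout (hf : cof X G f) (hW : IsRefinement (toRel f) (toRel g) W) :
    IsPushout f g (glueInl hf hW) (glueInr hW) := by
  have hcomm : ∀ s : PushoutCocone f g,
      compRel (toRel f) (toRel s.inl) = compRel (toRel g) (toRel s.inr) := fun s => by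
    rw [← toRel_comp, ← toRel_comp, s.condition]
  refine ⟨⟨toRel_injective ?_⟩, ⟨PushoutCocone.IsColimit.mk _
    (fun s => ofRel (glueDesc hW (toRel s.inl) (toRel s.inr))
      (glueDesc_isSubRel (toRel_isSubRel _) (toRel_isSubRel _)))
    (fun s => toRel_injective ?_) (fun s => toRel_injective ?_) fun s m h1 h2 =>
      toRel_injective ?_⟩⟩
  · rw [toRel_comp, toRel_comp, toRel_glueInl, toRel_glueInr]
    exact glue_comm ((cof_iff f).1 hf).2
  · rw [toRel_comp, toRel_ofRel, toRel_glueInl]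
    exact glueLeft_desc (toRel_isSubRel _) (toRel_isSubRel _) (toRel_isSubRel _) (hcomm s)
  · rw [toRel_comp, toRel_ofRel, toRel_glueInr]
    exact glueRight_desc (toRel_isSubRel _) (toRel_isSubRel _) (hcomm s)
  · rw [toRel_ofRel]
    refine eq_glueDesc (toRel_isSubRel m) ?_ ?_
    · rw [← h1, toRel_comp, toRel_glueInl]
    · rw [← h2, toRel_comp, toRel_glueInr]

lemma exists_refinement (hf : cof X G f) (g : A ⟶ D) :
    ∃ W, IsRefinement (toRel f) (toRel g) W :=
  exists_isRefinement (toRel_isSubRel f) (toRel_isSubRel g) ((cof_iff f).1 hf).1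

end PushoutCat

/-! ### The gluing axiom -/

section Gluing

variable {A B D A' B' D' : Fam X G} {f : A ⟶ B} {g : A ⟶ D} {f' : A' ⟶ B'} {g' : A' ⟶ D'}
  {W : D.tw.ι → Set (X.Obj G)} {W' : D'.tw.ι → Set (X.Obj G)}

/-- The composites with the two maps into the pushout determine `q`: on the parts it is read off
from `d`, on the unused members of `B` from `b`. -/
lemma weq_glue (hf : cof X G f) (hf' : cof X G f') (hW : IsRefinement (toRel f) (toRel g) W)
    (hW' : IsRefinement (toRel f') (toRel g') W') {a : A ⟶ A'} {b : B ⟶ B'} {d : D ⟶ D'}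
    {q : glue hW ⟶ glue hW'} (ha : weq X G a) (hb : weq X G b) (hd : weq X G d)
    (h1 : f ≫ b = a ≫ f') (h2 : glueInl hf hW ≫ q = b ≫ glueInl hf' hW')
    (h3 : glueInr hW ≫ q = d ≫ glueInr hW') : weq X G q := by
  rw [weq_iff] at ha hb hd
  have hq := toRel_isSubRel q
  -- This and `claim'`: across `b`, members of `B` with a copy in `A` correspond to members of `B'`
  -- with a copy in `A'`. Hence unused members correspond to unused members.
  have claim : ∀ {j₀ β j' i' m'}, (j₀, β, j') ∈ toRel b → (i', m', j') ∈ toRel f' →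
      ∃ i m, (i, m, j₀) ∈ toRel f := by
    intro j₀ β j' i' m' hb' hf'
    obtain ⟨i, α, hi⟩ := ha.2.2 i'
    have : (i, m' * α, j') ∈ toRel (f ≫ b) := by
      rw [h1]
      exact mem_comp_iff.2 ⟨_, _, _, hi, hf', rfl⟩
    obtain ⟨m, j, β', hj, hj', -⟩ := mem_comp_iff.1 this
    obtain ⟨rfl, rfl⟩ := hb.2.1 hb' hj'
    exact ⟨i, m, hj⟩
  have claim' : ∀ {j₀ β j' i m}, (j₀, β, j') ∈ toRel b → (i, m, j₀) ∈ toRel f →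
      ∃ i' m', (i', m', j') ∈ toRel f' := by
    intro j₀ β j' i m hb' hf
    have : (i, β * m, j') ∈ toRel (a ≫ f') := by
      rw [← h1]
      exact mem_comp_iff.2 ⟨_, _, _, hf, hb', rfl⟩
    obtain ⟨m, j, β', hj, hj', -⟩ := mem_comp_iff.1 this
    exact ⟨_, _, hj'⟩
  have hinr : ∀ {x γ y}, (x, γ, y) ∈ toRel (glueInr hW ≫ q) ↔
      ∃ w, (Sum.inl ⟨x, w⟩, γ, y) ∈ toRel q := by
    intro x γ y
    rw [mem_comp_iff, toRel_glueInr]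
    constructor
    · rintro ⟨γ₁, (⟨k, w⟩ | y), γ₂, h, h', rfl⟩
      · obtain ⟨rfl, rfl⟩ := mem_glueRight_inl.1 h
        rw [mul_one]
        exact ⟨w, h'⟩
      · exact h.elim
    · rintro ⟨w, h⟩
      exact ⟨1, _, γ, mem_glueRight_inl.2 ⟨rfl, rfl⟩, h, (mul_one _).symm⟩
  have hinl : ∀ {x : Compl (toRel f)} {γ y}, (x.1, γ, y) ∈ toRel (glueInl hf hW ≫ q) ↔
      (Sum.inr x, γ, y) ∈ toRel q := by
    intro x γ y
    rw [mem_comp_iff, toRel_glueInl]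
    constructor
    · rintro ⟨γ₁, (⟨k, w⟩ | y), γ₂, h, h', rfl⟩
      · obtain ⟨i, g, m, hi, hj, -, -⟩ := mem_glueLeft_inl.1 h
        exact (x.2 _ _ hj).elim
      · obtain ⟨rfl, e⟩ := mem_glueLeft_inr.1 h
        obtain rfl := Subtype.ext e
        rwa [mul_one]
    · intro h
      exact ⟨1, _, γ, mem_glueLeft_inr.2 ⟨rfl, rfl⟩, h, (mul_one _).symm⟩
  have hd' : IsInj (toRel (glueInr hW ≫ q)) := by
    rw [h3]
    exact isInj_comp hd.2.1 ((cof_iff _).1 (glueInr_cof hW')).2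
  have hcov' : IsCov (toRel (glueInr hW ≫ q)) := by
    rw [h3]
    exact isCov_comp hd.1 ((cof_iff _).1 (glueInr_cof hW')).1
  refine (weq_iff q).2 ⟨?_, ?_, ?_⟩
  · rintro (⟨k, w⟩ | j₀) c hc
    -- The copies in `d_k` cover the part `w`; those from other parts are disjoint from `w` and
    -- contribute nothing.
    · have key := hcov'.inf_le (toRel_isSubRel _) (i := k) (x := w.1) (c := c) (by
        intro γ y hy
        obtain ⟨w', hw'⟩ := hinr.1 hy
        by_cases e : w' = w
        · subst e
          exact inf_le_left.trans (hc γ y hw')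
        · have hle := hq.le hw'
          have := (hW.disj w'.2 w.2 (fun e' => e (Subtype.ext e'))).mono_left hle
          exact (this.le_bot).trans bot_le)
      rwa [inf_eq_right.2 (hW.le w.2)] at key
    · refine hb.1 j₀.1 c fun β j' hj' => ?_
      have hj'' : ∀ i' m', (i', m', j') ∉ toRel f' := fun i' m' h => by
        obtain ⟨i, m, hm⟩ := claim hj' h
        exact j₀.2 _ _ hm
      refine hc β (Sum.inr ⟨j', hj''⟩) (hinl.1 ?_)
      rw [h2, mem_comp_iff, toRel_glueInl]
      exact ⟨_, _, 1, hj', mem_glueLeft_inr.2 ⟨rfl, rfl⟩, (one_mul _).symm⟩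
  -- With `hr`: the relation `q` joins parts with parts and unused members with unused members only.
  · have hl : ∀ {x : Compl (toRel f)} {γ} {y : Σ k, W' k}, (Sum.inr x, γ, Sum.inl y) ∉ toRel q := by
      intro x γ y h
      have := hinl.2 h
      rw [h2, mem_comp_iff, toRel_glueInl] at this
      obtain ⟨β, j', γ', hj', hy, -⟩ := this
      obtain ⟨i', g', m', hi', hj'', -, -⟩ := mem_glueLeft_inl.1 hy
      obtain ⟨i, m, hm⟩ := claim hj' hj''
      exact x.2 _ _ hm
    have hr : ∀ {x : Σ k, W k} {γ} {y : Compl (toRel f')},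
        (Sum.inl x, γ, Sum.inr y) ∉ toRel q := by
      intro x γ y h
      have : (x.1, γ, Sum.inr y) ∈ toRel (glueInr hW ≫ q) := hinr.2 ⟨x.2, h⟩
      rw [h3, mem_comp_iff, toRel_glueInr] at this
      obtain ⟨β, j', γ', hj', hy, -⟩ := this
      exact hy.elim
    rintro x γ x' γ' (y | y) h h'
    · rcases x with ⟨k, w⟩ | x
      swap
      · exact (hl h).elim
      rcases x' with ⟨k', w'⟩ | x'
      swap
      · exact (hl h').elim
      obtain ⟨rfl, rfl⟩ := hd' (hinr.2 ⟨w, h⟩) (hinr.2 ⟨w', h'⟩)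
      refine ⟨?_, rfl⟩
      by_cases e : w = w'
      · rw [e]
      · have := hW.disj w.2 w'.2 (fun e' => e (Subtype.ext e')) (hq.le h) (hq.le h')
        exact (smul_obj_ne_bot _ _ _ (le_bot_iff.1 this)).elim
    · rcases x with x | x
      · exact (hr h).elim
      rcases x' with x' | x'
      · exact (hr h').elim
      have key : ∀ {x : Compl (toRel f)} {γ}, (Sum.inr x, γ, Sum.inr y) ∈ toRel q →
          (x.1, γ, y.1) ∈ toRel b := by
        intro x γ h
        have := hinl.2 h
        rw [h2, mem_comp_iff, toRel_glueInl] at this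
        obtain ⟨β, j', γ', hj', hy, rfl⟩ := this
        obtain ⟨rfl, rfl⟩ := mem_glueLeft_inr.1 hy
        rwa [one_mul]
      obtain ⟨e, rfl⟩ := hb.2.1 (key h) (key h')
      exact ⟨by rw [Subtype.ext e], rfl⟩
  · rintro (y | y)
    · obtain ⟨k, δ, hk⟩ := hd.2.2 y.1
      have : (k, δ, Sum.inl y) ∈ toRel (glueInr hW ≫ q) := by
        rw [h3, mem_comp_iff, toRel_glueInr]
        exact ⟨_, _, 1, hk, mem_glueRight_inl.2 ⟨rfl, rfl⟩, (one_mul _).symm⟩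
      obtain ⟨w, hw⟩ := hinr.1 this
      exact ⟨_, _, hw⟩
    · obtain ⟨j, β, hj⟩ := hb.2.2 y.1
      have hj₀ : ∀ i m, (i, m, j) ∉ toRel f := fun i m h => by
        obtain ⟨i', m', hm⟩ := claim' hj h
        exact y.2 _ _ hm
      refine ⟨Sum.inr ⟨j, hj₀⟩, β, hinl.1 ?_⟩
      rw [h2, mem_comp_iff, toRel_glueInl]
      exact ⟨_, _, 1, hj, mem_glueLeft_inr.2 ⟨rfl, rfl⟩, (one_mul _).symm⟩

end Gluing

variable (X G) in
-- Every pushout along a cofibration is isomorphic to an explicit one, and isomorphisms are weak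
-- equivalences, so it suffices to treat `glue`.
lemma isWaldhausen : IsWaldhausen (cof X G) (weq X G) where
  hasZero := ⟨⟨zeroFam, isZero_zeroFam⟩⟩
  cof_of_iso f _ := weq.cof (weq_of_isIso f)
  cof_comp _ _ hf hg := cof_comp hf hg
  cof_of_zero f hZ := by
    have := (isZero_iff _).1 hZ
    refine (cof_iff f).2 ⟨fun i => isEmptyElim i, fun i => isEmptyElim i⟩
  hasPushout f g hf := by
    obtain ⟨W, hW⟩ := exists_refinement hf g
    exact (glue_isPushout hf hW).hasPushout
  cof_pushout {A B D Q f g i j} h hf := by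
    obtain ⟨W, hW⟩ := exists_refinement hf g
    have h' := glue_isPushout hf hW
    rw [← IsPushout.inr_isoIsPushout_hom _ _ h' h]
    exact cof_comp (glueInr_cof hW) (weq.cof (weq_of_isIso _))
  we_of_iso f _ := weq_of_isIso f
  we_comp _ _ hf hg := weq_comp hf hg
  gluing {A B D Q A' B' D' Q' f g i j f' g' i' j'} a b d q h h' hf hf' ha hb hd e₁ _ e₃ e₄ := by
    obtain ⟨W, hW⟩ := exists_refinement hf g
    obtain ⟨W', hW'⟩ := exists_refinement hf' g'
    let α := IsPushout.isoIsPushout _ _ (glue_isPushout hf hW) h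
    let β := IsPushout.isoIsPushout _ _ (glue_isPushout hf' hW') h'
    have hq : weq X G (α.hom ≫ q ≫ β.inv) := by
      refine weq_glue hf hf' hW hW' ha hb hd e₁ ?_ ?_
      · rw [IsPushout.inl_isoIsPushout_hom_assoc, reassoc_of% e₃, IsPushout.inl_isoIsPushout_inv]
      · rw [IsPushout.inr_isoIsPushout_hom_assoc, reassoc_of% e₄, IsPushout.inr_isoIsPushout_inv]
    have : q = α.inv ≫ (α.hom ≫ q ≫ β.inv) ≫ β.hom := by simp
    rw [this]
    exact weq_comp (weq_of_isIso _) (weq_comp hq (weq_of_isIso _))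

end SpaceForm

end ScissorsCongruence

/-! ### From `K_0` to the scissors congruence group -/

namespace ScissorsCongruence

namespace SpaceForm

variable {X : SpaceForm} {G : Subgroup (Equiv.Perm X.Pt)}

open Classical in
/-- The class of a polytope, or `0` for the empty set, in the scissors congruence group. -/
noncomputable def cls (P : X.Obj G) : X.ScissorsGroup G :=
  if h : P.carrier.Nonempty then ScissorsGroup.of X G ⟨P.carrier, P.isSimplexUnion, h⟩ else 0

lemma cls_bot : cls (⊥ : X.Obj G) = 0 := dif_neg (by simp [Obj.bot_carrier])

lemma cls_of_nonempty {P : X.Obj G} (h : P.carrier.Nonempty) :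
    cls P = ScissorsGroup.of X G ⟨P.carrier, P.isSimplexUnion, h⟩ := dif_pos h

/-- The empty set is not a generator of the scissors congruence group, so it is treated apart;
otherwise this is a defining relation. -/
lemma cls_sup {P Q : X.Obj G} (h : Disjoint P Q) : cls (P ⊔ Q) = cls P + cls Q := by
  by_cases hP : P = ⊥
  · rw [hP, bot_sup_eq, cls_bot, zero_add]
  by_cases hQ : Q = ⊥
  · rw [hQ, sup_bot_eq, cls_bot, add_zero]
  have hP' := Obj.ne_bot_iff.1 hP
  have hQ' := Obj.ne_bot_iff.1 hQ
  have hPQ : (P ⊔ Q).carrier.Nonempty := hP'.mono Set.subset_union_left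
  rw [cls_of_nonempty hP', cls_of_nonempty hQ', cls_of_nonempty hPQ]
  refine QuotientAddGroup.eq_iff_sub_mem.2 (AddSubgroup.subset_closure (Or.inr ?_))
  exact ⟨⟨_, P.isSimplexUnion, hP'⟩, ⟨_, Q.isSimplexUnion, hQ'⟩, ⟨_, (P ⊔ Q).isSimplexUnion, hPQ⟩,
    Obj.disjoint_iff_vol.1 h, rfl, rfl⟩

lemma cls_finset_sup {ι : Type*} (t : Finset ι) (U : ι → X.Obj G)
    (h : ∀ i ∈ t, ∀ j ∈ t, i ≠ j → Disjoint (U i) (U j)) :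
    cls (t.sup U) = ∑ i ∈ t, cls (U i) := by
  classical
  induction t using Finset.induction_on with
  | empty => simpa using cls_bot
  | insert a t ha ih =>
    rw [Finset.sup_insert, Finset.sum_insert ha, cls_sup, ih]
    · exact fun i hi j hj => h i (Finset.mem_insert_of_mem hi) j (Finset.mem_insert_of_mem hj)
    · refine Finset.disjoint_sup_right.2 fun i hi => h a (Finset.mem_insert_self _ _) i
        (Finset.mem_insert_of_mem hi) ?_
      rintro rfl
      exact ha hi

variable [hG : Fact (G ≤ X.isometryGroup)]

lemma cls_smul (g : G) (P : X.Obj G) : cls (g • P) = cls P := by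
  by_cases hP : P.carrier.Nonempty
  · have hgP : (g • P).carrier.Nonempty := hP.image _
    rw [cls_of_nonempty hP, cls_of_nonempty hgP]
    refine Eq.symm ?_
    refine QuotientAddGroup.eq_iff_sub_mem.2 (AddSubgroup.subset_closure (Or.inl ?_))
    exact ⟨⟨_, P.isSimplexUnion, hP⟩, ⟨_, (g • P).isSimplexUnion, hgP⟩, g.1, g.2, rfl, rfl⟩
  · have hP : P = ⊥ := by
      by_contra h
      exact hP (Obj.ne_bot_iff.1 h)
    rw [hP, Obj.smul_bot]

/-- The sum of the classes of the members of a family. -/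
noncomputable def famCls (A : Fam X G) : X.ScissorsGroup G := ∑ᶠ i, cls (A.tw.obj i)

lemma famCls_eq_sum (A : Fam X G) [Fintype A.tw.ι] : famCls A = ∑ i, cls (A.tw.obj i) :=
  finsum_eq_sum_of_fintype _

open Classical in
-- Each `a_i` is the disjoint join of its copies, whose classes are those of the `b_j`. By
-- injectivity every `b_j` that is used occurs exactly once in the total.
lemma famCls_of_cof {A B : Fam X G} [Fintype B.tw.ι] {f : A ⟶ B} (hf : cof X G f) :
    famCls A = ∑ j : {j : B.tw.ι // ∃ i g, (i, g, j) ∈ toRel f}, cls (B.tw.obj j.1) := by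
  have := A.tw.fin
  cases nonempty_fintype A.tw.ι
  obtain ⟨hcov, hinj⟩ := (cof_iff f).1 hf
  have hR := toRel_isSubRel f
  let F := hR.finite.toFinset
  have memF : ∀ {x}, x ∈ F ↔ x ∈ toRel f := hR.finite.mem_toFinset
  have h1 : ∀ i, cls (A.tw.obj i) = ∑ x ∈ F with x.1 = i, cls (B.tw.obj x.2.2) := by
    intro i
    have e : A.tw.obj i = (F.filter fun x => x.1 = i).sup fun x => x.2.1⁻¹ • B.tw.obj x.2.2 := by
      refine le_antisymm (hcov i _ fun g j hj => ?_) (Finset.sup_le ?_)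
      · exact Finset.le_sup (f := fun x : A.tw.ι × G × B.tw.ι => x.2.1⁻¹ • B.tw.obj x.2.2)
          (b := (i, g, j)) (Finset.mem_filter.2 ⟨memF.2 hj, rfl⟩)
      · rintro ⟨i', g, j⟩ hx
        obtain ⟨hF, e⟩ := Finset.mem_filter.1 hx
        obtain rfl : i' = i := e
        exact hR.le (memF.1 hF)
    rw [e, cls_finset_sup]
    · exact Finset.sum_congr rfl fun x _ => cls_smul _ _
    · rintro ⟨i₁, g, j⟩ hx ⟨i₂, g', j'⟩ hx' hne
      obtain ⟨hF, e₁⟩ := Finset.mem_filter.1 hx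
      obtain ⟨hF', e₂⟩ := Finset.mem_filter.1 hx'
      obtain rfl : i₁ = i := e₁
      obtain rfl : i₂ = i₁ := e₂
      refine hR.disj (memF.1 hF) (memF.1 hF') fun e => hne ?_
      rw [e]
  rw [famCls_eq_sum, Finset.sum_congr rfl fun i _ => h1 i]
  refine (Finset.sum_fiberwise F (fun x => x.1) fun x => cls (B.tw.obj x.2.2)).trans ?_
  refine Finset.sum_bij (fun x hx => ⟨x.2.2, x.1, x.2.1, memF.1 hx⟩)
    (fun _ _ => @Finset.mem_univ _ (_) _) ?_ ?_ fun _ _ => rfl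
  · rintro ⟨i, g, j⟩ hx ⟨i', g', j'⟩ hx' e
    obtain rfl : j = j' := congrArg Subtype.val e
    obtain ⟨rfl, rfl⟩ := hinj (memF.1 hx) (memF.1 hx')
    rfl
  · rintro ⟨j, i, g, h⟩ -
    exact ⟨(i, g, j), memF.2 h, rfl⟩

lemma famCls_of_weq {A B : Fam X G} {f : A ⟶ B} (hf : weq X G f) : famCls A = famCls B := by
  classical
  have := B.tw.fin
  cases nonempty_fintype B.tw.ι
  rw [famCls_of_cof hf.cof, famCls_eq_sum B]
  exact Fintype.sum_equiv (Equiv.subtypeUnivEquiv fun j => ((weq_iff f).1 hf).2.2 j) _ _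
    fun _ => rfl

/-- A zero object has no members to cut, so only the unused members of `B` remain in the pushout. -/
lemma famCls_glue {A B Z : Fam X G} {f : A ⟶ B} {z : A ⟶ Z} (hf : cof X G f)
    {W : Z.tw.ι → Set (X.Obj G)} (hW : IsRefinement (toRel f) (toRel z) W) (hZ : IsZero Z) :
    famCls B = famCls A + famCls (glue hW) := by
  classical
  have := (isZero_iff Z).1 hZ
  have := B.tw.fin
  cases nonempty_fintype B.tw.ι
  have e : famCls (glue hW) =
      ∑ j : {j : B.tw.ι // ¬ ∃ i g, (i, g, j) ∈ toRel f}, cls (B.tw.obj j.1) := by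
    let : Fintype (glue hW).tw.ι := @Fintype.ofFinite _ (glue hW).tw.fin
    rw [famCls_eq_sum]
    refine Fintype.sum_equiv ((Equiv.emptySum _ _).trans
      (Equiv.subtypeEquivRight fun j => by push Not; rfl)) _ _ ?_
    rintro (⟨k, -⟩ | j)
    · exact (IsEmpty.false k).elim
    · rfl
  rw [famCls_of_cof hf, e, famCls_eq_sum]
  exact (Fintype.sum_subtype_add_sum_subtype _ fun j => cls (B.tw.obj j)).symm

variable (X G) in
/-- The homomorphism from `K_0` to the scissors congruence group. -/
noncomputable def fromK0 : K0 (cof X G) (weq X G) →+ X.ScissorsGroup G :=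
  QuotientAddGroup.lift _ (FreeAbelianGroup.lift famCls) (by
    rw [AddSubgroup.closure_le]
    rintro x (⟨A, B, f, hf, rfl⟩ | ⟨A, B, Q, Z, f, z, g, y, hf, hZ, h, rfl⟩)
    · simp [AddMonoidHom.mem_ker, famCls_of_weq hf]
    · obtain ⟨W, hW⟩ := exists_refinement hf z
      have e := famCls_of_weq
        (weq_of_isIso (IsPushout.isoIsPushout _ _ (glue_isPushout hf hW) h).hom)
      simp [AddMonoidHom.mem_ker, famCls_glue hf hW hZ, e])

lemma fromK0_of (A : Fam X G) : fromK0 X G (K0.of _ _ A) = famCls A := by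
  change FreeAbelianGroup.lift famCls (FreeAbelianGroup.of A) = _
  simp

/-! ### `K_0` is generated by the single polytopes -/

/-- The class of a family in `K_0`. -/
noncomputable abbrev kcls (A : Fam X G) : K0 (cof X G) (weq X G) := K0.of _ _ A

lemma kcls_of_weq {A B : Fam X G} {f : A ⟶ B} (hf : weq X G f) : kcls A = kcls B :=
  QuotientAddGroup.eq_iff_sub_mem.2 (AddSubgroup.subset_closure (Or.inl ⟨A, B, f, hf, rfl⟩))

section Reindex

variable {A B : Fam X G} {e : A.tw.ι → B.tw.ι} {g : A.tw.ι → G}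

/-- The relation which identifies members of a family with translates of members of another. -/
def reindexRel (e : A.tw.ι → B.tw.ι) (g : A.tw.ι → G) : FamRel A.tw B.tw :=
  Set.range fun i => (i, g i, e i)

lemma mem_reindexRel {i : A.tw.ι} {k : G} {j : B.tw.ι} :
    (i, k, j) ∈ reindexRel e g ↔ g i = k ∧ e i = j := by
  constructor
  · rintro ⟨i', h⟩
    simp only [Prod.mk.injEq] at h
    obtain ⟨rfl, rfl, rfl⟩ := h
    exact ⟨rfl, rfl⟩
  · rintro ⟨rfl, rfl⟩
    exact ⟨i, rfl⟩

lemma reindexRel_isSubRel (h : ∀ i, g i • A.tw.obj i = B.tw.obj (e i)) :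
    IsSubRel (reindexRel e g) where
  finite := by
    have := A.tw.fin
    exact Set.finite_range _
  le := by
    intro i k j hj
    obtain ⟨rfl, rfl⟩ := mem_reindexRel.1 hj
    rw [← h, inv_smul_smul]
  disj := by
    intro i k j k' j' hj hj' hne
    obtain ⟨rfl, rfl⟩ := mem_reindexRel.1 hj
    obtain ⟨rfl, rfl⟩ := mem_reindexRel.1 hj'
    exact (hne rfl).elim

lemma reindexRel_isCov (h : ∀ i, g i • A.tw.obj i = B.tw.obj (e i)) :
    IsCov (reindexRel e g) := by
  intro i c hc
  have := hc _ _ (mem_reindexRel.2 ⟨rfl, rfl⟩)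
  rwa [← h, inv_smul_smul] at this

lemma reindexRel_isInj (he : Function.Injective e) : IsInj (reindexRel e g) := by
  intro i k i' k' j hj hj'
  obtain ⟨rfl, rfl⟩ := mem_reindexRel.1 hj
  obtain ⟨rfl, e'⟩ := mem_reindexRel.1 hj'
  obtain rfl := he e'
  exact ⟨rfl, rfl⟩

/-- The morphism which identifies members of a family with translates of members of another. -/
noncomputable def reindex (h : ∀ i, g i • A.tw.obj i = B.tw.obj (e i)) : A ⟶ B :=
  ofRel (reindexRel e g) (reindexRel_isSubRel h)

lemma reindex_cof (h : ∀ i, g i • A.tw.obj i = B.tw.obj (e i)) (he : Function.Injective e) :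
    cof X G (reindex h) := by
  rw [cof_iff, reindex, toRel_ofRel]
  exact ⟨reindexRel_isCov h, reindexRel_isInj he⟩

/-- Translating the members one by one is a weak equivalence in which nothing is cut. -/
lemma kcls_eq_of_equiv {A B : Fam X G} (e : A.tw.ι ≃ B.tw.ι) (g : A.tw.ι → G)
    (h : ∀ i, g i • A.tw.obj i = B.tw.obj (e i)) : kcls A = kcls B := by
  refine kcls_of_weq (f := reindex (e := e) h) ?_
  rw [weq_iff, reindex, toRel_ofRel]
  refine ⟨reindexRel_isCov h, reindexRel_isInj e.injective, fun j =>
    ⟨e.symm j, g (e.symm j), ?_⟩⟩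
  exact mem_reindexRel.2 ⟨rfl, e.apply_symm_apply j⟩

end Reindex

/-- The part of a family given by a subset of its index set. -/
def restr (A : Fam X G) (s : Set A.tw.ι) : Fam X G :=
  ⟨⟨s, have := A.tw.fin; inferInstance, fun i => A.tw.obj i.1, fun i => A.tw.poly i.1⟩⟩

/-- The defining relation of `K_0` for the explicit cofiber, which is the subfamily of unused
members up to reindexing. -/
lemma kcls_of_cof {A B : Fam X G} {f : A ⟶ B} (hf : cof X G f) :
    kcls B = kcls A + kcls (restr B {j | ∀ i g, (i, g, j) ∉ toRel f}) := by
  have hZ := isZero_zeroFam (X := X) (G := G)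
  let z : A ⟶ zeroFam := hZ.from_ A
  obtain ⟨W, hW⟩ := exists_refinement hf z
  have h1 : kcls B = kcls A + kcls (glue hW) :=
    QuotientAddGroup.eq_iff_sub_mem.2 (AddSubgroup.subset_closure (Or.inr
      ⟨A, B, _, _, f, z, _, _, hf, hZ, glue_isPushout hf hW, rfl⟩))
  rw [h1]
  congr 1
  have : IsEmpty (zeroFam : Fam X G).tw.ι := (isZero_iff _).1 hZ
  refine kcls_eq_of_equiv (Equiv.emptySum _ _) (fun _ => 1) ?_
  rintro (⟨k, -⟩ | j)
  · exact (IsEmpty.false k).elim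
  · exact one_smul _ _

/-- The cofiber of the identity is again an empty family, so `[A] = [A] + [A]`. -/
lemma kcls_of_isEmpty (A : Fam X G) [IsEmpty A.tw.ι] : kcls A = 0 := by
  have h := kcls_of_cof (weq_of_isIso (𝟙 A)).cof
  have (s : Set A.tw.ι) : IsEmpty (restr A s).tw.ι :=
    ⟨fun i => isEmptyElim (α := A.tw.ι) i.1⟩
  rwa [left_eq_add, ← kcls_eq_of_equiv (A := A) (Equiv.equivOfIsEmpty _ _) (fun _ => 1)
    fun i => isEmptyElim i] at h

/-- The class of a polytope in `K_0`. -/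
noncomputable def kone (P : X.Obj G) (hP : IsPolytope P) : K0 (cof X G) (weq X G) :=
  kcls (SC.single (isPolytopeComplex X G) P hP)

/-- The inclusion of a subfamily is a cofibration. When one member is added, its cofiber is the
family with that member alone. -/
lemma kcls_restr (A : Fam X G) (s : Finset A.tw.ι) :
    kcls (restr A (s : Set A.tw.ι)) = ∑ i ∈ s, kone (A.tw.obj i) (A.tw.poly i) := by
  classical
  induction s using Finset.induction_on with
  | empty =>
    have : IsEmpty (restr A ((∅ : Finset A.tw.ι) : Set A.tw.ι)).tw.ι :=
      ⟨fun i => Finset.notMem_empty _ i.2⟩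
    rw [Finset.sum_empty, kcls_of_isEmpty]
  | insert a s ha ih =>
    rw [Finset.sum_insert ha, ← ih]
    let e : (restr A (s : Set A.tw.ι)).tw.ι →
        (restr A ((insert a s : Finset A.tw.ι) : Set A.tw.ι)).tw.ι := fun i =>
      ⟨i.1, Finset.mem_coe.2 (Finset.mem_insert_of_mem (Finset.mem_coe.1 i.2))⟩
    have he : Function.Injective e := fun i j h => by
      have h' : (e i).1 = (e j).1 := by rw [h]
      exact Subtype.ext h'
    have h : ∀ i, (fun _ => (1 : G)) i • (restr A (s : Set A.tw.ι)).tw.obj i =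
        (restr A ((insert a s : Finset A.tw.ι) : Set A.tw.ι)).tw.obj (e i) :=
      fun i => one_smul _ _
    rw [kcls_of_cof (reindex_cof h he), add_comm]
    congr 1
    have hmem : ∀ j : (restr A ((insert a s : Finset A.tw.ι) : Set A.tw.ι)).tw.ι,
        (∀ i g, (i, g, j) ∉ toRel (reindex (e := e) h)) ↔ j.1 = a := by
      intro j
      rw [reindex, toRel_ofRel]
      constructor
      · intro hj
        by_contra hja
        have hjs : j.1 ∈ s := (Finset.mem_insert.1 (Finset.mem_coe.1 j.2)).resolve_left hja
        exact hj ⟨j.1, hjs⟩ 1 (mem_reindexRel.2 ⟨rfl, rfl⟩)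
      · intro hja i g hi
        obtain ⟨-, h'⟩ := mem_reindexRel.1 hi
        have h'' : (e i).1 = j.1 := by rw [h']
        rw [hja] at h''
        exact ha (h'' ▸ i.2)
    have hu : ∀ j : (restr (restr A ((insert a s : Finset A.tw.ι) : Set A.tw.ι))
        {j | ∀ i g, (i, g, j) ∉ toRel (reindex (e := e) h)}).tw.ι, j.1.1 = a :=
      fun j => (hmem j.1).1 j.2
    refine kcls_eq_of_equiv
      { toFun := fun _ => ()
        invFun := fun _ => ⟨⟨a, Finset.mem_coe.2 (Finset.mem_insert_self a s)⟩, (hmem _).2 rfl⟩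
        left_inv := fun j => Subtype.ext (Subtype.ext (hu j).symm)
        right_inv := fun _ => rfl } (fun _ => 1) fun j => ?_
    rw [one_smul]
    exact congrArg A.tw.obj (hu j)

lemma kcls_eq_sum (A : Fam X G) [Fintype A.tw.ι] :
    kcls A = ∑ i, kone (A.tw.obj i) (A.tw.poly i) := by
  rw [← kcls_restr A Finset.univ]
  exact kcls_eq_of_equiv ((Equiv.Set.univ _).symm.trans
    (Equiv.setCongr Finset.coe_univ.symm)) (fun _ => 1) fun i => one_smul _ _

lemma kone_smul {P Q : X.Obj G} (hP : IsPolytope P) (hQ : IsPolytope Q) (g : G) (h : g • P = Q) :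
    kone P hP = kone Q hQ :=
  kcls_eq_of_equiv (Equiv.refl Unit) (fun _ => g) fun _ => h

/-- The family with two members. -/
def pair {P Q : X.Obj G} (hP : IsPolytope P) (hQ : IsPolytope Q) : Fam X G :=
  ⟨⟨Bool, inferInstance, fun b => bif b then P else Q, by rintro (_ | _) <;> assumption⟩⟩

/-- Cutting `P ⊔ Q` along the identity of `G` into the family of `P` and `Q` is a weak equivalence,
and a family is the sum of its members in `K_0`. -/
lemma kone_sup {P Q : X.Obj G} (hP : IsPolytope P) (hQ : IsPolytope Q) (hPQ : IsPolytope (P ⊔ Q))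
    (h : Disjoint P Q) : kone (P ⊔ Q) hPQ = kone P hP + kone Q hQ := by
  let : Fintype (pair hP hQ).tw.ι := inferInstanceAs (Fintype Bool)
  have h1 : kcls (pair hP hQ) = kone P hP + kone Q hQ := by
    rw [kcls_eq_sum]
    exact Fintype.sum_bool _
  rw [← h1]
  let A := SC.single (isPolytopeComplex X G) (P ⊔ Q) hPQ
  let R : FamRel A.tw (pair hP hQ).tw := {x | x.2.1 = 1}
  have hR : IsSubRel R := by
    refine ⟨?_, ?_, ?_⟩
    · refine ((Set.finite_univ (α := Unit)).prod ((Set.finite_singleton (1 : G)).prod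
        (Set.finite_univ (α := Bool)))).subset ?_
      exact fun x hx => ⟨trivial, hx, trivial⟩
    · rintro i g (_ | _) (rfl : g = 1)
      · rw [inv_one, one_smul]
        exact le_sup_right
      · rw [inv_one, one_smul]
        exact le_sup_left
    · rintro i g (_ | _) g' (_ | _) (rfl : g = 1) (rfl : g' = 1) hne
      · exact (hne rfl).elim
      · exact Obj.smul_disjoint.2 h.symm
      · exact Obj.smul_disjoint.2 h
      · exact (hne rfl).elim
  refine kcls_of_weq (f := (ofRel R hR : A ⟶ pair hP hQ)) ?_
  rw [weq_iff, toRel_ofRel]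
  refine ⟨fun i c hc => ?_, ?_, fun j => ⟨(), 1, rfl⟩⟩
  · have h2 := hc 1 true rfl
    have h3 := hc 1 false rfl
    rw [inv_one, one_smul] at h2 h3
    exact sup_le h2 h3
  · rintro i g i' g' j (rfl : g = 1) (rfl : g' = 1)
    exact ⟨rfl, rfl⟩

/-! ### The inverse homomorphism and the isomorphism -/

variable (X G) in
/-- The homomorphism from the scissors congruence group to `K_0`. -/
noncomputable def toK0 : X.ScissorsGroup G →+ K0 (cof X G) (weq X G) :=
  QuotientAddGroup.lift _
    (FreeAbelianGroup.lift fun P : X.Polytope => kone (P.toObj : X.Obj G) P.isPolytope_toObj) (by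
    rw [AddSubgroup.closure_le]
    rintro x (⟨P, Q, g, hg, h, rfl⟩ | ⟨P, Q, R, h, e, rfl⟩)
    · have := kone_smul (P.isPolytope_toObj (G := G)) (Q.isPolytope_toObj (G := G)) ⟨g, hg⟩
        (Obj.ext h)
      simp [AddMonoidHom.mem_ker, this]
    · have e' : (R.toObj : X.Obj G) = P.toObj ⊔ Q.toObj := Obj.ext e
      have hR := R.isPolytope_toObj (G := G)
      have : kone (R.toObj : X.Obj G) hR = kone P.toObj P.isPolytope_toObj +
          kone Q.toObj Q.isPolytope_toObj := by
        simp only [e'] at hR ⊢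
        exact kone_sup _ _ hR (Obj.disjoint_iff_vol.2 h)
      simp [AddMonoidHom.mem_ker, this])

lemma toK0_of (P : X.Polytope) :
    toK0 X G (ScissorsGroup.of X G P) = kone P.toObj P.isPolytope_toObj := by
  change FreeAbelianGroup.lift _ (FreeAbelianGroup.of P) = _
  simp

lemma toK0_cls {P : X.Obj G} (hP : IsPolytope P) : toK0 X G (cls P) = kone P hP := by
  rw [cls_of_nonempty (Obj.ne_bot_iff.1 (isPolytope_iff.1 hP)), toK0_of]
  rfl

lemma fromK0_single (P : X.Polytope) :
    fromK0 X G (K0.of _ _ (SC.single (isPolytopeComplex X G) P.toObj P.isPolytope_toObj)) =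
      ScissorsGroup.of X G P := by
  rw [fromK0_of]
  let : Fintype (SC.single (isPolytopeComplex X G) P.toObj P.isPolytope_toObj).tw.ι :=
    inferInstanceAs (Fintype Unit)
  rw [famCls_eq_sum]
  exact (Fintype.sum_unique (ι := Unit) _).trans (cls_of_nonempty P.2.2)

variable (X G) in
/-- `K_0` is isomorphic to the scissors congruence group. -/
noncomputable def k0Equiv : K0 (cof X G) (weq X G) ≃+ X.ScissorsGroup G :=
  AddMonoidHom.toAddEquiv (fromK0 X G) (toK0 X G)
    (by
      refine QuotientAddGroup.addMonoidHom_ext _ (FreeAbelianGroup.lift_ext _ _ fun A => ?_)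
      change toK0 X G (fromK0 X G (kcls A)) = kcls A
      have := A.tw.fin
      cases nonempty_fintype A.tw.ι
      -- Both sides are sums over the members of the family, which reduces the claim to a single
      -- polytope.
      rw [fromK0_of, famCls_eq_sum, map_sum, kcls_eq_sum]
      exact Finset.sum_congr rfl fun i _ => toK0_cls _)
    (by
      refine QuotientAddGroup.addMonoidHom_ext _ (FreeAbelianGroup.lift_ext _ _ fun P => ?_)
      change fromK0 X G (toK0 X G (ScissorsGroup.of X G P)) = ScissorsGroup.of X G P
      rw [toK0_of]
      exact fromK0_single P)

end SpaceForm

end ScissorsCongruence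

theorem mainTheorem2 (X : SpaceForm) (G : Subgroup (Equiv.Perm X.Pt))
    (hG : G ≤ X.isometryGroup) :
    ∃ J : CategoryTheory.GrothendieckTopology (X.Obj G),
      (∀ (P : X.Obj G) (ι : Type) (U : ι → X.Obj G) (f : ∀ i, U i ⟶ P),
        IsCovering J U f ↔ ∃ t : Finset ι, ⋃ i ∈ t, (U i).carrier = P.carrier) ∧
      ∃ h : IsPolytopeComplex J,
        IsWaldhausen (SC.cofibrations h) (SC.weakEquivalences h) ∧
        ∃ e : K0 (SC.cofibrations h) (SC.weakEquivalences h) ≃+ X.ScissorsGroup G,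
          ∀ P : X.Polytope,
            e (K0.of _ _ (SC.single h P.toObj P.isPolytope_toObj)) =
              SpaceForm.ScissorsGroup.of X G P := by
  have : Fact (G ≤ X.isometryGroup) := ⟨hG⟩
  refine ⟨SpaceForm.topology X G, fun P ι U f => ?_, SpaceForm.isPolytopeComplex X G,
    SpaceForm.isWaldhausen X G, SpaceForm.k0Equiv X G, SpaceForm.fromK0_single⟩
  rw [SpaceForm.isCovering_iff]
  refine exists_congr fun t => ?_
  rw [SpaceForm.Obj.ext_iff, SpaceForm.Obj.finset_sup_carrier]
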